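/- Let $0<\epsilon\le 1/2$ and $0<\epsilon_{small}<\epsilon_{large}\le 1$, let $N\in\mathbb N$ and let $K=[0,N]\times[0,N]$. A path corridor with $k\ge 1$ subcorridors is a simple rectilinear polygon $C\subseteq K$ with integral vertices and with $2k+2$ edges $e_0,\dots,e_{2k+1}$, in cyclic order and alternately horizontal and vertical, such that for every $i\in\{1,\dots,k\}$ the parallel edges $e_i$ and $e_{2k+2-i}$ have length at least $\epsilon_{large}N/2$ and there is a line segment orthogonal to them, of length less than $\epsilon\cdot\epsilon_{large}N$, that intersects both of them and no other edge of $C$. An item is an axis-parallel rectangle with positive integral width $w$ and height $h$; it is skewed if ($w>\epsilon_{large}N$ and $h\le\epsilon_{small}N$) or ($h>\epsilon_{large}N$ and $w\le\epsilon_{small}N$). A set of items fits non-overlappingly inside $C$ if its items can be placed as open rectangles, by translations and without rotation, inside $C$ so that they are pairwise disjoint. There is an algorithm (a single program for a random access machine whose elementary instructions are constants, addition, subtraction, indirect load and store, and tests for zero, each counted as one step) with the following property. Given $N$, a path corridor $C$ with $k$ subcorridors, a set $I_C$ of $n\ge 1$ skewed items, and a coloring of $I_C$ with colors from a set of $\gamma$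 colors, it decides in time $(nN)^{O(k/\epsilon_{large})}\cdot 2^{O(\gamma)}$ whether there is a set $I'_C\subseteq I_C$ that consists of exactly one item of each of the $\gamma$ colors and fits non-overlappingly inside $C$. The constants hidden in the $O$-notation, as well as the program, are absolute: they do not depend on $\epsilon,\epsilon_{small},\epsilon_{large},N,k,n,\gamma$ or on the instance. -/

import Mathlib

/-! ## A random access machine with a step count -/

namespace RAM

/-- A configuration: finitely many registers are named by a program (each addressed directly), and
the memory cells are reached only through addresses held in registers. All of them hold natural
numbers. -/
structure State where
  reg : ℕ → ℕ
  mem : ℕ → ℕ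

/-- Programs of the random access machine, in structured form. -/
inductive Prog : Type
  /-- do nothing -/
  | skip : Prog
  /-- `reg r := c` -/
  | const (r c : ℕ) : Prog
  /-- `reg r := reg a + reg b` -/
  | add (r a b : ℕ) : Prog
  /-- `reg r := reg a - reg b` (truncated at `0`) -/
  | sub (r a b : ℕ) : Prog
  /-- `reg r := mem (reg a)` -/
  | load (r a : ℕ) : Prog
  /-- `mem (reg a) := reg b` -/
  | store (a b : ℕ) : Prog
  /-- first `p`, then `q` -/
  | seq (p q : Prog) : Prog
  /-- if `reg r ≠ 0` then `p` else `q` -/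
  | ite (r : ℕ) (p q : Prog) : Prog
  /-- while `reg r ≠ 0` do `p` -/
  | loop (r : ℕ) (p : Prog) : Prog

def State.setReg (s : State) (r v : ℕ) : State := ⟨Function.update s.reg r v, s.mem⟩

def State.setMem (s : State) (a v : ℕ) : State := ⟨s.reg, Function.update s.mem a v⟩

/-- `Exec p s s' t`: started in `s`, the program `p` halts in `s'` after exactly `t` steps.
Every elementary instruction and every evaluation of a test is one step. -/
inductive Exec : Prog → State → State → ℕ → Prop
  | skip (s : State) : Exec .skip s s 1
  | const (s : State) (r c : ℕ) : Exec (.const r c) s (s.setReg r c) 1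
  | add (s : State) (r a b : ℕ) : Exec (.add r a b) s (s.setReg r (s.reg a + s.reg b)) 1
  | sub (s : State) (r a b : ℕ) : Exec (.sub r a b) s (s.setReg r (s.reg a - s.reg b)) 1
  | load (s : State) (r a : ℕ) : Exec (.load r a) s (s.setReg r (s.mem (s.reg a))) 1
  | store (s : State) (a b : ℕ) : Exec (.store a b) s (s.setMem (s.reg a) (s.reg b)) 1
  | seq {p q : Prog} {s s' s'' : State} {t t' : ℕ} :
      Exec p s s' t → Exec q s' s'' t' → Exec (.seq p q) s s'' (t + t')
  | ite_true {r : ℕ} {p q : Prog} {s s' : State} {t : ℕ} :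
      s.reg r ≠ 0 → Exec p s s' t → Exec (.ite r p q) s s' (t + 1)
  | ite_false {r : ℕ} {p q : Prog} {s s' : State} {t : ℕ} :
      s.reg r = 0 → Exec q s s' t → Exec (.ite r p q) s s' (t + 1)
  | loop_exit {r : ℕ} {p : Prog} {s : State} :
      s.reg r = 0 → Exec (.loop r p) s s 1
  | loop_step {r : ℕ} {p : Prog} {s s' s'' : State} {t t' : ℕ} :
      s.reg r ≠ 0 → Exec p s s' t → Exec (.loop r p) s' s'' t' →
        Exec (.loop r p) s s'' (t + t' + 1)

/-- The input list stands in the cells `0, 1, 2, …`; everything else is `0`. -/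
def init (input : List ℕ) : State := ⟨fun _ => 0, fun a => input.getD a 0⟩

/-- On `input`, the program `p` halts within `T` steps, and register `0` then holds the truth value
(`1` or `0`) of `answer`. -/
def DecidesWithin (p : Prog) (input : List ℕ) (answer : Prop) (T : ℝ) : Prop :=
  ∃ (s : State) (t : ℕ), Exec p (init input) s t ∧ (t : ℝ) ≤ T ∧
    (answer → s.reg 0 = 1) ∧ (¬ answer → s.reg 0 = 0)

end RAM

/-! ## Rectilinear polygons and path corridors -/

namespace Corridor

/-- A lattice point as a point of the plane. -/
def pt (p : ℕ × ℕ) : ℝ × ℝ := ((p.1 : ℝ), (p.2 : ℝ))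

section Polygon

variable {m : ℕ} [NeZero m]

/-- The edge `e_i` of the closed polygonal curve with vertices `P 0, …, P (m - 1)`: it joins `P i`
to `P (i + 1)`, with indices modulo `m`. -/
def edge (P : Fin m → ℕ × ℕ) (i : Fin m) : Set (ℝ × ℝ) := segment ℝ (pt (P i)) (pt (P (i + 1)))

def edgeHorizontal (P : Fin m → ℕ × ℕ) (i : Fin m) : Prop :=
  (P i).2 = (P (i + 1)).2 ∧ (P i).1 ≠ (P (i + 1)).1

def edgeVertical (P : Fin m → ℕ × ℕ) (i : Fin m) : Prop :=
  (P i).1 = (P (i + 1)).1 ∧ (P i).2 ≠ (P (i + 1)).2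

/-- The length of an axis-parallel edge. -/
noncomputable def edgeLength (P : Fin m → ℕ × ℕ) (i : Fin m) : ℝ :=
  |((P (i + 1)).1 : ℝ) - (P i).1| + |((P (i + 1)).2 : ℝ) - (P i).2|

/-- Horizontal and vertical edges alternate. -/
def IsRectilinear (P : Fin m → ℕ × ℕ) : Prop :=
  ∀ i, (edgeHorizontal P i ∧ edgeVertical P (i + 1)) ∨ (edgeVertical P i ∧ edgeHorizontal P (i + 1))

/-- Consecutive edges meet only in their common vertex, and all other pairs of edges are disjoint. -/
def IsSimple (P : Fin m → ℕ × ℕ) : Prop :=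
  (∀ i, edge P i ∩ edge P (i + 1) = {pt (P (i + 1))}) ∧
    ∀ i j, i ≠ j → i + 1 ≠ j → j + 1 ≠ i → Disjoint (edge P i) (edge P j)

/-- The closed region bounded by a simple rectilinear polygon: its boundary, and the points from
which the horizontal ray to the right crosses the boundary an odd number of times (a vertical edge
counts as containing its lower but not its upper endpoint). -/
def region (P : Fin m → ℕ × ℕ) : Set (ℝ × ℝ) :=
  {p | (∃ i, p ∈ edge P i) ∨
    Odd {i : Fin m | edgeVertical P i ∧ p.1 < ((P i).1 : ℝ) ∧
      min ((P i).2 : ℝ) (P (i + 1)).2 ≤ p.2 ∧ p.2 < max ((P i).2 : ℝ) (P (i + 1)).2}.ncard}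

/-- The edges `i` and `j` are connected by an axis-parallel segment of length less than `δ`,
orthogonal to them, that meets no other edge. -/
def ConnectedByShortSegment (P : Fin m → ℕ × ℕ) (δ : ℝ) (i j : Fin m) : Prop :=
  ∃ a b : ℝ × ℝ,
    ((edgeHorizontal P i ∧ edgeHorizontal P j ∧ a.1 = b.1 ∧ |a.2 - b.2| < δ) ∨
      (edgeVertical P i ∧ edgeVertical P j ∧ a.2 = b.2 ∧ |a.1 - b.1| < δ)) ∧
    (edge P i ∩ segment ℝ a b).Nonempty ∧ (edge P j ∩ segment ℝ a b).Nonempty ∧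
    ∀ l, l ≠ i → l ≠ j → Disjoint (edge P l) (segment ℝ a b)

end Polygon

/-- `P` describes a path corridor with `k` subcorridors in the knapsack `[0, N] × [0, N]`: a simple
rectilinear polygon with edges `e_0, …, e_{2k+1}` such that, for `i = 1, …, k`, the edges `e_i` and
`e_{2k+2-i}` have length at least `εlarge N / 2` and are connected by an orthogonal segment of length
less than `ε εlarge N` meeting no other edge. -/
structure IsPathCorridor (ε εlarge : ℝ) (N k : ℕ) (P : Fin (2 * k + 2) → ℕ × ℕ) : Prop where
  one_le : 1 ≤ k
  inside : ∀ i, (P i).1 ≤ N ∧ (P i).2 ≤ N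
  rectilinear : IsRectilinear P
  simple : IsSimple P
  thin : ∀ i ∈ Finset.Icc 1 k,
    ConnectedByShortSegment P (ε * εlarge * N)
      (Fin.ofNat (2 * k + 2) i) (Fin.ofNat (2 * k + 2) (2 * k + 2 - i))
  long : ∀ i ∈ Finset.Icc 1 k,
    εlarge * N / 2 ≤ edgeLength P (Fin.ofNat (2 * k + 2) i) ∧
      εlarge * N / 2 ≤ edgeLength P (Fin.ofNat (2 * k + 2) (2 * k + 2 - i))

/-! ## Items and packings -/

/-- An item: an axis-parallel rectangle of positive integral width and height. -/
structure Item where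
  w : ℕ
  h : ℕ
  w_pos : 0 < w
  h_pos : 0 < h

/-- Skewed items are the horizontal and the vertical ones. -/
def Item.IsSkewed (εsmall εlarge : ℝ) (N : ℕ) (a : Item) : Prop :=
  (εlarge * N < a.w ∧ (a.h : ℝ) ≤ εsmall * N) ∨ (εlarge * N < a.h ∧ (a.w : ℝ) ≤ εsmall * N)

/-- The open rectangle covered by an item whose lower left corner is placed at `q`. -/
def Item.placedAt (a : Item) (q : ℝ × ℝ) : Set (ℝ × ℝ) :=
  Set.Ioo q.1 (q.1 + a.w) ×ˢ Set.Ioo q.2 (q.2 + a.h)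

/-- The items of index in `S` can be placed (without rotations) inside `R` without overlaps. -/
def Fits {n : ℕ} (I : Fin n → Item) (S : Finset (Fin n)) (R : Set (ℝ × ℝ)) : Prop :=
  ∃ pos : Fin n → ℝ × ℝ,
    (∀ i ∈ S, (I i).placedAt (pos i) ⊆ R) ∧
      ∀ i ∈ S, ∀ j ∈ S, i ≠ j → Disjoint ((I i).placedAt (pos i)) ((I j).placedAt (pos j))

/-- Some set of items that has exactly one item of each of the `γ` colors fits in `R`. -/
def ColorfulPacking {n γ : ℕ} (I : Fin n → Item) (col : Fin n → Fin γ) (R : Set (ℝ × ℝ)) : Prop :=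
  ∃ S : Finset (Fin n), (∀ d : Fin γ, ∃! i, i ∈ S ∧ col i = d) ∧ Fits I S R

/-- The input of the algorithm: `N, k, n, γ`, then the coordinates of the vertices of the polygon,
then width, height and color of each item. -/
def encode {k n γ : ℕ} (N : ℕ) (P : Fin (2 * k + 2) → ℕ × ℕ) (I : Fin n → Item)
    (col : Fin n → Fin γ) : List ℕ :=
  [N, k, n, γ] ++ (List.finRange (2 * k + 2)).flatMap (fun i => [(P i).1, (P i).2]) ++
    (List.finRange n).flatMap (fun i => [(I i).w, (I i).h, (col i : ℕ)])

end Corridor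

/-! The algorithm is a reachability search. A state records which colors have been used and a family
of at most k(q+1) boxes with integral corners in K, where q is N divided by the shortest longer side
of an item. A step places one more item at an integral position: its cells lie in the polygon, its
color is new, it avoids all old boxes, it lies in some new box, and every nonempty old box lies in a
new one.

Soundness (`Inst.Reach.sound`) needs no geometry of corridors. The boxes always cover the placed
items, so an item that avoids the boxes avoids these items, even if the boxes are much too large.

Completeness says that every packing can be built in an order for which so few boxes suffice.
Rounding all positions down keeps the items disjoint and inside the polygon. Every item is long
compared to the widths of the subcorridors, hence lies in the bounding rectangle of one subcorridor
and along its axis (`Corr.IsCorr.exists_class`). Each subcorridor is swept across its axis, always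
from the same side of the corridor. The items met by one sweep line are disjoint along the axis, so
there are at most q of them, and each gets its own box; the items already left by the line share one
bounding box. This makes q+1 boxes per subcorridor.

It remains to interleave the sweeps so that the shared boxes stay clear of all unplaced items
(`Sweep.Chain.sep_boxes`). Subcorridors that are not adjacent have rectangles with disjoint
interiors (`Corr.IsCorr.separated`). At a bend there is an order condition, whose form depends on
whether the sweep starts on the outer or the inner side. Of two items at a bend at least one may
precede the other, as otherwise they would cross. Since the subcorridors form a path, some
subcorridor is therefore always free to advance (`Sweep.Chain.exists_insert`).
`Corr.IsCorr.exists_chain` collects the geometry, and `Inst.accepts_of_boxes` turns such an order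
into a run of the search.

The geometry is integral. The polygon is described by two sides joined by two end edges
(`Corr.IsCorr`), and membership of a cell is the crossing parity `Corr.chi`. Following the boundary
edge by edge shows that distant edges never enter the rectangle of a subcorridor
(`Corr.IsCorr.avoid`); simplicity of the polygon and the crossing segments keep each edge from
passing through.

There are 2^γ (N+1)^(4k(q+1)) states with q at most 1/εlarge. The machine needs time polynomial in
this number and in the input parameters (`RAM.exists_algorithm_spec`), which gives the bound in
`Inst.time_le`. -/

/-! ## A term language for the random access machine -/

namespace RAM

/-- A term is a family of programs: at level `d` it leaves its value in register `d`, it may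
overwrite the registers from `d` on, and it changes nothing else. -/
abbrev Term := ℕ → Prog

/-- The situation in which a term is evaluated: the registers below `lvl` and the memory are known,
and running times are measured against `size`. -/
structure Ctx where
  reg : ℕ → ℕ
  mem : ℕ → ℕ
  lvl : ℕ
  size : ℕ

/-- `Δ` knows at least what `Γ` knows. -/
structure Ctx.Le (Γ Δ : Ctx) : Prop where
  lvl : Γ.lvl ≤ Δ.lvl
  reg : ∀ r < Γ.lvl, Δ.reg r = Γ.reg r
  mem : Δ.mem = Γ.mem
  size : Δ.size = Γ.size

theorem Ctx.Le.rfl {Γ : Ctx} : Γ.Le Γ := ⟨le_rfl, fun _ _ => Eq.refl _, Eq.refl _, Eq.refl _⟩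

theorem Ctx.Le.trans {Γ Δ Θ : Ctx} (h : Γ.Le Δ) (h' : Δ.Le Θ) : Γ.Le Θ :=
  ⟨h.lvl.trans h'.lvl, fun r hr => (h'.reg r (hr.trans_le h.lvl)).trans (h.reg r hr),
    h'.mem.trans h.mem, h'.size.trans h.size⟩

/-- In the context `Γ` the term `a` evaluates to `v`, within `(size + 2) ^ e` steps. -/
def Val (Γ : Ctx) (a : Term) (v e : ℕ) : Prop :=
  ∀ Δ, Γ.Le Δ → ∃ s' t, Exec (a Δ.lvl) ⟨Δ.reg, Δ.mem⟩ s' t ∧ t ≤ (Γ.size + 2) ^ e ∧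
    s'.reg Δ.lvl = v ∧ s'.mem = Γ.mem ∧ ∀ r < Δ.lvl, s'.reg r = Δ.reg r

theorem Val.mono {Γ Δ : Ctx} {a : Term} {v e : ℕ} (h : Val Γ a v e) (hl : Γ.Le Δ) :
    Val Δ a v e := by
  intro Θ hΘ
  obtain ⟨s', t, h1, h2, h3, h4, h5⟩ := h Θ (hl.trans hΘ)
  exact ⟨s', t, h1, hl.size ▸ h2, h3, h4.trans hl.mem.symm, h5⟩

theorem Val.weaken {Γ : Ctx} {a : Term} {v e e' : ℕ} (h : Val Γ a v e) (he : e ≤ e') :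
    Val Γ a v e' := by
  intro Θ hΘ
  obtain ⟨s', t, h1, h2, h3, h4, h5⟩ := h Θ hΘ
  exact ⟨s', t, h1, h2.trans (Nat.pow_le_pow_right (by omega) he), h3, h4, h5⟩

theorem Val.congr {Γ : Ctx} {a : Term} {v v' e : ℕ} (h : Val Γ a v e) (he : v = v') :
    Val Γ a v' e := he ▸ h

/-- Since the base is at least 2, two further factors absorb a sum and a constant. Running times can
therefore be tracked through exponents that simply add up. -/
theorem add_pow_le_pow {Z a b c : ℕ} (h : a ≤ (Z + 2) ^ b) (d : ℕ) (hc : c ≤ (Z + 2) ^ d) :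
    a + c + 1 ≤ (Z + 2) ^ (b + d + 2) := by
  have h1 : (Z + 2) ^ b ≤ (Z + 2) ^ (b + d) := Nat.pow_le_pow_right (by omega) (by omega)
  have h2 : (Z + 2) ^ d ≤ (Z + 2) ^ (b + d) := Nat.pow_le_pow_right (by omega) (by omega)
  have h3 : 1 ≤ (Z + 2) ^ (b + d) := Nat.one_le_pow _ _ (by omega)
  have h4 : 2 ^ 2 ≤ (Z + 2) ^ 2 := Nat.pow_le_pow_left (by omega) 2
  rw [pow_add _ (b + d) 2]
  nlinarith

def constT (c : ℕ) : Term := fun d => .const d c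

/-- There is no instruction that copies a register, so zero is added to it. -/
def varT (r : ℕ) : Term := fun d => .seq (.const d 0) (.add d r d)

def addT (a b : Term) : Term := fun d => .seq (a d) (.seq (b (d + 1)) (.add d d (d + 1)))

def subT (a b : Term) : Term := fun d => .seq (a d) (.seq (b (d + 1)) (.sub d d (d + 1)))

def readT (a : Term) : Term := fun d => .seq (a d) (.load d d)

def iteT (c a b : Term) : Term := fun d => .seq (c d) (.ite d (a d) (b d))

/-- The body of the loop of `foldT`. -/
def foldBody (body : Term → Term → Term) : Term := fun d =>
  .seq (body (varT d) (varT (d + 1)) (d + 4)) (.seq (.const d 0) (.seq (.add d (d + 4) d)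
    (.seq (.add (d + 1) (d + 1) (d + 3)) (.sub (d + 2) (d + 2) (d + 3)))))

/-- Iterates `acc ↦ body acc i` for `i = 0, …, n - 1`, starting from `init`. -/
def foldT (n init : Term) (body : Term → Term → Term) : Term := fun d =>
  -- During the loop, `d` holds the accumulator, `d + 1` the index, `d + 2` the number of remaining
  -- rounds and `d + 3` the constant 1; the body works from `d + 4` on. The start value is computed
  -- in `d + 3`, above the bound, and then moved down.
  .seq (n (d + 2)) (.seq (init (d + 3)) (.seq (.const d 0) (.seq (.add d (d + 3) d)
    (.seq (.const (d + 1) 0) (.seq (.const (d + 3) 1) (.loop (d + 2) (foldBody body d)))))))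

theorem val_const (Γ : Ctx) (c : ℕ) : Val Γ (constT c) c 0 := by
  intro Δ hΔ
  refine ⟨_, _, Exec.const _ _ _, by simp, by simp [State.setReg], by simp [State.setReg, hΔ.mem], ?_⟩
  intro r hr
  simp [State.setReg, Function.update_of_ne hr.ne]

theorem val_var {Γ : Ctx} {r : ℕ} (hr : r < Γ.lvl) : Val Γ (varT r) (Γ.reg r) 1 := by
  intro Δ hΔ
  have hrd : r < Δ.lvl := hr.trans_le hΔ.lvl
  refine ⟨_, _, Exec.seq (Exec.const _ _ _) (Exec.add _ _ _ _), by simp, ?_, ?_, ?_⟩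
  · simp [State.setReg, Function.update_of_ne hrd.ne, hΔ.reg r hr]
  · simp [State.setReg, hΔ.mem]
  · intro x hx
    simp [State.setReg, Function.update_of_ne hx.ne]

/-- After evaluating the first of two terms, the second one is evaluated one level higher. -/
theorem Val.pair {Γ : Ctx} {a b : Term} {va vb ea eb : ℕ} (ha : Val Γ a va ea) (hb : Val Γ b vb eb)
    {Δ : Ctx} (hΔ : Γ.Le Δ) : ∃ s₁ t₁ s₂ t₂, Exec (a Δ.lvl) ⟨Δ.reg, Δ.mem⟩ s₁ t₁ ∧
      Exec (b (Δ.lvl + 1)) s₁ s₂ t₂ ∧ t₁ ≤ (Γ.size + 2) ^ ea ∧ t₂ ≤ (Γ.size + 2) ^ eb ∧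
      s₂.reg Δ.lvl = va ∧ s₂.reg (Δ.lvl + 1) = vb ∧ s₂.mem = Γ.mem ∧
      ∀ r < Δ.lvl, s₂.reg r = Δ.reg r := by
  obtain ⟨s₁, t₁, h1, h2, h3, h4, h5⟩ := ha Δ hΔ
  have hl : Γ.Le ⟨s₁.reg, s₁.mem, Δ.lvl + 1, Γ.size⟩ :=
    ⟨hΔ.lvl.trans (Nat.le_succ _), fun r hr =>
      (h5 r (hr.trans_le hΔ.lvl)).trans (hΔ.reg r hr), h4, rfl⟩
  obtain ⟨s₂, t₂, g1, g2, g3, g4, g5⟩ := hb _ hl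
  refine ⟨s₁, t₁, s₂, t₂, h1, g1, h2, g2, ?_, g3, g4, fun r hr => ?_⟩
  · exact (g5 _ (Nat.lt_succ_self _)).trans h3
  · exact (g5 _ (hr.trans (Nat.lt_succ_self _))).trans (h5 r hr)

theorem Val.add {Γ : Ctx} {a b : Term} {va vb ea eb : ℕ} (ha : Val Γ a va ea) (hb : Val Γ b vb eb) :
    Val Γ (addT a b) (va + vb) (ea + eb + 2) := by
  intro Δ hΔ
  obtain ⟨s₁, t₁, s₂, t₂, h1, h2, h3, h4, h5, h6, h7, h8⟩ := Val.pair ha hb hΔ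
  refine ⟨_, _, Exec.seq h1 (Exec.seq h2 (Exec.add _ _ _ _)), ?_, ?_, ?_, ?_⟩
  · have := add_pow_le_pow h3 eb h4; omega
  · simp [State.setReg, h5, h6]
  · simp [State.setReg, h7]
  · intro r hr
    simp [State.setReg, Function.update_of_ne hr.ne, h8 r hr]

theorem Val.sub {Γ : Ctx} {a b : Term} {va vb ea eb : ℕ} (ha : Val Γ a va ea) (hb : Val Γ b vb eb) :
    Val Γ (subT a b) (va - vb) (ea + eb + 2) := by
  intro Δ hΔ
  obtain ⟨s₁, t₁, s₂, t₂, h1, h2, h3, h4, h5, h6, h7, h8⟩ := Val.pair ha hb hΔ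
  refine ⟨_, _, Exec.seq h1 (Exec.seq h2 (Exec.sub _ _ _ _)), ?_, ?_, ?_, ?_⟩
  · have := add_pow_le_pow h3 eb h4; omega
  · simp [State.setReg, h5, h6]
  · simp [State.setReg, h7]
  · intro r hr
    simp [State.setReg, Function.update_of_ne hr.ne, h8 r hr]

theorem Val.read {Γ : Ctx} {a : Term} {va ea : ℕ} (ha : Val Γ a va ea) :
    Val Γ (readT a) (Γ.mem va) (ea + 2) := by
  intro Δ hΔ
  obtain ⟨s₁, t₁, h1, h2, h3, h4, h5⟩ := ha Δ hΔ
  refine ⟨_, _, Exec.seq h1 (Exec.load _ _ _), ?_, ?_, ?_, ?_⟩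
  · have := add_pow_le_pow h2 0 (c := 0) (by simp); simpa using this
  · simp [State.setReg, h3, h4]
  · simp [State.setReg, h4]
  · intro r hr
    simp [State.setReg, Function.update_of_ne hr.ne, h5 r hr]

theorem Val.ite {Γ : Ctx} {c a b : Term} {vc va vb ec ea eb : ℕ} (hc : Val Γ c vc ec)
    (ha : vc ≠ 0 → Val Γ a va ea) (hb : vc = 0 → Val Γ b vb eb) :
    Val Γ (iteT c a b) (if vc ≠ 0 then va else vb) (ec + (ea + eb) + 2) := by
  intro Δ hΔ
  obtain ⟨s₁, t₁, h1, h2, h3, h4, h5⟩ := hc Δ hΔ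
  have hl : Γ.Le ⟨s₁.reg, s₁.mem, Δ.lvl, Γ.size⟩ :=
    ⟨hΔ.lvl, fun r hr => (h5 r (hr.trans_le hΔ.lvl)).trans (hΔ.reg r hr), h4, rfl⟩
  by_cases h : vc = 0
  · obtain ⟨s₂, t₂, g1, g2, g3, g4, g5⟩ := hb h _ hl
    refine ⟨_, _, Exec.seq h1 (Exec.ite_false (by rw [h3, h]) g1), ?_, ?_, g4, ?_⟩
    · have h2' := g2.trans (Nat.pow_le_pow_right (by omega) (Nat.le_add_left eb ea))
      have := add_pow_le_pow h2 _ h2'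
      omega
    · simp [h, g3]
    · exact fun r hr => (g5 r hr).trans (h5 r hr)
  · obtain ⟨s₂, t₂, g1, g2, g3, g4, g5⟩ := ha h _ hl
    refine ⟨_, _, Exec.seq h1 (Exec.ite_true (by rw [h3]; exact h) g1), ?_, ?_, g4, ?_⟩
    · have h2' := g2.trans (Nat.pow_le_pow_right (by omega) (Nat.le_add_right ea eb))
      have := add_pow_le_pow h2 _ h2'
      omega
    · simp [h, g3]
    · exact fun r hr => (g5 r hr).trans (h5 r hr)

/-- The body of a loop is known to work if its accumulator and its counter have the right values. -/
def BodyVal (Γ : Ctx) (body : Term → Term → Term) (F : ℕ → ℕ) (n eb : ℕ) : Prop :=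
  ∀ Δ, Γ.Le Δ → ∀ A I j, j < n → Val Δ A (F j) 1 → Val Δ I j 1 → Val Δ (body A I) (F (j + 1)) eb

/-- Induction on the number `m` of remaining rounds. The accumulator is handed to the body as a term
that reads a register, so the body is evaluated in a context in which the loop registers are known.
-/
theorem foldLoop {Γ : Ctx} {body : Term → Term → Term} {F : ℕ → ℕ} {n eb d : ℕ}
    (hb : BodyVal Γ body F n eb) (hd : Γ.lvl ≤ d) :
    ∀ m ≤ n, ∀ s : State, s.mem = Γ.mem → (∀ r < Γ.lvl, s.reg r = Γ.reg r) →
      s.reg d = F (n - m) → s.reg (d + 1) = n - m → s.reg (d + 2) = m → s.reg (d + 3) = 1 →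
      ∃ s' t, Exec (.loop (d + 2) (foldBody body d)) s s' t ∧
        t ≤ m * ((Γ.size + 2) ^ eb + 5) + 1 ∧ s'.reg d = F n ∧ s'.mem = Γ.mem ∧
        ∀ r < d, s'.reg r = s.reg r := by
  intro m
  induction m with
  | zero =>
    intro _ s h1 h2 h3 h4 h5 h6
    exact ⟨s, 1, Exec.loop_exit h5, by simp, by simpa using h3, h1, fun _ _ => rfl⟩
  | succ m ih =>
    intro hm s h1 h2 h3 h4 h5 h6
    have hl : Γ.Le ⟨s.reg, s.mem, d + 4, Γ.size⟩ := ⟨by simp only; omega, h2, h1, rfl⟩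
    have hA : Val ⟨s.reg, s.mem, d + 4, Γ.size⟩ (varT d) (F (n - (m + 1))) 1 := by
      rw [← h3]
      exact val_var (Γ := ⟨s.reg, s.mem, d + 4, Γ.size⟩) (by simp)
    have hI : Val ⟨s.reg, s.mem, d + 4, Γ.size⟩ (varT (d + 1)) (n - (m + 1)) 1 := by
      rw [← h4]
      exact val_var (Γ := ⟨s.reg, s.mem, d + 4, Γ.size⟩) (by simp)
    obtain ⟨s₁, t₁, g1, g2, g3, g4, g5⟩ := hb _ hl _ _ _ (by omega) hA hI _ Ctx.Le.rfl
    simp only at g1 g2 g3 g4 g5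
    have hn : n - (m + 1) + 1 = n - m := by omega
    have k1 := g5 (d + 1) (by omega)
    have k2 := g5 (d + 2) (by omega)
    have k3 := g5 (d + 3) (by omega)
    obtain ⟨s₂, e, e1, e2, e3, e4, e5, e6⟩ : ∃ s₂, Exec (foldBody body d) s s₂ (t₁ + 4) ∧
        s₂.mem = Γ.mem ∧ s₂.reg d = F (n - m) ∧ s₂.reg (d + 1) = n - m ∧ s₂.reg (d + 2) = m ∧
        s₂.reg (d + 3) = 1 ∧ ∀ r < d, s₂.reg r = s.reg r := by
      refine ⟨_, Exec.seq g1 (Exec.seq (Exec.const _ d 0) (Exec.seq (Exec.add _ d (d + 4) d)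
        (Exec.seq (Exec.add _ (d + 1) (d + 1) (d + 3)) (Exec.sub _ (d + 2) (d + 2) (d + 3))))),
        by simpa [State.setReg] using g4.trans h1, by simp [State.setReg, Function.update, g3, hn],
        by simp [State.setReg, Function.update, k1, k3, h4, h6]; omega,
        by simp [State.setReg, Function.update, k2, k3, h5, h6],
        by simp [State.setReg, Function.update, k3, h6], fun r hr => ?_⟩
      simp only [State.setReg]
      rw [Function.update_of_ne (by omega), Function.update_of_ne (by omega),
        Function.update_of_ne (by omega), Function.update_of_ne (by omega), g5 r (by omega)]
    obtain ⟨s₃, t₂, f1, f2, f3, f4, f5⟩ := ih (by omega) s₂ e1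
      (fun r hr => (e6 r (by omega)).trans (h2 r hr)) e2 e3 e4 e5
    refine ⟨s₃, _, Exec.loop_step (by rw [h5]; omega) e f1, ?_, f3, f4,
      fun r hr => (f5 r hr).trans (e6 r hr)⟩
    rw [Nat.succ_mul]
    omega

/-- The number of rounds is at most `size`, so the loop multiplies the cost of the body by `size`
and a constant. Four more factors pay for this. -/
theorem Val.fold {Γ : Ctx} {n init : Term} {body : Term → Term → Term} {F : ℕ → ℕ}
    {vn en ei eb : ℕ} (hn : Val Γ n vn en) (hv : vn ≤ Γ.size) (hi : Val Γ init (F 0) ei)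
    (hb : BodyVal Γ body F vn eb) : Val Γ (foldT n init body) (F vn) (en + ei + eb + 4) := by
  intro Δ hΔ
  have hl : Γ.Le ⟨Δ.reg, Δ.mem, Δ.lvl + 2, Γ.size⟩ :=
    ⟨hΔ.lvl.trans (Nat.le_add_right _ _), hΔ.reg, hΔ.mem, rfl⟩
  obtain ⟨s₁, t₁, s₂, t₂, h1, h2, h3, h4, h5, h6, h7, h8⟩ := Val.pair hn hi hl
  simp only at h1 h2 h5 h6 h8
  obtain ⟨s₃, t₃, g1, g2, g3, g4, g5⟩ := foldLoop hb hΔ.lvl vn le_rfl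
    ((((s₂.setReg Δ.lvl 0).setReg Δ.lvl ((s₂.setReg Δ.lvl 0).reg (Δ.lvl + 3) +
      (s₂.setReg Δ.lvl 0).reg Δ.lvl)).setReg (Δ.lvl + 1) 0).setReg (Δ.lvl + 3) 1)
    (by simpa [State.setReg] using h7)
    (fun r hr => by
      have := hΔ.lvl
      simp only [State.setReg]
      rw [Function.update_of_ne (by omega), Function.update_of_ne (by omega),
        Function.update_of_ne (by omega), Function.update_of_ne (by omega),
        h8 r (by omega), hΔ.reg r hr])
    (by simp [State.setReg, Function.update, h6])
    (by simp [State.setReg, Function.update])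
    (by simp [State.setReg, Function.update, h5])
    (by simp [State.setReg, Function.update])
  refine ⟨_, _, Exec.seq h1 (Exec.seq h2 (Exec.seq (Exec.const _ _ _) (Exec.seq (Exec.add _ _ _ _)
    (Exec.seq (Exec.const _ _ _) (Exec.seq (Exec.const _ _ _) g1))))), ?_, g3, g4, ?_⟩
  · have a1 : (Γ.size + 2) ^ en ≤ (Γ.size + 2) ^ (en + ei + eb) :=
      Nat.pow_le_pow_right (by omega) (by omega)
    have a2 : (Γ.size + 2) ^ ei ≤ (Γ.size + 2) ^ (en + ei + eb) :=
      Nat.pow_le_pow_right (by omega) (by omega)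
    have a3 : (Γ.size + 2) ^ eb ≤ (Γ.size + 2) ^ (en + ei + eb) :=
      Nat.pow_le_pow_right (by omega) (by omega)
    have a4 : 1 ≤ (Γ.size + 2) ^ (en + ei + eb) := Nat.one_le_pow _ _ (by omega)
    have a5 : vn * ((Γ.size + 2) ^ eb + 5) ≤ Γ.size * (6 * (Γ.size + 2) ^ (en + ei + eb)) :=
      Nat.mul_le_mul hv (by omega)
    have a6 : 7 * (Γ.size + 2) ≤ (Γ.size + 2) ^ 4 := by
      have : 8 ≤ (Γ.size + 2) ^ 3 := Nat.pow_le_pow_left (show 2 ≤ Γ.size + 2 by omega) 3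
      rw [pow_succ]
      nlinarith
    change t₁ ≤ (Γ.size + 2) ^ en at h3
    change t₂ ≤ (Γ.size + 2) ^ ei at h4
    rw [pow_add _ (en + ei + eb) 4]
    have a7 := Nat.mul_le_mul_left ((Γ.size + 2) ^ (en + ei + eb)) a6
    nlinarith
  · intro r hr
    rw [g5 r hr]
    simp only [State.setReg]
    rw [Function.update_of_ne (by omega), Function.update_of_ne (by omega),
      Function.update_of_ne (by omega), Function.update_of_ne (by omega), h8 r (by omega)]

/-! ### Truth values -/

open Classical in
/-- The truth value of `p` as a number. -/
noncomputable def truth (p : Prop) : ℕ := if p then 1 else 0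

@[simp] theorem truth_of {p : Prop} (h : p) : truth p = 1 := if_pos h

@[simp] theorem truth_of_not {p : Prop} (h : ¬ p) : truth p = 0 := if_neg h

theorem truth_ne_zero {p : Prop} : truth p ≠ 0 ↔ p := by
  by_cases h : p <;> simp [h]

/-- In the context `Γ` the term `a` evaluates to the truth value of `p`. -/
def ValB (Γ : Ctx) (a : Term) (p : Prop) (e : ℕ) : Prop := Val Γ a (truth p) e

theorem ValB.weaken {Γ : Ctx} {a : Term} {p : Prop} {e e' : ℕ} (h : ValB Γ a p e) (he : e ≤ e') :
    ValB Γ a p e' := Val.weaken h he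

theorem ValB.congr {Γ : Ctx} {a : Term} {p p' : Prop} {e : ℕ} (h : ValB Γ a p e) (he : p ↔ p') :
    ValB Γ a p' e := propext he ▸ h

def ltT (a b : Term) : Term := iteT (subT b a) (constT 1) (constT 0)

def notT (a : Term) : Term := iteT a (constT 0) (constT 1)

def andT (a b : Term) : Term := iteT a b (constT 0)

def orT (a b : Term) : Term := iteT a (constT 1) b

def leT (a b : Term) : Term := notT (ltT b a)

def eqT (a b : Term) : Term := andT (leT a b) (leT b a)

def existsT (n : Term) (body : Term → Term) : Term :=
  foldT n (constT 0) fun acc i => orT acc (body i)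

def forallT (n : Term) (body : Term → Term) : Term :=
  foldT n (constT 1) fun acc i => andT acc (body i)

section

variable {Γ : Ctx} {a b : Term} {va vb ea eb : ℕ} {p q : Prop}

theorem Val.lt (ha : Val Γ a va ea) (hb : Val Γ b vb eb) :
    ValB Γ (ltT a b) (va < vb) (ea + eb + 4) := by
  refine (Val.weaken (Val.ite (hb.sub ha) (fun _ => val_const Γ 1) (fun _ => val_const Γ 0))
    (by omega)).congr ?_
  by_cases h : va < vb
  · rw [if_pos (by omega), truth_of h]
  · rw [if_neg (by omega), truth_of_not h]

theorem ValB.not (ha : ValB Γ a p ea) : ValB Γ (notT a) (¬ p) (ea + 2) := by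
  refine (Val.weaken (Val.ite ha (fun _ => val_const Γ 0) (fun _ => val_const Γ 1))
    (by omega)).congr ?_
  by_cases h : p <;> simp [h]

/-- The second term runs only if the first one is true. Hence it may rely on this truth, for
instance to have its own loops bounded by `size`. -/
theorem ValB.and (ha : ValB Γ a p ea) (hb : p → ValB Γ b q eb) :
    ValB Γ (andT a b) (p ∧ q) (ea + eb + 2) := by
  refine (Val.weaken (Val.ite ha (fun h => hb (truth_ne_zero.mp h))
    (fun _ => val_const Γ 0)) (by omega)).congr ?_
  by_cases h : p <;> by_cases h' : q <;> simp [h, h']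

theorem ValB.or (ha : ValB Γ a p ea) (hb : ¬ p → ValB Γ b q eb) :
    ValB Γ (orT a b) (p ∨ q) (ea + eb + 2) := by
  refine (Val.weaken (Val.ite ha (fun _ => val_const Γ 1)
    (fun h => hb (fun h' => truth_ne_zero.mpr h' h))) (by omega)).congr ?_
  by_cases h : p <;> by_cases h' : q <;> simp [h, h']

theorem Val.le (ha : Val Γ a va ea) (hb : Val Γ b vb eb) :
    ValB Γ (leT a b) (va ≤ vb) (ea + eb + 6) :=
  ((ValB.not (hb.lt ha)).weaken (by omega)).congr not_lt

theorem Val.eq (ha : Val Γ a va ea) (hb : Val Γ b vb eb) :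
    ValB Γ (eqT a b) (va = vb) (2 * (ea + eb) + 14) :=
  (ValB.weaken ((ha.le hb).and fun _ => hb.le ha) (by omega)).congr le_antisymm_iff.symm

theorem ValB.exists {n : Term} {body : Term → Term} {vn en eb : ℕ} {p : ℕ → Prop}
    (hn : Val Γ n vn en) (hv : vn ≤ Γ.size)
    (hb : ∀ Δ, Γ.Le Δ → ∀ I j, j < vn → Val Δ I j 1 → ValB Δ (body I) (p j) eb) :
    ValB Γ (existsT n body) (∃ j < vn, p j) (en + eb + 7) := by
  have h0 : Val Γ (constT 0) ((fun m => truth (∃ j < m, p j)) 0) 0 := by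
    simpa using val_const Γ 0
  refine Val.weaken (e := en + 0 + (eb + 3) + 4)
    (Val.fold (F := fun m => truth (∃ j < m, p j)) hn hv h0 ?_) (by omega)
  intro Δ hΔ A I j hj hA hI
  refine ((ValB.or (p := ∃ i < j, p i) hA fun _ => hb Δ hΔ I j hj hI).weaken (by omega)).congr ?_
  simp only [Nat.lt_succ_iff_lt_or_eq, or_and_right, exists_or, exists_eq_left]

theorem ValB.forall {n : Term} {body : Term → Term} {vn en eb : ℕ} {p : ℕ → Prop}
    (hn : Val Γ n vn en) (hv : vn ≤ Γ.size)
    (hb : ∀ Δ, Γ.Le Δ → ∀ I j, j < vn → Val Δ I j 1 → ValB Δ (body I) (p j) eb) :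
    ValB Γ (forallT n body) (∀ j < vn, p j) (en + eb + 7) := by
  have h0 : Val Γ (constT 1) ((fun m => truth (∀ j < m, p j)) 0) 0 := by
    simpa using val_const Γ 1
  refine Val.weaken (e := en + 0 + (eb + 3) + 4)
    (Val.fold (F := fun m => truth (∀ j < m, p j)) hn hv h0 ?_) (by omega)
  intro Δ hΔ A I j hj hA hI
  refine ((ValB.and (p := ∀ i < j, p i) hA fun _ => hb Δ hΔ I j hj hI).weaken (by omega)).congr ?_
  constructor
  · rintro ⟨h1, h2⟩ i hi
    rcases Nat.lt_succ_iff_lt_or_eq.mp hi with h | rfl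
    exacts [h1 i h, h2]
  · exact fun h => ⟨fun i hi => h i (by omega), h j (by omega)⟩

/-! ### Arithmetic -/

def mulT (a b : Term) : Term := foldT a (constT 0) fun acc _ => addT acc b

/-- The quotient is the number of `i < a` with `(i + 1) * b ≤ a`. -/
def divT (a b : Term) : Term :=
  foldT a (constT 0) fun acc i => addT acc (leT (mulT (addT i (constT 1)) b) a)

def modT (a b : Term) : Term := subT a (mulT (divT a b) b)

def powT (a b : Term) : Term := foldT b (constT 1) fun acc _ => mulT a acc

theorem Val.mul (ha : Val Γ a va ea) (hb : Val Γ b vb eb) (hv : va ≤ Γ.size) :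
    Val Γ (mulT a b) (va * vb) (ea + eb + 7) := by
  refine (Val.fold (F := fun m => m * vb) ha hv (by simpa using val_const Γ 0)
    (eb := eb + 3) ?_).weaken (by omega)
  intro Δ hΔ A I j hj hA hI
  exact ((hA.add (hb.mono hΔ)).congr (by ring)).weaken (by omega)

theorem Val.div (ha : Val Γ a va ea) (hb : Val Γ b vb eb) (hv : va ≤ Γ.size) (hpos : 0 < vb) :
    Val Γ (divT a b) (va / vb) (2 * ea + eb + 23) := by
  refine ((Val.fold (F := fun m => min m (va / vb)) ha hv (by simpa using val_const Γ 0)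
    (eb := ea + eb + 19) ?_).weaken (by omega)).congr (min_eq_right (Nat.div_le_self _ _))
  intro Δ hΔ A I j hj hA hI
  have h1 : Val Δ (addT I (constT 1)) (j + 1) 3 := hI.add (val_const Δ 1)
  have h2 := h1.mul (hb.mono hΔ) (by rw [hΔ.size]; omega)
  have h3 := hA.add (h2.le (ha.mono hΔ))
  refine (h3.weaken (by omega)).congr ?_
  have := Nat.le_div_iff_mul_le hpos (x := j + 1) (y := va)
  change min j (va / vb) + _ = min (j + 1) (va / vb)
  by_cases h : (j + 1) * vb ≤ va <;> simp only [h, truth_of, truth_of_not, not_false_eq_true]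
  · have := this.mpr h; omega
  · have : ¬ (j + 1 ≤ va / vb) := fun h' => h (this.mp h')
    omega

theorem Val.mod (ha : Val Γ a va ea) (hb : Val Γ b vb eb) (hv : va ≤ Γ.size) (hpos : 0 < vb) :
    Val Γ (modT a b) (va % vb) (3 * ea + 2 * eb + 32) := by
  have h := ha.sub ((ha.div hb hv hpos).mul hb ((Nat.div_le_self _ _).trans hv))
  refine (h.weaken (by omega)).congr ?_
  have := Nat.div_add_mod' va vb
  omega

theorem Val.pow (ha : Val Γ a va ea) (hb : Val Γ b vb eb) (hva : va ≤ Γ.size) (hvb : vb ≤ Γ.size) :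
    Val Γ (powT a b) (va ^ vb) (ea + eb + 12) := by
  refine (Val.fold (F := fun m => va ^ m) hb hvb (by simpa using val_const Γ 1)
    (eb := ea + 8) ?_).weaken (by omega)
  intro Δ hΔ A I j hj hA hI
  exact (((ha.mono hΔ).mul hA (by rw [hΔ.size]; exact hva)).congr (pow_succ' va j).symm)

end

end RAM

/-! ## The algorithm -/

/-- An instance of the packing problem: the polygon has the vertices `(px i, py i)`, `i < 2 k + 2`,
and the items have widths `w a`, heights `h a` and colors `col a`, `a < n`. -/
structure Inst where
  N : ℕ
  k : ℕ
  n : ℕ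
  γ : ℕ
  px : ℕ → ℕ
  py : ℕ → ℕ
  w : ℕ → ℕ
  h : ℕ → ℕ
  col : ℕ → ℕ

namespace Inst

variable (D : Inst)

def next (i : ℕ) : ℕ := if i + 1 = 2 * D.k + 2 then 0 else i + 1

/-- The edge `i` is vertical, meets the row `y` and lies to the right of the column `x`. -/
def Cross (x y i : ℕ) : Prop := x < D.px i ∧ ¬ (D.py i ≤ y ↔ D.py (D.next i) ≤ y)

/-- A cell is named by its lower left corner. It belongs to the polygon if and only if this number
is 1. -/
noncomputable def parity (x y : ℕ) : ℕ :=
  (∑ i ∈ Finset.range (2 * D.k + 2), RAM.truth (D.Cross x y i)) % 2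

/-- The smallest length of a longer side among the first `m` items, cut off at `N`. -/
def minSide : ℕ → ℕ
  | 0 => D.N
  | m + 1 => min (minSide m) (max (D.w m) (D.h m))

/-- The number of items that a line across a subcorridor can meet. -/
def width : ℕ := D.N / D.minSide D.n

/-- The number of boxes in a state. -/
def slots : ℕ := D.k * (D.width + 1)

/-- The number of families of boxes. -/
def families : ℕ := (D.N + 1) ^ (4 * D.slots)

/-- A state is a number below `states`; it encodes a set of colors and a family of boxes. -/
def states : ℕ := 2 ^ D.γ * D.families

def bit (z c : ℕ) : ℕ := z / D.families / 2 ^ c % 2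

/-- The `i`-th coordinate of the `j`-th box of the state `z`; the coordinates of a box are those of
its lower left corner, followed by those of its upper right corner. -/
def coord (z j i : ℕ) : ℕ := z / (D.N + 1) ^ (4 * j + i) % (D.N + 1)

/-- The box `j` of `z` is empty or contained in the box `j'` of `z'`. -/
def Inside (z j z' j' : ℕ) : Prop :=
  D.coord z' j' 0 ≤ D.coord z j 0 ∧ D.coord z' j' 1 ≤ D.coord z j 1 ∧
    D.coord z j 2 ≤ D.coord z' j' 2 ∧ D.coord z j 3 ≤ D.coord z' j' 3

/-- From `z` one gets to `z'` by placing the item `a` at `(x, y)`. -/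
def Place (z z' a x y : ℕ) : Prop :=
  (x + D.w a ≤ D.N ∧ y + D.h a ≤ D.N) ∧
  (∀ i < D.w a, ∀ j < D.h a, D.parity (x + i) (y + j) = 1) ∧
  D.bit z (D.col a) = 0 ∧ D.bit z' (D.col a) = 1 ∧
  (∀ c < D.γ, c = D.col a ∨ D.bit z' c = D.bit z c) ∧
  (∀ j < D.slots, D.coord z j 2 ≤ x ∨ D.coord z j 3 ≤ y ∨ x + D.w a ≤ D.coord z j 0 ∨
    y + D.h a ≤ D.coord z j 1) ∧
  (∃ j < D.slots, D.coord z' j 0 ≤ x ∧ D.coord z' j 1 ≤ y ∧ x + D.w a ≤ D.coord z' j 2 ∧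
    y + D.h a ≤ D.coord z' j 3) ∧
  ∀ j < D.slots, D.coord z j 2 = 0 ∨ ∃ i < D.slots, D.Inside z j z' i

def Trans (z z' : ℕ) : Prop :=
  ∃ a < D.n, ∃ x < D.N + 1, ∃ y < D.N + 1, D.Place z z' a x y

/-- The condition `z < z'` excludes nothing that is needed: the colors form the leading part of a
state and each step adds a color. It allows the table of reachable states to be filled in increasing
order. -/
inductive Reach : ℕ → Prop
  | zero : Reach 0
  | step {z z' : ℕ} : Reach z → z < z' → D.Trans z z' → Reach z'

theorem reach_iff (z' : ℕ) : D.Reach z' ↔ z' = 0 ∨ ∃ z < z', D.Reach z ∧ D.Trans z z' := by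
  constructor
  · rintro (_ | ⟨h1, h2, h3⟩)
    exacts [Or.inl rfl, Or.inr ⟨_, h2, h1, h3⟩]
  · rintro (rfl | ⟨z, h1, h2, h3⟩)
    exacts [.zero, .step h2 h1 h3]

/-- The answer of the algorithm. -/
def Accepts : Prop := ∃ z < D.states, D.Reach z ∧ ∀ c < D.γ, D.bit z c = 1

/-- The address of the table of reachable states. -/
def base : ℕ := 8 + 4 * D.k + 3 * D.n

/-- This bounds the lengths of all loops of the algorithm, so that the running time is a fixed power
of it. -/
def size : ℕ := D.states + D.families + 2 ^ D.γ + D.n + D.γ + 4 * D.slots + 2 * D.k + D.N + 2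

/-- The memory contains the instance. -/
structure Holds (μ : ℕ → ℕ) : Prop where
  N : μ 0 = D.N
  k : μ 1 = D.k
  n : μ 2 = D.n
  γ : μ 3 = D.γ
  px : ∀ i < 2 * D.k + 2, μ (4 + (i + i)) = D.px i
  py : ∀ i < 2 * D.k + 2, μ (5 + (i + i)) = D.py i
  w : ∀ a < D.n, μ (8 + (D.k + D.k + (D.k + D.k)) + (a + (a + a))) = D.w a
  h : ∀ a < D.n, μ (9 + (D.k + D.k + (D.k + D.k)) + (a + (a + a))) = D.h a
  col : ∀ a < D.n, μ (10 + (D.k + D.k + (D.k + D.k)) + (a + (a + a))) = D.col a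

end Inst

/-! ### The terms that make up the algorithm. -/

namespace RAM

def NT : Term := readT (constT 0)
def kT : Term := readT (constT 1)
def nT : Term := readT (constT 2)
def γT : Term := readT (constT 3)
def pxT (i : Term) : Term := readT (addT (constT 4) (addT i i))
def pyT (i : Term) : Term := readT (addT (constT 5) (addT i i))
def fourT (i : Term) : Term := addT (addT i i) (addT i i)
def itemT (c : ℕ) (a : Term) : Term :=
  readT (addT (addT (constT c) (fourT kT)) (addT a (addT a a)))
def verticesT : Term := addT (addT kT kT) (constT 2)
def nextT (i : Term) : Term :=
  iteT (eqT (addT i (constT 1)) verticesT) (constT 0) (addT i (constT 1))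
def crossT (x y i : Term) : Term :=
  andT (ltT x (pxT i)) (notT (eqT (leT (pyT i) y) (leT (pyT (nextT i)) y)))
def parityT (x y : Term) : Term :=
  foldT verticesT (constT 0) fun acc i => iteT (crossT x y i) (subT (constT 1) acc) acc
def minT (a b : Term) : Term := subT a (subT a b)
def maxT (a b : Term) : Term := addT a (subT b a)
def minSideT : Term := foldT nT NT fun acc a => minT acc (maxT (itemT 8 a) (itemT 9 a))
def slotsT : Term := mulT kT (addT (divT NT minSideT) (constT 1))
def succNT : Term := addT NT (constT 1)
def familiesT : Term := powT succNT (fourT slotsT)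
def statesT : Term := mulT (powT (constT 2) γT) familiesT
def bitT (z c : Term) : Term := modT (divT (divT z familiesT) (powT (constT 2) c)) (constT 2)
def coordT (z j : Term) (i : ℕ) : Term :=
  modT (divT z (powT succNT (addT (fourT j) (constT i)))) succNT
def insideT (z j z' j' : Term) : Term :=
  andT (leT (coordT z' j' 0) (coordT z j 0)) (andT (leT (coordT z' j' 1) (coordT z j 1))
    (andT (leT (coordT z j 2) (coordT z' j' 2)) (leT (coordT z j 3) (coordT z' j' 3))))
def rightT (a x : Term) : Term := addT x (itemT 8 a)
def topT (a y : Term) : Term := addT y (itemT 9 a)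

def placeT (z z' a x y : Term) : Term :=
  andT (andT (leT (rightT a x) NT) (leT (topT a y) NT)) <|
  andT (forallT (itemT 8 a) fun i => forallT (itemT 9 a) fun j =>
    eqT (parityT (addT x i) (addT y j)) (constT 1)) <|
  andT (eqT (bitT z (itemT 10 a)) (constT 0)) <|
  andT (eqT (bitT z' (itemT 10 a)) (constT 1)) <|
  andT (forallT γT fun c => orT (eqT c (itemT 10 a)) (eqT (bitT z' c) (bitT z c))) <|
  andT (forallT slotsT fun j => orT (leT (coordT z j 2) x) <| orT (leT (coordT z j 3) y) <|
    orT (leT (rightT a x) (coordT z j 0)) (leT (topT a y) (coordT z j 1))) <|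
  andT (existsT slotsT fun j => andT (leT (coordT z' j 0) x) <| andT (leT (coordT z' j 1) y) <|
    andT (leT (rightT a x) (coordT z' j 2)) (leT (topT a y) (coordT z' j 3))) <|
  forallT slotsT fun j => orT (eqT (coordT z j 2) (constT 0)) <|
    existsT slotsT fun i => insideT z j z' i

def transT (z z' : Term) : Term :=
  existsT nT fun a => existsT succNT fun x => existsT succNT fun y => placeT z z' a x y

def baseT : Term := addT (addT (constT 8) (fourT kT)) (addT nT (addT nT nT))

def tableT (z : Term) : Term := readT (addT baseT z)

def stepT (z' : Term) : Term :=
  orT (eqT z' (constT 0)) (existsT z' fun z => andT (tableT z) (transT z z'))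

def acceptT : Term :=
  existsT statesT fun z => andT (tableT z) (forallT γT fun c => eqT (bitT z c) (constT 1))

/-- The context `Γ` is the instance `D`. -/
structure Reads (Γ : Ctx) (D : Inst) : Prop where
  holds : D.Holds Γ.mem
  size : Γ.size = D.size
  posN : 0 < D.N
  posSide : 0 < D.minSide D.n
  col : ∀ a < D.n, D.col a < D.γ

theorem Reads.mono {Γ Δ : Ctx} {D : Inst} (h : Reads Γ D) (hl : Γ.Le Δ) : Reads Δ D :=
  ⟨hl.mem ▸ h.holds, hl.size.trans h.size, h.posN, h.posSide, h.col⟩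

section

variable {Γ : Ctx} {D : Inst} (H : Reads Γ D)
include H

theorem val_N : Val Γ NT D.N 2 := ((val_const Γ 0).read).congr H.holds.N
theorem val_k : Val Γ kT D.k 2 := ((val_const Γ 1).read).congr H.holds.k
theorem val_n : Val Γ nT D.n 2 := ((val_const Γ 2).read).congr H.holds.n
theorem val_γ : Val Γ γT D.γ 2 := ((val_const Γ 3).read).congr H.holds.γ

end
end RAM

/-! ### Values and running times of these terms. -/

namespace RAM

section

variable {Γ : Ctx} {D : Inst} {a b c d f z z' x y i j : Term}
  {va vb vc vd vf vz vz' vx vy vi vj ea eb ec ed ef ez ez' ex ey ei ej : ℕ} {p q : Prop}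

theorem Val.two (ha : Val Γ a va ea) : Val Γ (addT a a) (va + va) (2 * ea + 2) :=
  (ha.add ha).weaken (by omega)

theorem Val.four (ha : Val Γ a va ea) : Val Γ (fourT a) (4 * va) (4 * ea + 6) :=
  (((ha.add ha).add (ha.add ha)).weaken (by omega)).congr (by ring)

theorem ValB.iff (ha : ValB Γ a p ea) (hb : ValB Γ b q eb) :
    ValB Γ (eqT a b) (p ↔ q) (2 * (ea + eb) + 14) := by
  refine (Val.eq ha hb).congr ?_
  by_cases h : p <;> by_cases h' : q <;> simp [h, h']

theorem Val.min (ha : Val Γ a va ea) (hb : Val Γ b vb eb) :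
    Val Γ (minT a b) (min va vb) (2 * ea + eb + 4) :=
  ((ha.sub (ha.sub hb)).weaken (by omega)).congr (by omega)

theorem Val.max (ha : Val Γ a va ea) (hb : Val Γ b vb eb) :
    Val Γ (maxT a b) (max va vb) (2 * ea + eb + 4) :=
  ((ha.add (hb.sub ha)).weaken (by omega)).congr (by omega)

variable (H : Reads Γ D)
include H

theorem Reads.le_size : D.states ≤ Γ.size ∧ D.families ≤ Γ.size ∧ 2 ^ D.γ ≤ Γ.size ∧
    D.n ≤ Γ.size ∧ D.γ ≤ Γ.size ∧ 4 * D.slots ≤ Γ.size ∧ 2 * D.k + 2 ≤ Γ.size ∧ D.N + 1 ≤ Γ.size := by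
  rw [H.size, Inst.size]
  generalize 2 ^ D.γ = t
  omega

theorem val_px (hi : Val Γ i vi ei) (h : vi < 2 * D.k + 2) :
    Val Γ (pxT i) (D.px vi) (2 * ei + 6) :=
  ((((val_const Γ 4).add hi.two).read).weaken (by omega)).congr (H.holds.px vi h)

theorem val_py (hi : Val Γ i vi ei) (h : vi < 2 * D.k + 2) :
    Val Γ (pyT i) (D.py vi) (2 * ei + 6) :=
  ((((val_const Γ 5).add hi.two).read).weaken (by omega)).congr (H.holds.py vi h)

theorem val_item (r : ℕ) (ha : Val Γ a va ea) :
    Val Γ (itemT r a) (Γ.mem (r + (D.k + D.k + (D.k + D.k)) + (va + (va + va)))) (3 * ea + 24) :=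
  (((val_const Γ r).add ((val_k H).two.two)).add (ha.add ha.two)).read.weaken (by omega)

theorem val_w (ha : Val Γ a va ea) (h : va < D.n) : Val Γ (itemT 8 a) (D.w va) (3 * ea + 24) :=
  (val_item H 8 ha).congr (H.holds.w va h)

theorem val_h (ha : Val Γ a va ea) (h : va < D.n) : Val Γ (itemT 9 a) (D.h va) (3 * ea + 24) :=
  (val_item H 9 ha).congr (H.holds.h va h)

theorem val_col (ha : Val Γ a va ea) (h : va < D.n) :
    Val Γ (itemT 10 a) (D.col va) (3 * ea + 24) :=
  (val_item H 10 ha).congr (H.holds.col va h)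

theorem val_vertices : Val Γ verticesT (2 * D.k + 2) 8 :=
  ((val_k H).two.add (val_const Γ 2)).congr (by ring)

theorem val_next (hi : Val Γ i vi ei) : Val Γ (nextT i) (D.next vi) (3 * ei + 40) := by
  have h1 : Val Γ (addT i (constT 1)) (vi + 1) (ei + 2) := hi.add (val_const Γ 1)
  refine ((Val.ite (h1.eq (val_vertices H)) (fun _ => val_const Γ 0) (fun _ => h1)).weaken
    (by omega)).congr ?_
  unfold Inst.next
  by_cases h : vi + 1 = 2 * D.k + 2
  · rw [if_pos h, if_pos (truth_ne_zero.mpr h)]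
  · rw [if_neg h, if_neg (fun h' => h (truth_ne_zero.mp h'))]

theorem val_cross (hx : Val Γ x vx ex) (hy : Val Γ y vy ey) (hi : Val Γ i vi ei)
    (h : vi < 2 * D.k + 2) :
    ValB Γ (crossT x y i) (D.Cross vx vy vi) (ex + 4 * ey + 18 * ei + 250) := by
  have hn : D.next vi < 2 * D.k + 2 := by
    unfold Inst.next
    split_ifs <;> omega
  exact ((hx.lt (val_px H hi h)).and fun _ => (((val_py H hi h).le hy).iff
    ((val_py H (val_next H hi) hn).le hy)).not).weaken (by omega)

theorem val_parity (hx : Val Γ x vx ex) (hy : Val Γ y vy ey) :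
    Val Γ (parityT x y) (D.parity vx vy) (ex + 4 * ey + 300) := by
  refine Val.weaken (e := 8 + 0 + (ex + 4 * ey + 280) + 4)
    (Val.fold (F := fun m => (∑ i ∈ Finset.range m, truth (D.Cross vx vy i)) % 2)
    (val_vertices H) H.le_size.2.2.2.2.2.2.1 (by simpa using val_const Γ 0) ?_) (by omega)
  intro Δ hΔ A I j hj hA hI
  have h := val_cross (H.mono hΔ) (hx.mono hΔ) (hy.mono hΔ) hI hj
  refine ((Val.ite h (fun _ => (val_const Δ 1).sub hA) (fun _ => hA)).weaken (by omega)).congr ?_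
  simp only [Finset.sum_range_succ]
  by_cases h' : D.Cross vx vy j <;> simp only [h', truth_of, truth_of_not, not_false_eq_true,
    ne_eq, one_ne_zero, if_true, not_true, if_false] <;> omega

theorem val_minSide : Val Γ minSideT (D.minSide D.n) 100 := by
  refine Val.weaken (e := 2 + 2 + 91 + 4) (Val.fold (F := D.minSide) (val_n H) H.le_size.2.2.2.1
    (val_N H) ?_) (by omega)
  intro Δ hΔ A I j hj hA hI
  have H' := H.mono hΔ
  exact (hA.min ((val_w H' hI hj).max (val_h H' hI hj))).weaken (by omega)

theorem val_slots : Val Γ slotsT D.slots 150 := by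
  have h := H.le_size
  exact ((val_k H).mul (((val_N H).div (val_minSide H) (by omega) H.posSide).add (val_const Γ 1))
    (by omega)).weaken (by omega)

theorem val_succN : Val Γ succNT (D.N + 1) 4 := (val_N H).add (val_const Γ 1)

theorem val_families : Val Γ familiesT D.families 650 := by
  have h := H.le_size
  exact ((val_succN H).pow (val_slots H).four (by omega) (by omega)).weaken (by omega)

theorem val_states : Val Γ statesT D.states 700 := by
  have h := H.le_size
  exact (((val_const Γ 2).pow (val_γ H) (by omega) (by omega)).mul (val_families H)
    (by omega)).weaken (by omega)

theorem val_bit (hz : Val Γ z vz ez) (hc : Val Γ c vc ec) (hzs : vz < D.states) (hcs : vc < D.γ) :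
    ValB Γ (eqT (bitT z c) (constT 1)) (D.bit vz vc = 1) (24 * ez + 6 * ec + 8500) ∧
    Val Γ (bitT z c) (D.bit vz vc) (12 * ez + 3 * ec + 4200) := by
  have h := H.le_size
  have hf : 0 < D.families := pow_pos (Nat.succ_pos _) _
  have h1 := hz.div (val_families H) (by omega) hf
  have h2 := h1.div ((val_const Γ 2).pow hc (by omega) (by omega))
    ((Nat.div_le_self _ _).trans (by omega)) (by positivity)
  have h3 := h2.mod (val_const Γ 2) ((Nat.div_le_self _ _).trans ((Nat.div_le_self _ _).trans
    (by omega))) (by omega)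
  have h4 : Val Γ (bitT z c) (D.bit vz vc) (12 * ez + 3 * ec + 4200) := h3.weaken (by omega)
  exact ⟨(h4.eq (val_const Γ 1)).weaken (by omega), h4⟩

theorem val_coord (r : ℕ) (hz : Val Γ z vz ez) (hj : Val Γ j vj ej) (hzs : vz < D.states)
    (hr : r < 4) (hjs : vj < D.slots) :
    Val Γ (coordT z j r) (D.coord vz vj r) (6 * ez + 12 * ej + 200) := by
  have h := H.le_size
  have h1 := hz.div ((val_succN H).pow (hj.four.add (val_const Γ r)) (by omega) (by omega))
    (by omega) (by positivity)
  exact (h1.mod (val_succN H) ((Nat.div_le_self _ _).trans (by omega)) (by omega)).weaken (by omega)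

theorem val_inside (hz : Val Γ z vz ez) (hj : Val Γ j vj ej) (hzs : vz < D.states)
    (hjs : vj < D.slots) (hz' : Val Γ z' vz' ez') (hi : Val Γ i vi ei) (hzs' : vz' < D.states)
    (his : vi < D.slots) :
    ValB Γ (insideT z j z' i) (D.Inside vz vj vz' vi)
      (24 * ez + 24 * ez' + 48 * ei + 48 * ej + 1700) := by
  have h (r : ℕ) (hr : r < 4) := val_coord H r hz hj hzs hr hjs
  have h' (r : ℕ) (hr : r < 4) := val_coord H r hz' hi hzs' hr his
  exact (((h' 0 (by omega)).le (h 0 (by omega))).and fun _ =>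
    ((h' 1 (by omega)).le (h 1 (by omega))).and fun _ =>
    ((h 2 (by omega)).le (h' 2 (by omega))).and fun _ =>
    ((h 3 (by omega)).le (h' 3 (by omega)))).weaken (by omega)

end

/-- Only some absolute exponent is needed. Here and in the next estimates it is left open at the
start and determined by composing the bounds of the parts. -/
theorem exists_val_place : ∃ e, ∀ {Γ : Ctx} {D : Inst}, Reads Γ D → ∀ {z z' a x y : Term}
    {vz vz' va vx vy : ℕ}, Val Γ z vz 1 → Val Γ z' vz' 1 → Val Γ a va 1 → Val Γ x vx 1 →
    Val Γ y vy 1 → vz < D.states → vz' < D.states → va < D.n →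
    ValB Γ (placeT z z' a x y) (D.Place vz vz' va vx vy) e := by
  apply Exists.intro
  intro Γ D H z z' a x y vz vz' va vx vy hz hz' ha hx hy hzs hzs' has
  have hs := H.le_size
  have hr : Val Γ (rightT a x) (vx + D.w va) 30 := (hx.add (val_w H ha has)).weaken (by omega)
  have ht : Val Γ (topT a y) (vy + D.h va) 30 := (hy.add (val_h H ha has)).weaken (by omega)
  have hcol := H.col va has
  -- Items may be larger than the knapsack. The loops over their cells are bounded by `size` only
  -- because the test against `N` has already succeeded.
  have c1 (h1 : vx + D.w va ≤ D.N ∧ vy + D.h va ≤ D.N) : ValB Γ (forallT (itemT 8 a) fun i =>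
      forallT (itemT 9 a) fun j => eqT (parityT (addT x i) (addT y j)) (constT 1))
      (∀ i < D.w va, ∀ j < D.h va, D.parity (vx + i) (vy + j) = 1) 2000 := by
    refine (ValB.forall (eb := 1700) (val_w H ha has) (by omega) fun Δ hΔ I i hi hI =>
      (ValB.forall (eb := 1600) ((val_h H ha has).mono hΔ) (by rw [hΔ.size]; omega)
        fun Θ hΘ J j hj hJ => ?_).weaken (by omega)).weaken (by omega)
    have hl := hΔ.trans hΘ
    exact ((val_parity (H.mono hl) ((hx.mono hl).add (hI.mono hΘ)) ((hy.mono hl).add hJ)).eq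
      (val_const Θ 1)).weaken (by omega)
  have c2 := ValB.forall (eb := 20000) (body := fun c =>
      orT (eqT c (itemT 10 a)) (eqT (bitT z' c) (bitT z c)))
      (p := fun c => c = D.col va ∨ D.bit vz' c = D.bit vz c) (val_γ H) (by omega)
      fun Δ hΔ C c hc hC => by
    have H' := H.mono hΔ
    exact ((hC.eq (val_col H' (ha.mono hΔ) has)).or fun _ =>
      (val_bit H' (hz'.mono hΔ) hC hzs' hc).2.eq (val_bit H' (hz.mono hΔ) hC hzs hc).2).weaken
        (by omega)
  have c3 := ValB.forall (eb := 10000) (body := fun j => orT (leT (coordT z j 2) x) <|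
      orT (leT (coordT z j 3) y) <|
      orT (leT (rightT a x) (coordT z j 0)) (leT (topT a y) (coordT z j 1)))
      (p := fun j => D.coord vz j 2 ≤ vx ∨ D.coord vz j 3 ≤ vy ∨ vx + D.w va ≤ D.coord vz j 0 ∨
        vy + D.h va ≤ D.coord vz j 1) (val_slots H) (by omega) fun Δ hΔ J j hj hJ => by
    have H' := H.mono hΔ
    have h (r : ℕ) (hr : r < 4) := val_coord H' r (hz.mono hΔ) hJ hzs hr hj
    exact (((h 2 (by omega)).le (hx.mono hΔ)).or fun _ => ((h 3 (by omega)).le (hy.mono hΔ)).or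
      fun _ => ((hr.mono hΔ).le (h 0 (by omega))).or fun _ =>
        (ht.mono hΔ).le (h 1 (by omega))).weaken (by omega)
  have c4 := ValB.exists (eb := 10000) (body := fun j => andT (leT (coordT z' j 0) x) <|
      andT (leT (coordT z' j 1) y) <|
      andT (leT (rightT a x) (coordT z' j 2)) (leT (topT a y) (coordT z' j 3)))
      (p := fun j => D.coord vz' j 0 ≤ vx ∧ D.coord vz' j 1 ≤ vy ∧ vx + D.w va ≤ D.coord vz' j 2 ∧
        vy + D.h va ≤ D.coord vz' j 3) (val_slots H) (by omega) fun Δ hΔ J j hj hJ => by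
    have H' := H.mono hΔ
    have h (r : ℕ) (hr : r < 4) := val_coord H' r (hz'.mono hΔ) hJ hzs' hr hj
    exact (((h 0 (by omega)).le (hx.mono hΔ)).and fun _ => ((h 1 (by omega)).le (hy.mono hΔ)).and
      fun _ => ((hr.mono hΔ).le (h 2 (by omega))).and fun _ =>
        (ht.mono hΔ).le (h 3 (by omega))).weaken (by omega)
  have c5 := ValB.forall (eb := 10000) (body := fun j => orT (eqT (coordT z j 2) (constT 0)) <|
      existsT slotsT fun i => insideT z j z' i)
      (p := fun j => D.coord vz j 2 = 0 ∨ ∃ i < D.slots, D.Inside vz j vz' i)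
      (val_slots H) (by omega) fun Δ hΔ J j hj hJ => by
    have H' := H.mono hΔ
    refine (((val_coord H' 2 (hz.mono hΔ) hJ hzs (by omega) hj).eq (val_const Δ 0)).or fun _ =>
      ValB.exists (eb := 3000) (val_slots H') (by rw [hΔ.size]; omega)
        fun Θ hΘ I i hi hI => ?_).weaken (by omega)
    have hl := hΔ.trans hΘ
    exact (val_inside (H.mono hl) (hz.mono hl) (hJ.mono hΘ) hzs hj (hz'.mono hl) hI hzs' hi).weaken
      (by omega)
  exact ((hr.le (val_N H)).and fun _ => ht.le (val_N H)).and fun h1 => (c1 h1).and fun _ =>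
    ((val_bit H hz (val_col H ha has) hzs hcol).2.eq (val_const Γ 0)).and fun _ =>
    (val_bit H hz' (val_col H ha has) hzs' hcol).1.and fun _ => c2.and fun _ => c3.and fun _ =>
    c4.and fun _ => c5

theorem exists_val_trans : ∃ e, ∀ {Γ : Ctx} {D : Inst}, Reads Γ D → ∀ {z z' : Term}
    {vz vz' : ℕ}, Val Γ z vz 1 → Val Γ z' vz' 1 → vz < D.states → vz' < D.states →
    ValB Γ (transT z z') (D.Trans vz vz') e := by
  obtain ⟨e, he⟩ := exists_val_place
  apply Exists.intro
  intro Γ D H z z' vz vz' hz hz' hzs hzs'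
  have hs := H.le_size
  refine ValB.exists (eb := e + 22) (val_n H) (by omega) fun Δ hΔ A a ha hA => ?_
  have H₁ := H.mono hΔ
  refine (ValB.exists (eb := e + 11) (val_succN H₁) (by rw [hΔ.size]; omega)
    fun Θ hΘ X x hx hX => ?_).weaken (by omega)
  have H₂ := H₁.mono hΘ
  refine (ValB.exists (eb := e) (val_succN H₂) (by rw [hΘ.size, hΔ.size]; omega)
    fun Ξ hΞ Y y hy hY => ?_).weaken (by omega)
  have hl := (hΔ.trans hΘ).trans hΞ
  exact he (H₂.mono hΞ) (hz.mono hl) (hz'.mono hl) (hA.mono (hΘ.trans hΞ)) (hX.mono hΞ) hY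
    hzs hzs' ha

theorem val_base {Γ : Ctx} {D : Inst} (H : Reads Γ D) : Val Γ baseT D.base 50 :=
  ((((val_const Γ 8).add (val_k H).four).add ((val_n H).add (val_n H).two)).weaken
    (by omega)).congr (by unfold Inst.base; ring)

theorem val_table {Γ : Ctx} {D : Inst} (H : Reads Γ D) {z : Term} {vz ez : ℕ} (hz : Val Γ z vz ez)
    (h : Γ.mem (D.base + vz) = truth (D.Reach vz)) :
    ValB Γ (tableT z) (D.Reach vz) (ez + 60) :=
  ((((val_base H).add hz).read).weaken (by omega)).congr h

/-- By `Inst.reach_iff`, the entry of `vz'` depends only on entries of smaller states. -/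
theorem exists_val_step : ∃ e, ∀ {Γ : Ctx} {D : Inst}, Reads Γ D → ∀ {z' : Term} {vz' : ℕ},
    Val Γ z' vz' 1 → vz' < D.states →
    (∀ z < vz', Γ.mem (D.base + z) = truth (D.Reach z)) →
    ValB Γ (stepT z') (D.Reach vz') e := by
  obtain ⟨e, he⟩ := exists_val_trans
  apply Exists.intro
  intro Γ D H z' vz' hz' hzs' ht
  have hs := H.le_size
  refine (((hz'.eq (val_const Γ 0)).or fun _ => ValB.exists (eb := e + 100) hz' (by omega)
    fun Δ hΔ Z z hz hZ => ?_)).congr (D.reach_iff vz').symm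
  have H' := H.mono hΔ
  exact ((val_table H' hZ (by rw [hΔ.mem]; exact ht z hz)).and fun _ =>
    he H' hZ (hz'.mono hΔ) (by omega) hzs').weaken (by omega)

theorem exists_val_accept : ∃ e, ∀ {Γ : Ctx} {D : Inst}, Reads Γ D →
    (∀ z < D.states, Γ.mem (D.base + z) = truth (D.Reach z)) →
    ValB Γ acceptT D.Accepts e := by
  apply Exists.intro
  intro Γ D H ht
  have hs := H.le_size
  refine ValB.exists (eb := 10000) (val_states H) (by omega) fun Δ hΔ Z z hz hZ => ?_
  have H' := H.mono hΔ
  refine ((val_table H' hZ (by rw [hΔ.mem]; exact ht z hz)).and fun _ =>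
    ValB.forall (eb := 9000) (val_γ H') (by rw [hΔ.size]; omega) fun Θ hΘ C c hc hC => ?_).weaken
      (by omega)
  exact (val_bit (H'.mono hΘ) (hZ.mono hΘ) hC hz hc).1.weaken (by omega)

/-- Fills the table of reachable states. -/
def loopBody : Prog :=
  .seq (stepT (varT 2) 4) <| .seq (addT baseT (varT 2) 5) <| .seq (.store 5 4) <|
    .seq (.add 2 2 3) (.sub 1 1 3)

def algorithm : Prog :=
  .seq (statesT 1) <| .seq (.const 2 0) <| .seq (.const 3 1) <| .seq (.loop 1 loopBody) (acceptT 0)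

/-- The instance occupies the cells below `base`, where the table begins, so writing the table does
not destroy it. -/
theorem Inst.Holds.congr {D : Inst} {μ ν : ℕ → ℕ} (h : D.Holds μ) (hν : ∀ a < D.base, ν a = μ a) :
    D.Holds ν where
  N := (hν _ (by unfold Inst.base; omega)).trans h.N
  k := (hν _ (by unfold Inst.base; omega)).trans h.k
  n := (hν _ (by unfold Inst.base; omega)).trans h.n
  γ := (hν _ (by unfold Inst.base; omega)).trans h.γ
  px i hi := (hν _ (by unfold Inst.base; omega)).trans (h.px i hi)
  py i hi := (hν _ (by unfold Inst.base; omega)).trans (h.py i hi)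
  w a ha := (hν _ (by unfold Inst.base; omega)).trans (h.w a ha)
  h a ha := (hν _ (by unfold Inst.base; omega)).trans (h.h a ha)
  col a ha := (hν _ (by unfold Inst.base; omega)).trans (h.col a ha)

/-- Induction on the number `m` of entries still to be written; the invariant is that the entries
below `states - m` are correct. -/
theorem exec_loop {D : Inst} {e : ℕ} (posN : 0 < D.N) (posSide : 0 < D.minSide D.n)
    (col : ∀ a < D.n, D.col a < D.γ)
    (he : ∀ {Γ : Ctx} {D : Inst}, Reads Γ D → ∀ {z' : Term} {vz' : ℕ},
      Val Γ z' vz' 1 → vz' < D.states →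
      (∀ z < vz', Γ.mem (D.base + z) = truth (D.Reach z)) →
      ValB Γ (stepT z') (D.Reach vz') e) :
    ∀ m ≤ D.states, ∀ s : State, D.Holds s.mem → s.reg 1 = m → s.reg 2 = D.states - m →
      s.reg 3 = 1 → (∀ z < D.states - m, s.mem (D.base + z) = truth (D.Reach z)) →
      ∃ s' t, Exec (.loop 1 loopBody) s s' t ∧
        t ≤ m * ((D.size + 2) ^ e + (D.size + 2) ^ 60 + 4) + 1 ∧ D.Holds s'.mem ∧
        ∀ z < D.states, s'.mem (D.base + z) = truth (D.Reach z) := by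
  intro m
  induction m with
  | zero =>
    intro _ s h1 h2 h3 h4 h5
    exact ⟨s, 1, Exec.loop_exit h2, by omega, h1, h5⟩
  | succ m ih =>
    intro hm s h1 h2 h3 h4 h5
    have H : Reads ⟨s.reg, s.mem, 4, D.size⟩ D := ⟨h1, rfl, posN, posSide, col⟩
    have hz : Val ⟨s.reg, s.mem, 4, D.size⟩ (varT 2) (D.states - (m + 1)) 1 := by
      rw [← h3]
      exact val_var (Γ := ⟨s.reg, s.mem, 4, D.size⟩) (by simp)
    obtain ⟨s₁, t₁, s₂, t₂, g1, g2, g3, g4, g5, g6, g7, g8⟩ :=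
      Val.pair (he H hz (by omega) h5)
        (((val_base H).add hz).weaken (e' := 60) (by omega)) Ctx.Le.rfl
    simp only at g1 g2 g3 g4 g5 g6 g7 g8
    set v := truth (D.Reach (D.states - (m + 1))) with hv
    obtain ⟨s₃, e1, e2, e3, e4, e5⟩ : ∃ s₃, Exec loopBody s s₃ (t₁ + (t₂ + 3)) ∧
        s₃.mem = Function.update s.mem (D.base + (D.states - (m + 1))) v ∧
        s₃.reg 1 = m ∧ s₃.reg 2 = D.states - m ∧ s₃.reg 3 = 1 := by
      refine ⟨_, Exec.seq g1 (Exec.seq g2 (Exec.seq (Exec.store _ _ _) (Exec.seq (Exec.add _ _ _ _)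
        (Exec.sub _ _ _ _)))), ?_, ?_, ?_, ?_⟩
      · simp [State.setReg, State.setMem, g5, g6, g7]
      · simp [State.setReg, State.setMem, g8, h2, h4]
      · simp [State.setReg, State.setMem, g8, h3, h4]
        omega
      · simp [State.setReg, State.setMem, g8, h4]
    obtain ⟨s₄, t₄, f1, f2, f3, f4⟩ := ih (by omega) s₃
      (Inst.Holds.congr h1 fun a ha => by
        rw [e2, Function.update_of_ne (by omega)]) e3 e4 e5
      (fun z hz => by
        rw [e2]
        by_cases hzm : z = D.states - (m + 1)
        · rw [hzm, Function.update_self]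
        · rw [Function.update_of_ne (by omega)]
          exact h5 z (by omega))
    refine ⟨s₄, _, Exec.loop_step (by omega) e1 f1, ?_, f3, f4⟩
    rw [Nat.succ_mul]
    omega

set_option exponentiation.threshold 1000 in
theorem exists_algorithm_spec : ∃ e, ∀ (D : Inst) (input : List ℕ), 0 < D.N →
    0 < D.minSide D.n → (∀ a < D.n, D.col a < D.γ) → D.Holds (init input).mem →
    DecidesWithin algorithm input D.Accepts ((D.size + 2) ^ e : ℕ) := by
  obtain ⟨e, he⟩ := exists_val_step
  obtain ⟨e', he'⟩ := exists_val_accept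
  -- The exponent `e + e' + 790` dominates each single evaluation; the other ten factors pay for the
  -- rounds of the main loop and for constants.
  refine ⟨e + e' + 800, fun D input posN posSide col hD => ?_⟩
  have H : Reads ⟨(init input).reg, (init input).mem, 1, D.size⟩ D :=
    ⟨hD, rfl, posN, posSide, col⟩
  obtain ⟨s₁, t₁, h1, h2, h3, h4, h5⟩ := val_states H _ Ctx.Le.rfl
  simp only at h1 h2 h3 h4 h5
  have hm : ((s₁.setReg 2 0).setReg 3 1).mem = (init input).mem := h4
  obtain ⟨s₂, t₂, g1, g2, g3, g4⟩ := exec_loop posN posSide col he D.states le_rfl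
    ((s₁.setReg 2 0).setReg 3 1) (by rw [hm]; exact hD) (by simp [State.setReg, h3])
    (by simp [State.setReg]) (by simp [State.setReg]) (by simp)
  have H' : Reads ⟨s₂.reg, s₂.mem, 0, D.size⟩ D := ⟨g3, rfl, posN, posSide, col⟩
  obtain ⟨s₃, t₃, f1, f2, f3, f4, f5⟩ := he' H' g4 _ Ctx.Le.rfl
  refine ⟨s₃, _, Exec.seq h1 (Exec.seq (Exec.const _ _ _) (Exec.seq (Exec.const _ _ _)
    (Exec.seq g1 f1))), ?_, fun h => f3.trans (truth_of h), fun h => f3.trans (truth_of_not h)⟩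
  have h2' : t₁ ≤ (D.size + 2) ^ 700 := h2
  have f2' : _ ≤ (D.size + 2) ^ e' := f2
  have hs : D.states ≤ D.size := H.le_size.1
  have a1 : (D.size + 2) ^ 700 ≤ (D.size + 2) ^ (e + e' + 790) :=
    Nat.pow_le_pow_right (by omega) (by omega)
  have a2 : (D.size + 2) ^ e ≤ (D.size + 2) ^ (e + e' + 790) :=
    Nat.pow_le_pow_right (by omega) (by omega)
  have a3 : (D.size + 2) ^ e' ≤ (D.size + 2) ^ (e + e' + 790) :=
    Nat.pow_le_pow_right (by omega) (by omega)
  have a4 : (D.size + 2) ^ 60 ≤ (D.size + 2) ^ (e + e' + 790) :=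
    Nat.pow_le_pow_right (by omega) (by omega)
  have a5 : 1 ≤ (D.size + 2) ^ (e + e' + 790) := Nat.one_le_pow _ _ (by omega)
  have a6 : (D.size + 2) ^ (e + e' + 800) = (D.size + 2) ^ (e + e' + 790) * (D.size + 2) ^ 10 := by
    rw [← pow_add]
  have a7 : 512 * (D.size + 2) ≤ (D.size + 2) ^ 10 := by
    have : 2 ^ 9 ≤ (D.size + 2) ^ 9 := Nat.pow_le_pow_left (by omega) 9
    rw [pow_succ (D.size + 2) 9]
    exact Nat.mul_le_mul_right _ this
  refine Nat.cast_le.mpr ?_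
  rw [a6]
  generalize (D.size + 2) ^ (e + e' + 790) = X at *
  generalize (D.size + 2) ^ 10 = Y at *
  generalize (D.size + 2) ^ 700 = Y₁ at *
  generalize (D.size + 2) ^ 60 = Y₂ at *
  generalize (D.size + 2) ^ e = Y₃ at *
  generalize (D.size + 2) ^ e' = Y₄ at *
  have a8 : D.states * (Y₃ + Y₂ + 4) ≤ D.size * (6 * X) := Nat.mul_le_mul hs (by omega)
  have a9 := Nat.mul_le_mul_left X a7
  nlinarith

end RAM

/-! ## Correctness of the search -/

/-- The number with the digits `f 0, …, f (m - 1)` in base `B`, the least significant one first. -/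
def ofDigitFn (B : ℕ) (f : ℕ → ℕ) (m : ℕ) : ℕ := ∑ j ∈ Finset.range m, f j * B ^ j

theorem ofDigitFn_lt {B : ℕ} {f : ℕ → ℕ} (hf : ∀ j, f j < B) (m : ℕ) : ofDigitFn B f m < B ^ m := by
  induction m with
  | zero => simp [ofDigitFn]
  | succ m ih =>
    have h1 : ofDigitFn B f (m + 1) = ofDigitFn B f m + f m * B ^ m := Finset.sum_range_succ _ _
    have h2 : (f m + 1) * B ^ m ≤ B * B ^ m := Nat.mul_le_mul_right _ (hf m)
    rw [h1, pow_succ']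
    nlinarith

/-- This is why `Inst.coord` can read a digit off the whole state, without first removing the colors
that stand above the boxes. -/
theorem add_mul_pow_digit {B : ℕ} (hB : 0 < B) {j m : ℕ} (h : j < m) (u a : ℕ) :
    (u + a * B ^ m) / B ^ j % B = u / B ^ j % B := by
  obtain ⟨r, rfl⟩ := Nat.exists_eq_add_of_lt h
  have : a * B ^ (j + r + 1) = a * B ^ r * B * B ^ j := by ring
  rw [this, Nat.add_mul_div_right _ _ (pow_pos hB j), Nat.add_mul_mod_self_right]

theorem ofDigitFn_digit {B : ℕ} {f : ℕ → ℕ} (hf : ∀ j, f j < B) {j m : ℕ} (hj : j < m) :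
    ofDigitFn B f m / B ^ j % B = f j := by
  have hB : 0 < B := (Nat.zero_le _).trans_lt (hf 0)
  induction m with
  | zero => omega
  | succ m ih =>
    have h1 : ofDigitFn B f (m + 1) = ofDigitFn B f m + f m * B ^ m := Finset.sum_range_succ _ _
    rw [h1]
    rcases Nat.lt_succ_iff_lt_or_eq.mp hj with h | rfl
    · rw [add_mul_pow_digit hB h, ih h]
    · rw [Nat.add_mul_div_right _ _ (pow_pos hB j), Nat.div_eq_of_lt (ofDigitFn_lt hf j), zero_add,
        Nat.mod_eq_of_lt (hf j)]

/-! ### Soundness and completeness of the search through states. -/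

namespace Inst

variable (D : Inst)

/-- The coordinates of an item placed at `(X a, Y a)`. -/
def box (X Y : ℕ → ℕ) (a : ℕ) : ℕ → ℕ
  | 0 => X a
  | 1 => Y a
  | 2 => X a + D.w a
  | _ => Y a + D.h a

/-- The items of `A`, placed at `(X a, Y a)`, are disjoint, lie in the polygon and have different
colors. -/
structure Packing (A : Finset ℕ) (X Y : ℕ → ℕ) : Prop where
  lt : ∀ a ∈ A, a < D.n
  color : ∀ a ∈ A, ∀ b ∈ A, D.col a = D.col b → a = b
  inside : ∀ a ∈ A, X a + D.w a ≤ D.N ∧ Y a + D.h a ≤ D.N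
  cells : ∀ a ∈ A, ∀ i < D.w a, ∀ j < D.h a, D.parity (X a + i) (Y a + j) = 1
  disjoint : ∀ a ∈ A, ∀ b ∈ A, a ≠ b → X a + D.w a ≤ X b ∨ Y a + D.h a ≤ Y b ∨
    X b + D.w b ≤ X a ∨ Y b + D.h b ≤ Y a

def Colorful : Prop := ∃ A X Y, D.Packing A X Y ∧ ∀ c < D.γ, ∃ a ∈ A, D.col a = c

variable {D}

/-- Induction along the run, keeping a packing whose items all lie in boxes of the current state. A
new item that avoids the boxes avoids these items, and the new boxes still contain them. -/
theorem Reach.sound (hw : ∀ a < D.n, 0 < D.w a) (hcol : ∀ a < D.n, D.col a < D.γ) {z : ℕ}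
    (hz : D.Reach z) : ∃ A X Y, D.Packing A X Y ∧
      (∀ c < D.γ, D.bit z c = 1 ↔ ∃ a ∈ A, D.col a = c) ∧
      ∀ a ∈ A, ∃ j < D.slots, D.coord z j 0 ≤ X a ∧ D.coord z j 1 ≤ Y a ∧
        X a + D.w a ≤ D.coord z j 2 ∧ Y a + D.h a ≤ D.coord z j 3 := by
  induction hz with
  | zero =>
    refine ⟨∅, 0, 0, ⟨by simp, by simp, by simp, by simp, by simp⟩, ?_, by simp⟩
    intro c hc
    simp [bit]
  | @step z z' _ _ ht ih =>
    obtain ⟨A, X, Y, hP, hbit, hcov⟩ := ih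
    obtain ⟨a, ha, x, -, y, -, hin, hcell, hb0, hb1, hbits, hdis, hcov', hmono⟩ := ht
    have haA : a ∉ A := by
      intro h
      have := (hbit (D.col a) (hcol a ha)).mpr ⟨a, h, rfl⟩
      omega
    have hne : ∀ b ∈ A, b ≠ a := fun b hb h => haA (h ▸ hb)
    have hsep : ∀ b ∈ A, X b + D.w b ≤ x ∨ Y b + D.h b ≤ y ∨ x + D.w a ≤ X b ∨
        y + D.h a ≤ Y b := by
      intro b hb
      obtain ⟨j, hj, h0, h1, h2, h3⟩ := hcov b hb
      rcases hdis j hj with h | h | h | h <;> omega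
    refine ⟨insert a A, Function.update X a x, Function.update Y a y, ⟨?_, ?_, ?_, ?_, ?_⟩, ?_, ?_⟩
    · intro b hb
      rcases Finset.mem_insert.mp hb with rfl | hb
      exacts [ha, hP.lt b hb]
    · have key : ∀ b ∈ A, D.col b ≠ D.col a := by
        intro b hb h
        have := (hbit (D.col a) (hcol a ha)).mpr ⟨b, hb, h⟩
        omega
      intro b hb b' hb' h
      rcases Finset.mem_insert.mp hb with rfl | g <;> rcases Finset.mem_insert.mp hb' with rfl | g'
      exacts [rfl, absurd h.symm (key _ g'), absurd h (key _ g), hP.color b g b' g' h]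
    · intro b hb
      rcases Finset.mem_insert.mp hb with rfl | hb
      · simpa using hin
      · simpa [Function.update_of_ne (hne b hb)] using hP.inside b hb
    · intro b hb
      rcases Finset.mem_insert.mp hb with rfl | hb
      · simpa using hcell
      · simpa [Function.update_of_ne (hne b hb)] using hP.cells b hb
    · intro b hb b' hb' h
      rcases Finset.mem_insert.mp hb with rfl | g <;> rcases Finset.mem_insert.mp hb' with rfl | g'
      · exact absurd rfl h
      · have := hsep b' g'
        simp only [Function.update_self, Function.update_of_ne (hne b' g')]
        omega
      · have := hsep b g
        simp only [Function.update_self, Function.update_of_ne (hne b g)]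
        omega
      · simpa [Function.update_of_ne (hne b g), Function.update_of_ne (hne b' g')] using
          hP.disjoint b g b' g' h
    · intro c hc
      by_cases hca : c = D.col a
      · subst hca
        exact ⟨fun _ => ⟨a, Finset.mem_insert_self _ _, rfl⟩, fun _ => hb1⟩
      · rw [(hbits c hc).resolve_left hca, hbit c hc]
        constructor
        · rintro ⟨b, hb, h⟩
          exact ⟨b, Finset.mem_insert_of_mem hb, h⟩
        · rintro ⟨b, hb, h⟩
          rcases Finset.mem_insert.mp hb with rfl | hb
          exacts [absurd h.symm hca, ⟨b, hb, h⟩]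
    · intro b hb
      rcases Finset.mem_insert.mp hb with rfl | hb
      · simpa using hcov'
      · obtain ⟨j, hj, h0, h1, h2, h3⟩ := hcov b hb
        -- A box that contains an item has a positive right end, so it does not count as empty and
        -- must be contained in a new box.
        have := hw b (hP.lt b hb)
        obtain ⟨i, hi, g0, g1, g2, g3⟩ := (hmono j hj).resolve_left (by omega)
        refine ⟨i, hi, ?_⟩
        simp only [Function.update_of_ne (hne b hb)]
        omega

theorem Accepts.colorful (hw : ∀ a < D.n, 0 < D.w a) (hcol : ∀ a < D.n, D.col a < D.γ)
    (h : D.Accepts) : D.Colorful := by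
  obtain ⟨z, -, hz, hb⟩ := h
  obtain ⟨A, X, Y, hP, hbit, -⟩ := hz.sound hw hcol
  exact ⟨A, X, Y, hP, fun c hc => (hbit c hc).mp (hb c hc)⟩

variable (D)

open Classical in
/-- The state with the given set of colors and the given boxes. -/
noncomputable def code (C : Set ℕ) (l : List (ℕ → ℕ)) : ℕ :=
  ofDigitFn (D.N + 1) (fun t => min D.N (l.getD (t / 4) 0 (t % 4))) (4 * D.slots) +
    ofDigitFn 2 (fun c => if c ∈ C then 1 else 0) D.γ * D.families

variable {D}

theorem code_low_lt (l : List (ℕ → ℕ)) :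
    ofDigitFn (D.N + 1) (fun t => min D.N (l.getD (t / 4) 0 (t % 4))) (4 * D.slots) <
      D.families :=
  ofDigitFn_lt (fun _ => Nat.lt_succ_of_le (min_le_left _ _)) _

theorem code_lt_states (C : Set ℕ) (l : List (ℕ → ℕ)) : D.code C l < D.states := by
  classical
  have h1 := code_low_lt (D := D) l
  have h2 : ofDigitFn 2 (fun c => if c ∈ C then 1 else 0) D.γ < 2 ^ D.γ :=
    ofDigitFn_lt (fun c => by split_ifs <;> omega) _
  have h3 := Nat.mul_le_mul_right D.families (Nat.succ_le_of_lt h2)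
  unfold code states
  rw [Nat.succ_mul] at h3
  omega

theorem bit_code (C : Set ℕ) (l : List (ℕ → ℕ)) {c : ℕ} (hc : c < D.γ) [Decidable (c ∈ C)] :
    D.bit (D.code C l) c = if c ∈ C then 1 else 0 := by
  have hf : 0 < D.families := pow_pos (Nat.succ_pos _) _
  unfold bit code
  rw [Nat.add_mul_div_right _ _ hf, Nat.div_eq_of_lt (code_low_lt l), zero_add,
    ofDigitFn_digit (fun c => by split_ifs <;> omega) hc]
  congr

theorem coord_code (C : Set ℕ) (l : List (ℕ → ℕ)) {j i : ℕ} (hj : j < D.slots) (hi : i < 4) :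
    D.coord (D.code C l) j i = min D.N (l.getD j 0 i) := by
  unfold coord code families
  rw [add_mul_pow_digit (Nat.succ_pos _) (by omega), ofDigitFn_digit
    (fun _ => Nat.lt_succ_of_le (min_le_left _ _)) (by omega),
    show (4 * j + i) / 4 = j by omega, show (4 * j + i) % 4 = i by omega]

/-- The colors are the leading digits, so a new color increases the number whatever happens to the
boxes. -/
theorem code_lt_code {C C' : Set ℕ} (l l' : List (ℕ → ℕ)) (h : C ⊆ C') {c : ℕ} (hc : c < D.γ)
    (h1 : c ∉ C) (h2 : c ∈ C') : D.code C l < D.code C' l' := by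
  classical
  have h3 : ofDigitFn 2 (fun c => if c ∈ C then 1 else 0) D.γ <
      ofDigitFn 2 (fun c => if c ∈ C' then 1 else 0) D.γ := by
    refine Finset.sum_lt_sum (fun i _ => Nat.mul_le_mul_right _ ?_)
      ⟨c, Finset.mem_range.mpr hc, ?_⟩
    · by_cases hi : i ∈ C
      · simp [hi, h hi]
      · simp [hi]
    · simp [h1, h2]
  have h4 := code_low_lt (D := D) l
  have h5 := Nat.mul_le_mul_right D.families (Nat.succ_le_of_lt h3)
  unfold code
  rw [Nat.succ_mul] at h5
  convert lt_of_lt_of_le (Nat.add_lt_add_right h4 _) ((add_comm _ _).le.trans (h5.trans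
    (Nat.le_add_left _ _))) using 1

/-- The box `b` is empty or contained in the box `b'`. -/
def BoxLE (b b' : ℕ → ℕ) : Prop :=
  b 2 = 0 ∨ (b' 0 ≤ b 0 ∧ b' 1 ≤ b 1 ∧ b 2 ≤ b' 2 ∧ b 3 ≤ b' 3)

/-- The boxes `b` and `b'` do not overlap. -/
def BoxSep (b b' : ℕ → ℕ) : Prop := b 2 ≤ b' 0 ∨ b 3 ≤ b' 1 ∨ b' 2 ≤ b 0 ∨ b' 3 ≤ b 1

theorem getD_mem_or {α : Type*} (l : List α) (j : ℕ) (x : α) : l.getD j x ∈ l ∨ l.getD j x = x := by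
  by_cases h : j < l.length
  · left
    rw [List.getD_eq_getElem _ _ h]
    exact List.getElem_mem h
  · right
    rw [List.getD_eq_default _ _ (by omega)]

/-- A packing is found if its items can be placed one after the other in such a way that at any time
few boxes separate the placed ones from the others. -/
theorem accepts_of_boxes {A : Finset ℕ} {X Y : ℕ → ℕ} (hP : D.Packing A X Y)
    (hw : ∀ a < D.n, 0 < D.w a) (hcol : ∀ a < D.n, D.col a < D.γ)
    (hA : ∀ c < D.γ, ∃ a ∈ A, D.col a = c)
    (Good : Finset ℕ → Prop) (boxes : Finset ℕ → List (ℕ → ℕ))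
    (good_empty : Good ∅) (sub : ∀ S, Good S → S ⊆ A)
    (good_insert : ∀ S, Good S → S ≠ A → ∃ a ∈ A, a ∉ S ∧ Good (insert a S))
    (boxes_empty : ∀ b ∈ boxes ∅, b = 0)
    (len : ∀ S, Good S → (boxes S).length ≤ D.slots)
    (le : ∀ S, Good S → ∀ b ∈ boxes S, ∀ i, b i ≤ D.N)
    (cover : ∀ S, Good S → ∀ a ∈ S, ∃ b ∈ boxes S, BoxLE (D.box X Y a) b)
    (sep : ∀ S, Good S → ∀ a ∈ A, a ∉ S → ∀ b ∈ boxes S, BoxSep b (D.box X Y a))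
    (mono : ∀ S a, Good S → Good (insert a S) → ∀ b ∈ boxes S, ∃ b' ∈ boxes (insert a S), BoxLE b b') :
    D.Accepts := by
  classical
  have key : ∀ m ≤ A.card, ∃ S, Good S ∧ S.card = m ∧
      D.Reach (D.code (D.col '' S) (boxes S)) := by
    intro m
    induction m with
    | zero =>
      intro _
      refine ⟨∅, good_empty, rfl, ?_⟩
      convert Reach.zero (D := D)
      -- Zero boxes and no colors are encoded by the number 0, where the search starts.
      have h1 : ∀ j, (boxes ∅).getD j 0 = 0 := fun j =>
        (getD_mem_or (boxes ∅) j 0).elim (boxes_empty _) id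
      simp only [code, h1, ofDigitFn]
      simp
    | succ m ih =>
      intro hm
      obtain ⟨S, hS, hc, hR⟩ := ih (by omega)
      obtain ⟨a, ha, haS, hG⟩ := good_insert S hS (by rintro rfl; omega)
      refine ⟨insert a S, hG, by rw [Finset.card_insert_of_notMem haS, hc], ?_⟩
      have han := hP.lt a ha
      have hacol := hcol a han
      have hnot : D.col a ∉ D.col '' (S : Set ℕ) := by
        rintro ⟨b, hb, h⟩
        exact haS (hP.color b (sub S hS hb) a ha h ▸ hb)
      have hin : D.col a ∈ D.col '' ((insert a S : Finset ℕ) : Set ℕ) :=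
        ⟨a, by simp, rfl⟩
      have hmin (S) (hS : Good S) (j i : ℕ) : min D.N ((boxes S).getD j 0 i) =
          (boxes S).getD j 0 i := by
        refine min_eq_right ?_
        rcases getD_mem_or (boxes S) j 0 with h | h
        · exact le S hS _ h i
        · rw [h]; exact Nat.zero_le _
      have hcoord (S) (hS : Good S) (C : Set ℕ) {j i : ℕ} (hj : j < D.slots) (hi : i < 4) :
          D.coord (D.code C (boxes S)) j i = (boxes S).getD j 0 i := by
        rw [coord_code C _ hj hi, hmin S hS]
      have hget (S) (hS : Good S) {b : ℕ → ℕ} (hb : b ∈ boxes S) :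
          ∃ j < D.slots, (boxes S).getD j 0 = b := by
        obtain ⟨j, hj, rfl⟩ := List.getElem_of_mem hb
        exact ⟨j, hj.trans_le (len S hS), List.getD_eq_getElem _ _ hj⟩
      have hbox := hP.inside a ha
      refine Reach.step hR (code_lt_code _ _ ?_ hacol hnot hin)
        ⟨a, han, X a, by omega, Y a, by omega, hbox, hP.cells a ha, ?_, ?_, ?_, ?_, ?_, ?_⟩
      · exact Set.image_mono (by simp)
      · rw [bit_code _ _ hacol, if_neg hnot]
      · rw [bit_code _ _ hacol, if_pos hin]
      · intro c hc
        by_cases h : c = D.col a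
        · exact Or.inl h
        · right
          rw [bit_code _ _ hc, bit_code _ _ hc]
          refine if_congr ?_ rfl rfl
          simp [Set.image_insert_eq, h]
      · intro j hj
        have := getD_mem_or (boxes S) j 0
        rw [hcoord S hS _ hj (by omega), hcoord S hS _ hj (by omega), hcoord S hS _ hj (by omega),
          hcoord S hS _ hj (by omega)]
        rcases getD_mem_or (boxes S) j 0 with h | h
        · exact sep S hS a ha haS _ h
        · rw [h]; exact Or.inl (Nat.zero_le _)
      · obtain ⟨b, hb, hb'⟩ := cover _ hG a (Finset.mem_insert_self _ _)
        obtain ⟨j, hj, rfl⟩ := hget _ hG hb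
        refine ⟨j, hj, ?_⟩
        rw [hcoord _ hG _ hj (by omega), hcoord _ hG _ hj (by omega), hcoord _ hG _ hj (by omega),
          hcoord _ hG _ hj (by omega)]
        have := hw a han
        exact hb'.resolve_left (by simp only [box]; omega)
      · intro j hj
        rw [hcoord S hS _ hj (by omega)]
        rcases getD_mem_or (boxes S) j 0 with h | h
        · obtain ⟨b, hb, hb'⟩ := mono S a hS hG _ h
          obtain ⟨i, hi, rfl⟩ := hget _ hG hb
          refine hb'.imp_right fun h' => ⟨i, hi, ?_⟩
          unfold Inside
          rw [hcoord _ hG _ hi (by omega), hcoord _ hG _ hi (by omega), hcoord _ hG _ hi (by omega),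
            hcoord _ hG _ hi (by omega), hcoord S hS _ hj (by omega), hcoord S hS _ hj (by omega),
            hcoord S hS _ hj (by omega), hcoord S hS _ hj (by omega)]
          exact h'
        · left
          rw [h]; rfl
  obtain ⟨S, hS, hc, hR⟩ := key A.card le_rfl
  have hSA : S = A := Finset.eq_of_subset_of_card_le (sub S hS) hc.ge
  subst hSA
  refine ⟨_, code_lt_states _ _, hR, fun c hc => ?_⟩
  rw [bit_code _ _ hc, if_pos]
  exact hA c hc

end Inst

/-! ## Sweeping a chain of subcorridors -/

namespace Sweep

/-- Where the item `a` with the extent `lo`, `hi` is first met in the direction `d`, which is given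
by an axis and an orientation. -/
def start (lo hi : Bool → ℕ → ℕ) (d : Bool × Bool) (a : ℕ) : ℤ :=
  if d.2 then lo d.1 a else -(hi d.1 a : ℤ)

/-- Where the item `a` is left in the direction `d`. -/
def finish (lo hi : Bool → ℕ → ℕ) (d : Bool × Bool) (a : ℕ) : ℤ :=
  if d.2 then hi d.1 a else -(lo d.1 a : ℤ)

/-- The items of `A` lie in the rectangles of a chain; those in the `i`-th rectangle are swept in the
direction `dir i`, and `outer i` tells whether the sweeps start on the outer sides of the bend
between the rectangles `i` and `i + 1`. -/
structure Chain (A : Finset ℕ) (lo hi : Bool → ℕ → ℕ) (k q N : ℕ) (cls : ℕ → ℕ)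
    (dir : ℕ → Bool × Bool) (outer : ℕ → Bool) (Rlo Rhi : Bool → ℕ → ℤ) : Prop where
  cls_mem : ∀ a ∈ A, 1 ≤ cls a ∧ cls a ≤ k
  lt : ∀ a ∈ A, ∀ x, lo x a < hi x a
  le : ∀ a ∈ A, ∀ x, hi x a ≤ N
  disjoint : ∀ a ∈ A, ∀ b ∈ A, a ≠ b → ∃ x, hi x a ≤ lo x b ∨ hi x b ≤ lo x a
  mem : ∀ a ∈ A, ∀ x, Rlo x (cls a) ≤ lo x a ∧ hi x a ≤ Rhi x (cls a)
  far : ∀ i j, 1 ≤ i → i + 2 ≤ j → j ≤ k → ∃ x, Rhi x i ≤ Rlo x j ∨ Rhi x j ≤ Rlo x i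
  bend_outer : ∀ a ∈ A, ∀ b ∈ A, cls b = cls a + 1 → outer (cls a) = true →
    start lo hi (dir (cls b)) a < start lo hi (dir (cls b)) b →
    start lo hi (dir (cls a)) b < start lo hi (dir (cls a)) a → False
  bend_inner : ∀ a ∈ A, ∀ b ∈ A, cls b = cls a + 1 → outer (cls a) = false →
    start lo hi (dir (cls a)) a < finish lo hi (dir (cls a)) b →
    start lo hi (dir (cls b)) b < finish lo hi (dir (cls b)) a → False
  few : ∀ i, ∀ T ⊆ A, (∀ a ∈ T, cls a = i) → ∀ s : ℤ,
    (∀ a ∈ T, start lo hi (dir i) a ≤ s ∧ s < finish lo hi (dir i) a) → T.card ≤ q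

variable {A : Finset ℕ} {lo hi : Bool → ℕ → ℕ} {k q N : ℕ} {cls : ℕ → ℕ} {dir : ℕ → Bool × Bool}
  {outer : ℕ → Bool} {Rlo Rhi : Bool → ℕ → ℤ}

/-- The item `a` may be placed before the item `b`. -/
def Allow (lo hi : Bool → ℕ → ℕ) (cls : ℕ → ℕ) (dir : ℕ → Bool × Bool) (outer : ℕ → Bool)
    (a b : ℕ) : Prop :=
  (cls a = cls b → start lo hi (dir (cls a)) a ≤ start lo hi (dir (cls a)) b) ∧
  ∀ i, (i = cls a ∧ cls b = i + 1) ∨ (i = cls b ∧ cls a = i + 1) →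
    (outer i = true → start lo hi (dir (cls a)) a ≤ start lo hi (dir (cls a)) b) ∧
    (outer i = false → finish lo hi (dir (cls b)) a ≤ start lo hi (dir (cls b)) b)

/-- The items of `S` may be placed before all others. -/
def Good (A : Finset ℕ) (lo hi : Bool → ℕ → ℕ) (cls : ℕ → ℕ) (dir : ℕ → Bool × Bool)
    (outer : ℕ → Bool) (S : Finset ℕ) : Prop :=
  S ⊆ A ∧ ∀ a ∈ S, ∀ b ∈ A, b ∉ S → Allow lo hi cls dir outer a b

/-- In every subcorridor consider the unplaced item that is met first. By the bend conditions, two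
neighbouring subcorridors cannot block each other mutually. As the subcorridors form a path, one of
them is blocked by neither neighbour, and its first item can be placed. -/
theorem Chain.exists_insert (h : Chain A lo hi k q N cls dir outer Rlo Rhi) {S : Finset ℕ}
    (hS : Good A lo hi cls dir outer S) (hne : S ≠ A) :
    ∃ a ∈ A, a ∉ S ∧ Good A lo hi cls dir outer (insert a S) := by
  classical
  let Q : ℕ → ℕ → Prop := fun i m => m ∈ A ∧ m ∉ S ∧ cls m = i ∧
    ∀ b ∈ A, b ∉ S → cls b = i → start lo hi (dir i) m ≤ start lo hi (dir i) b
  have hmin : ∀ i, (∃ a ∈ A, a ∉ S ∧ cls a = i) → ∃ m, Q i m := by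
    rintro i ⟨a, ha, haS, hai⟩
    obtain ⟨m, hm, hm'⟩ := Finset.exists_min_image
      (A.filter fun a => a ∉ S ∧ cls a = i) (start lo hi (dir i)) ⟨a, by simp [ha, haS, hai]⟩
    simp only [Finset.mem_filter] at hm hm'
    exact ⟨m, hm.1, hm.2.1, hm.2.2, fun b hb hbS hbi => hm' b ⟨hb, hbS, hbi⟩⟩
  -- `F i` says that the first item of the subcorridor `i` is not blocked by the subcorridor `i +
  -- 1`. This holds vacuously for the last subcorridor with an unplaced item. The least `i` with `F
  -- i` is the right choice: if the subcorridor before it has unplaced items, that one is blocked by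
  -- `i`, hence does not block `i`.
  let F : ℕ → Prop := fun i => ∃ m, Q i m ∧
    ∀ b ∈ A, b ∉ S → cls b = i + 1 → Allow lo hi cls dir outer m b
  have hex : ∃ i, F i := by
    obtain ⟨a, ha, haS⟩ : ∃ a ∈ A, a ∉ S := by
      by_contra! hcon
      exact hne (Finset.Subset.antisymm hS.1 hcon)
    obtain ⟨c, hc, hc'⟩ := Finset.exists_max_image (A.filter fun a => a ∉ S) cls
      ⟨a, by simp [ha, haS]⟩
    simp only [Finset.mem_filter] at hc hc'
    obtain ⟨m, hm⟩ := hmin (cls c) ⟨c, hc.1, hc.2, rfl⟩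
    refine ⟨cls c, m, hm, fun b hb hbS hbc => ?_⟩
    have := hc' b ⟨hb, hbS⟩
    omega
  obtain ⟨m, ⟨hmA, hmS, hmi, hmmin⟩, hup⟩ := Nat.find_spec hex
  set i := Nat.find hex with hi'
  refine ⟨m, hmA, hmS, Finset.insert_subset hmA hS.1, fun a ha b hb hbS => ?_⟩
  have hbS' : b ∉ S := fun h => hbS (Finset.mem_insert_of_mem h)
  rcases Finset.mem_insert.mp ha with rfl | ha
  swap
  · exact hS.2 a ha b hb hbS'
  by_cases h1 : cls b = i + 1
  · exact hup b hb hbS' h1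
  by_cases h2 : i = cls b + 1
  swap
  · refine ⟨fun h => ?_, fun j hj => ?_⟩
    · rw [hmi]
      exact hmmin b hb hbS' (by omega)
    · omega
  obtain ⟨m', hm'⟩ := hmin (cls b) ⟨b, hb, hbS', rfl⟩
  -- By minimality some unplaced `b'` in the subcorridor of `m` blocks the first item `m'` before
  -- it. If `m` were blocked too, a bend condition would fail: for `b` and `b'` if the sweep starts
  -- on the outer side, and for `m'` and `m` if it starts on the inner side.
  have hnF : ¬ F (cls b) := Nat.find_min hex (by omega)
  obtain ⟨b', hb', hbS'', hcb', hnall⟩ : ∃ b' ∈ A, b' ∉ S ∧ cls b' = cls b + 1 ∧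
      ¬ Allow lo hi cls dir outer m' b' := by
    by_contra! hcon
    exact hnF ⟨m', hm', hcon⟩
  obtain ⟨hm'A, hm'S, hm'i, hm'min⟩ := hm'
  have e1 := hm'min b hb hbS' rfl
  have e2 := hmmin b' hb' hbS'' (by omega)
  have hbi : cls a = cls b + 1 := by omega
  refine ⟨fun h => by omega, fun j hj => ⟨fun ho => ?_, fun ho => ?_⟩⟩
  · obtain rfl : j = cls b := by omega
    by_contra! hlt
    refine hnall ⟨fun h => by omega, fun j hj => ⟨fun _ => ?_, fun ho' => ?_⟩⟩
    · by_contra! hlt'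
      rw [hm'i] at hlt'
      refine h.bend_outer b hb b' hb' hcb' ho ?_ ?_
      · rw [hcb', ← hbi]
        rw [← hmi] at e2
        omega
      · omega
    · obtain rfl : j = cls b := by omega
      simp [ho] at ho'
  · obtain rfl : j = cls b := by omega
    by_contra! hlt
    refine hnall ⟨fun h => by omega, fun j hj => ⟨fun ho' => ?_, fun _ => ?_⟩⟩
    · obtain rfl : j = cls b := by omega
      simp [ho] at ho'
    · by_contra! hlt'
      rw [hcb', ← hbi] at hlt'
      refine h.bend_inner m' hm'A a hmA (by omega) (by rw [hm'i]; exact ho) ?_ ?_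
      · rw [hm'i]
        omega
      · rw [← hmi] at e2
        omega

/-- The bounding box of the items of `T`. -/
def hull (lo hi : Bool → ℕ → ℕ) (T : Finset ℕ) : ℕ → ℕ
  | 0 => if h : T.Nonempty then T.inf' h (lo false) else 0
  | 1 => if h : T.Nonempty then T.inf' h (lo true) else 0
  | 2 => T.sup (hi false)
  | 3 => T.sup (hi true)
  | _ => 0

theorem hull_empty : hull lo hi ∅ = 0 := by
  funext i
  match i with
  | 0 => simp [hull]
  | 1 => simp [hull]
  | 2 => simp [hull]
  | 3 => simp [hull]
  | (_ + 4) => simp [hull]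

theorem hull_mono {T T' : Finset ℕ} (h : T ⊆ T') : Inst.BoxLE (hull lo hi T) (hull lo hi T') := by
  by_cases hT : T.Nonempty
  · right
    have hT' := hT.mono h
    simp only [hull, hT, hT', dif_pos]
    exact ⟨Finset.inf'_mono _ h hT, Finset.inf'_mono _ h hT, Finset.sup_mono h, Finset.sup_mono h⟩
  · left
    rw [Finset.not_nonempty_iff_eq_empty] at hT
    simp [hull, hT]

/-- The item `a` as a box. -/
def itemBox (lo hi : Bool → ℕ → ℕ) (a : ℕ) : ℕ → ℕ := hull lo hi {a}

theorem itemBox_le {T : Finset ℕ} {a : ℕ} (h : a ∈ T) :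
    Inst.BoxLE (itemBox lo hi a) (hull lo hi T) :=
  hull_mono (Finset.singleton_subset_iff.mpr h)

theorem hull_le {T : Finset ℕ} (hlt : ∀ a ∈ T, ∀ x, lo x a < hi x a)
    (hle : ∀ a ∈ T, ∀ x, hi x a ≤ N) (i : ℕ) : hull lo hi T i ≤ N := by
  match i with
  | 0 =>
    simp only [hull]
    split_ifs with h
    · obtain ⟨a, ha⟩ := h
      exact (Finset.inf'_le _ ha).trans ((hlt a ha _).le.trans (hle a ha _))
    · exact Nat.zero_le _
  | 1 =>
    simp only [hull]
    split_ifs with h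
    · obtain ⟨a, ha⟩ := h
      exact (Finset.inf'_le _ ha).trans ((hlt a ha _).le.trans (hle a ha _))
    · exact Nat.zero_le _
  | 2 => exact Finset.sup_le fun a ha => hle a ha _
  | 3 => exact Finset.sup_le fun a ha => hle a ha _
  | (_ + 4) => exact Nat.zero_le _

/-- An item that lies on one side of all items of `T` is disjoint from their bounding box. -/
theorem hull_sep {T : Finset ℕ} {b : ℕ} (x : Bool)
    (h : (∀ a ∈ T, hi x a ≤ lo x b) ∨ (∀ a ∈ T, hi x b ≤ lo x a)) :
    Inst.BoxSep (hull lo hi T) (itemBox lo hi b) := by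
  by_cases hT : T.Nonempty
  · unfold Inst.BoxSep itemBox
    simp only [hull, hT, dif_pos, Finset.singleton_nonempty, Finset.inf'_singleton,
      Finset.sup_singleton]
    cases x
    · rcases h with h | h
      · exact Or.inl (Finset.sup_le h)
      · exact Or.inr (Or.inr (Or.inl (Finset.le_inf' _ _ h)))
    · rcases h with h | h
      · exact Or.inr (Or.inl (Finset.sup_le h))
      · exact Or.inr (Or.inr (Or.inr (Finset.le_inf' _ _ h)))
  · left
    rw [Finset.not_nonempty_iff_eq_empty] at hT
    simp [hull, hT]

theorem hull_sep_of_stop_le {T : Finset ℕ} {b : ℕ} (d : Bool × Bool)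
    (h : ∀ a ∈ T, finish lo hi d a ≤ start lo hi d b) :
    Inst.BoxSep (hull lo hi T) (itemBox lo hi b) := by
  refine hull_sep d.1 ?_
  unfold finish start at h
  by_cases hd : d.2 = true
  · left
    intro a ha
    have := h a ha
    simp only [hd, if_true] at this
    omega
  · right
    intro a ha
    have := h a ha
    simp only [hd] at this
    simp only [Bool.false_eq_true, if_false] at this
    omega

open Classical in
/-- The items of `S` in the rectangle `i` that the sweep line has left. -/
noncomputable def passed (lo hi : Bool → ℕ → ℕ) (cls : ℕ → ℕ) (dir : ℕ → Bool × Bool)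
    (S : Finset ℕ) (i : ℕ) : Finset ℕ :=
  S.filter fun a => cls a = i ∧ ∃ a' ∈ S, cls a' = i ∧ finish lo hi (dir i) a ≤ start lo hi (dir i) a'

open Classical in
/-- The items of `S` that meet a sweep line. -/
noncomputable def active (lo hi : Bool → ℕ → ℕ) (cls : ℕ → ℕ) (dir : ℕ → Bool × Bool)
    (S : Finset ℕ) : Finset ℕ :=
  S.filter fun a => ∀ a' ∈ S, cls a' = cls a →
    start lo hi (dir (cls a)) a' < finish lo hi (dir (cls a)) a

/-- Boxes that separate the items of `S` from the others. -/
noncomputable def boxes (lo hi : Bool → ℕ → ℕ) (cls : ℕ → ℕ) (dir : ℕ → Bool × Bool) (k : ℕ)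
    (S : Finset ℕ) : List (ℕ → ℕ) :=
  (List.range k).map (fun i => hull lo hi (passed lo hi cls dir S (i + 1))) ++
    (active lo hi cls dir S).toList.map (itemBox lo hi)

theorem mem_boxes {S : Finset ℕ} {b : ℕ → ℕ} : b ∈ boxes lo hi cls dir k S ↔
    (∃ i < k, hull lo hi (passed lo hi cls dir S (i + 1)) = b) ∨
      ∃ a ∈ active lo hi cls dir S, itemBox lo hi a = b := by
  simp [boxes]

/-- All active items of one subcorridor meet the sweep line at the largest start among them, so
`few` bounds their number. -/
theorem Chain.length_boxes (h : Chain A lo hi k q N cls dir outer Rlo Rhi) {S : Finset ℕ}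
    (hS : S ⊆ A) : (boxes lo hi cls dir k S).length ≤ k * (q + 1) := by
  classical
  have hcard : (active lo hi cls dir S).card ≤ q * (Finset.Icc 1 k).card := by
    have hsub : active lo hi cls dir S ⊆ S := Finset.filter_subset _ _
    refine Finset.card_le_mul_card_image_of_maps_to (f := cls)
      (fun a ha => Finset.mem_Icc.mpr (h.cls_mem a (hS (hsub ha)))) q fun i _ => ?_
    set T := (active lo hi cls dir S).filter fun a => cls a = i with hT
    by_cases hne : T.Nonempty
    swap
    · rw [Finset.not_nonempty_iff_eq_empty.mp hne]; simp
    obtain ⟨m, hm, hmax⟩ := Finset.exists_max_image T (start lo hi (dir i)) hne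
    refine h.few i T (fun a ha => hS (hsub (Finset.mem_filter.mp ha).1))
      (fun a ha => (Finset.mem_filter.mp ha).2) (start lo hi (dir i) m) fun a ha => ⟨hmax a ha, ?_⟩
    obtain ⟨ha1, ha2⟩ := Finset.mem_filter.mp ha
    obtain ⟨hm1, hm2⟩ := Finset.mem_filter.mp hm
    have := (Finset.mem_filter.mp ha1).2 m (hsub hm1) (by rw [hm2, ha2])
    rwa [ha2] at this
  simp only [boxes, List.length_append, List.length_map, List.length_range, Finset.length_toList]
  rw [Nat.card_Icc, Nat.add_sub_cancel] at hcard
  nlinarith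

/-- An unplaced item of the same subcorridor starts after the sweep line, and the passed items end
before it. At a bend swept from the outer side, the sweep of the passed items separates in the same
way; at one swept from the inner side, the sweep of the unplaced item does. Other subcorridors have
separated rectangles. -/
theorem Chain.sep_boxes (h : Chain A lo hi k q N cls dir outer Rlo Rhi) {S : Finset ℕ}
    (hS : Good A lo hi cls dir outer S) {b : ℕ} (hb : b ∈ A) (hbS : b ∉ S) :
    ∀ c ∈ boxes lo hi cls dir k S, Inst.BoxSep c (itemBox lo hi b) := by
  intro c hc
  rcases mem_boxes.mp hc with ⟨i, hi', rfl⟩ | ⟨a, ha, rfl⟩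
  · set T := passed lo hi cls dir S (i + 1) with hT
    have hmem : ∀ a ∈ T, a ∈ S ∧ cls a = i + 1 ∧ ∃ a' ∈ S, cls a' = i + 1 ∧
        finish lo hi (dir (i + 1)) a ≤ start lo hi (dir (i + 1)) a' := fun a ha => by
      simpa [hT, passed] using ha
    have hcb := h.cls_mem b hb
    by_cases h1 : cls b = i + 1
    · refine hull_sep_of_stop_le (dir (i + 1)) fun a ha => ?_
      obtain ⟨-, -, a', ha', hca', hle⟩ := hmem a ha
      have := (hS.2 a' ha' b hb hbS).1 (by omega)
      rw [hca'] at this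
      omega
    by_cases h2 : cls b = i + 2 ∨ cls b = i
    · obtain ⟨j, hj⟩ : ∃ j, (j = i + 1 ∧ cls b = j + 1) ∨ (j = cls b ∧ i + 1 = j + 1) := by
        rcases h2 with h2 | h2
        · exact ⟨i + 1, Or.inl ⟨rfl, by omega⟩⟩
        · exact ⟨i, Or.inr ⟨by omega, rfl⟩⟩
      cases ho : outer j
      · refine hull_sep_of_stop_le (dir (cls b)) fun a ha => ?_
        obtain ⟨haS, hca, -⟩ := hmem a ha
        exact ((hS.2 a haS b hb hbS).2 j (by rw [hca]; exact hj)).2 ho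
      · refine hull_sep_of_stop_le (dir (i + 1)) fun a ha => ?_
        obtain ⟨-, -, a', ha', hca', hle⟩ := hmem a ha
        have := ((hS.2 a' ha' b hb hbS).2 j (by rw [hca']; exact hj)).1 ho
        rw [hca'] at this
        omega
    · obtain ⟨x, hx⟩ : ∃ x, Rhi x (i + 1) ≤ Rlo x (cls b) ∨ Rhi x (cls b) ≤ Rlo x (i + 1) := by
        rcases lt_or_ge (i + 1) (cls b) with hlt | hge
        · exact h.far (i + 1) (cls b) (by omega) (by omega) (by omega)
        · obtain ⟨x, hx⟩ := h.far (cls b) (i + 1) (by omega) (by omega) (by omega)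
          exact ⟨x, hx.symm⟩
      refine hull_sep x ?_
      have hbR := h.mem b hb x
      refine hx.imp (fun hx a ha => ?_) (fun hx a ha => ?_)
      all_goals
        obtain ⟨haS, hca, -⟩ := hmem a ha
        have haR := h.mem a (hS.1 haS) x
        rw [hca] at haR
        omega
  · have haS : a ∈ S := (Finset.mem_filter.mp ha).1
    obtain ⟨x, hx⟩ := h.disjoint a (hS.1 haS) b hb (by rintro rfl; exact hbS haS)
    exact hull_sep x (by simpa using hx)

theorem Chain.cover_boxes (h : Chain A lo hi k q N cls dir outer Rlo Rhi) {S : Finset ℕ}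
    (hS : S ⊆ A) {a : ℕ} (ha : a ∈ S) :
    ∃ b ∈ boxes lo hi cls dir k S, Inst.BoxLE (itemBox lo hi a) b := by
  classical
  by_cases hact : a ∈ active lo hi cls dir S
  · exact ⟨_, mem_boxes.mpr (Or.inr ⟨a, hact, rfl⟩), itemBox_le (Finset.mem_singleton_self a)⟩
  · have hca := h.cls_mem a (hS ha)
    refine ⟨_, mem_boxes.mpr (Or.inl ⟨cls a - 1, by omega, rfl⟩), itemBox_le ?_⟩
    rw [Nat.sub_add_cancel hca.1]
    simp only [active, Finset.mem_filter, ha, true_and] at hact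
    push Not at hact
    simpa [passed, ha] using hact

/-- The sets of passed items only grow, and an active item either stays active or is passed. -/
theorem Chain.mono_boxes (h : Chain A lo hi k q N cls dir outer Rlo Rhi) {S S' : Finset ℕ}
    (hS' : S' ⊆ A) (hsub : S ⊆ S') {b : ℕ → ℕ} (hb : b ∈ boxes lo hi cls dir k S) :
    ∃ b' ∈ boxes lo hi cls dir k S', Inst.BoxLE b b' := by
  classical
  rcases mem_boxes.mp hb with ⟨i, hi', rfl⟩ | ⟨a, ha, rfl⟩
  · refine ⟨_, mem_boxes.mpr (Or.inl ⟨i, hi', rfl⟩), hull_mono fun a ha => ?_⟩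
    simp only [passed, Finset.mem_filter] at ha ⊢
    obtain ⟨h1, h2, a', h3, h4⟩ := ha
    exact ⟨hsub h1, h2, a', hsub h3, h4⟩
  · exact h.cover_boxes hS' (hsub (Finset.mem_filter.mp ha).1)

end Sweep

theorem Inst.accepts_of_chain {D : Inst} {A : Finset ℕ} {X Y : ℕ → ℕ} (hP : D.Packing A X Y)
    (hw : ∀ a < D.n, 0 < D.w a) (hcol : ∀ a < D.n, D.col a < D.γ)
    (hA : ∀ c < D.γ, ∃ a ∈ A, D.col a = c) {lo hi : Bool → ℕ → ℕ} (hlo0 : lo false = X)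
    (hlo1 : lo true = Y) (hhi0 : hi false = X + D.w) (hhi1 : hi true = Y + D.h) {cls : ℕ → ℕ}
    {dir : ℕ → Bool × Bool} {outer : ℕ → Bool} {Rlo Rhi : Bool → ℕ → ℤ}
    (h : Sweep.Chain A lo hi D.k D.width D.N cls dir outer Rlo Rhi) : D.Accepts := by
  classical
  have hbox : ∀ a i, i < 4 → Sweep.itemBox lo hi a i = D.box X Y a i := by
    intro a i hi'
    unfold Sweep.itemBox
    interval_cases i <;> simp [Sweep.hull, box, hlo0, hlo1, hhi0, hhi1]
  have hBoxLE : ∀ a b, BoxLE (Sweep.itemBox lo hi a) b → BoxLE (D.box X Y a) b := by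
    intro a b
    unfold BoxLE
    rw [hbox a 0 (by omega), hbox a 1 (by omega), hbox a 2 (by omega), hbox a 3 (by omega)]
    exact id
  have hBoxSep : ∀ a b, BoxSep b (Sweep.itemBox lo hi a) → BoxSep b (D.box X Y a) := by
    intro a b
    unfold BoxSep
    rw [hbox a 0 (by omega), hbox a 1 (by omega), hbox a 2 (by omega), hbox a 3 (by omega)]
    exact id
  refine accepts_of_boxes hP hw hcol hA (Sweep.Good A lo hi cls dir outer)
    (Sweep.boxes lo hi cls dir D.k) ⟨Finset.empty_subset _, by simp⟩ (fun S hS => hS.1)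
    (fun S hS hne => h.exists_insert hS hne) ?_ (fun S hS => h.length_boxes hS.1) ?_
    (fun S hS a ha => ?_) (fun S hS a ha haS b hb => hBoxSep _ _ (h.sep_boxes hS ha haS b hb))
    (fun S a hS hS' b hb => h.mono_boxes hS'.1 (Finset.subset_insert _ _) hb)
  · intro b hb
    rcases Sweep.mem_boxes.mp hb with ⟨i, -, rfl⟩ | ⟨a, ha, rfl⟩
    · rw [show Sweep.passed lo hi cls dir ∅ (i + 1) = ∅ by simp [Sweep.passed], Sweep.hull_empty]
    · simp [Sweep.active] at ha
  · intro S hS b hb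
    rcases Sweep.mem_boxes.mp hb with ⟨i, -, rfl⟩ | ⟨a, ha, rfl⟩
    · exact Sweep.hull_le (fun a ha => h.lt a (hS.1 (Finset.mem_filter.mp ha).1))
        (fun a ha => h.le a (hS.1 (Finset.mem_filter.mp ha).1))
    · have haA := hS.1 (Finset.mem_filter.mp ha).1
      refine Sweep.hull_le (fun b hb => ?_) (fun b hb => ?_) <;> rw [Finset.mem_singleton.mp hb]
      exacts [h.lt a haA, h.le a haA]
  · obtain ⟨b, hb, hle⟩ := h.cover_boxes hS.1 ha
    exact ⟨b, hb, hBoxLE _ _ hle⟩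

/-! ## The geometry of a path corridor -/

namespace Corr

/-- The extent of the edge `i` of the side `s` along the axis `x`. -/
def elo (v : Bool → Bool → ℕ → ℤ) (s : Bool) (i : ℕ) (x : Bool) : ℤ := min (v x s i) (v x s (i + 1))

def ehi (v : Bool → Bool → ℕ → ℤ) (s : Bool) (i : ℕ) (x : Bool) : ℤ := max (v x s i) (v x s (i + 1))

/-- The extent of the rectangle of the subcorridor `i` along the axis `x`. -/
def Rlo (v : Bool → Bool → ℕ → ℤ) (x : Bool) (i : ℕ) : ℤ := min (elo v true i x) (elo v false i x)

def Rhi (v : Bool → Bool → ℕ → ℤ) (x : Bool) (i : ℕ) : ℤ := max (ehi v true i x) (ehi v false i x)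

/-- Two boxes, given by their extents along both axes, meet. -/
def Touch (l h l' h' : Bool → ℤ) : Prop := ∀ x, l x ≤ h' x ∧ l' x ≤ h x

/-- A path corridor. It has two sides; the coordinate along the axis `x` of the vertex `i` of the
side `s` is `v x s i`, and the edge `i` of the side `s` joins the vertices `i` and `i + 1`. The
subcorridor `i` leads along the axis `t i`; it is crossed by a line through the cells with coordinate
`c i` along this axis. -/
structure IsCorr (k : ℕ) (v : Bool → Bool → ℕ → ℤ) (t : ℕ → Bool) (c : ℕ → ℤ) (w : ℤ) : Prop where
  one_le : 1 ≤ k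
  alt : ∀ i, t (i + 1) = !t i
  par : ∀ i ≤ k + 1, ∀ s, v (!t i) s i = v (!t i) s (i + 1)
  cap_start : ∀ x s, v x s 0 = v x (!s) 1
  cap_end : ∀ x s, v x s (k + 2) = v x (!s) (k + 1)
  chord : ∀ i, 1 ≤ i → i ≤ k → ∀ s, (v (t i) s i ≤ c i ∧ c i + 1 ≤ v (t i) s (i + 1)) ∨
    (v (t i) s (i + 1) ≤ c i ∧ c i + 1 ≤ v (t i) s i)
  width : ∀ i, 1 ≤ i → i ≤ k → |v (!t i) true i - v (!t i) false i| ≤ w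
  length : ∀ i, 1 ≤ i → i ≤ k → ∀ s, w < |v (t i) s i - v (t i) s (i + 1)|
  far : ∀ s s' i j, i + 2 ≤ j → j ≤ k + 1 →
    ¬ Touch (elo v s i) (ehi v s i) (elo v s' j) (ehi v s' j)
  opp : ∀ s i j, 1 ≤ i → i ≤ k → 1 ≤ j → j ≤ k →
    ¬ Touch (elo v s i) (ehi v s i) (elo v (!s) j) (ehi v (!s) j)
  free : ∀ i, 1 ≤ i → i ≤ k → ∀ j ≤ k + 1, j ≠ i → ∀ s,
    ¬ (elo v s j (t i) ≤ c i ∧ c i + 1 ≤ ehi v s j (t i) ∧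
      elo v s j (!t i) ≤ max (v (!t i) true i) (v (!t i) false i) ∧
      min (v (!t i) true i) (v (!t i) false i) ≤ ehi v s j (!t i))

variable {k : ℕ} {v : Bool → Bool → ℕ → ℤ} {t : ℕ → Bool} {c : ℕ → ℤ} {w : ℤ}

theorem forall_bool_not {p : Bool → Prop} (b : Bool) : (∀ x, p x) ↔ p b ∧ p (!b) := by
  cases b <;> simp [and_comm]

theorem not_touch_iff (x : Bool) {l h l' h' : Bool → ℤ} : ¬ Touch l h l' h' ↔
    ¬ (l x ≤ h' x ∧ l' x ≤ h x ∧ l (!x) ≤ h' (!x) ∧ l' (!x) ≤ h (!x)) := by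
  unfold Touch
  rw [forall_bool_not x]
  tauto

theorem touch_symm {l h l' h' : Bool → ℤ} (H : Touch l h l' h') : Touch l' h' l h :=
  fun x => (H x).symm

theorem IsCorr.alt' (H : IsCorr k v t c w) (i : ℕ) : t (i + 2) = t i := by
  rw [H.alt, H.alt, Bool.not_not]

theorem IsCorr.cross (H : IsCorr k v t c w) {i : ℕ} (hi : i ≤ k + 1) (s : Bool) :
    v (!t i) s (i + 1) = v (!t i) s i := (H.par i hi s).symm

/-- The vertices between two subcorridors do not turn back. -/
theorem IsCorr.cross_succ (H : IsCorr k v t c w) {i : ℕ} (hi : i ≤ k) (s : Bool) :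
    v (t i) s (i + 2) = v (t i) s (i + 1) := by
  have := H.cross (i := i + 1) (by omega) s
  rwa [H.alt, Bool.not_not] at this

/-- Across the subcorridor `i` this is its width. Along it, it is the width of the subcorridor `i -
1`, whose axis is the other one; at the two ends of the corridor the coordinate of the end edge is
common to both sides. -/
theorem IsCorr.vertex_width (H : IsCorr k v t c w) {i : ℕ} (h1 : 1 ≤ i) (hk : i ≤ k + 1) (x : Bool) :
    |v x true i - v x false i| ≤ w := by
  have h0 : 0 ≤ w := (abs_nonneg _).trans (H.width 1 le_rfl H.one_le)
  obtain ⟨i, rfl⟩ := Nat.exists_eq_add_of_le' h1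
  have e := H.alt i
  rcases Bool.eq_or_eq_not x (t i) with rfl | hx
  · by_cases hik : i + 1 ≤ k
    · have := H.width (i + 1) h1 hik
      rwa [H.alt, Bool.not_not] at this
    · obtain rfl : i = k := by omega
      have e1 := H.cross_succ (le_refl i) true
      have e2 := H.cross_succ (le_refl i) false
      have e3 := H.cap_end (t i) true
      simp only [Bool.not_true] at e3
      rw [show v (t i) true (i + 1) - v (t i) false (i + 1) = 0 by omega, abs_zero]
      exact h0
  · subst hx
    by_cases hi : 1 ≤ i
    · have := H.width i hi (by omega)
      rwa [H.par i (by omega), H.par i (by omega)] at this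
    · obtain rfl : i = 0 := by omega
      have e1 := H.cross (i := 0) (by omega) true
      have e3 := H.cap_start (!t 0) true
      simp only [Bool.not_true, zero_add] at e1 e3 ⊢
      rw [show v (!t 0) true 1 - v (!t 0) false 1 = 0 by omega, abs_zero]
      exact h0

/-- Both sides of a subcorridor lead in the same direction. -/
theorem IsCorr.direction (H : IsCorr k v t c w) {i : ℕ} (h1 : 1 ≤ i) (hk : i ≤ k) :
    (∀ s, v (t i) s i ≤ c i ∧ c i + 1 ≤ v (t i) s (i + 1)) ∨
      ∀ s, v (t i) s (i + 1) ≤ c i ∧ c i + 1 ≤ v (t i) s i := by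
  have w1 := abs_le.mp (H.vertex_width h1 (by omega) (t i))
  have w2 := abs_le.mp (H.vertex_width (i := i + 1) (by omega) (by omega) (t i))
  have ct := H.chord i h1 hk true
  have cf := H.chord i h1 hk false
  have lt := lt_abs.mp (H.length i h1 hk true)
  have lf := lt_abs.mp (H.length i h1 hk false)
  simp only [Bool.forall_bool]
  omega

/-- Otherwise both edges would lie on one line, and as both run through the same crossing cell they
would touch. -/
theorem IsCorr.cross_ne (H : IsCorr k v t c w) {i : ℕ} (h1 : 1 ≤ i) (hk : i ≤ k) :
    v (!t i) true i ≠ v (!t i) false i := by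
  intro he
  have h := (not_touch_iff (t i)).mp (H.opp true i i h1 hk h1 hk)
  have ct := H.chord i h1 hk true
  have cf := H.chord i h1 hk false
  have e1 := H.cross (i := i) (by omega) true
  have e2 := H.cross (i := i) (by omega) false
  simp only [elo, ehi, Bool.not_true] at h
  omega

/-- The shape of a bend: `o` is its outer side. -/
theorem IsCorr.bend (H : IsCorr k v t c w) {i : ℕ} (h1 : 1 ≤ i) (hk : i < k) :
    ∃ o, ((∀ s, v (!t i) s (i + 1) ≤ c (i + 1) ∧ c (i + 1) + 1 ≤ v (!t i) s (i + 2)) ∧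
        v (!t i) o i < v (!t i) (!o) i ∨
      (∀ s, v (!t i) s (i + 2) ≤ c (i + 1) ∧ c (i + 1) + 1 ≤ v (!t i) s (i + 1)) ∧
        v (!t i) (!o) i < v (!t i) o i) ∧
      ((∀ s, v (t i) s i ≤ c i ∧ c i + 1 ≤ v (t i) s (i + 1)) ∧
        v (t i) (!o) (i + 1) < v (t i) o (i + 1) ∨
      (∀ s, v (t i) s (i + 1) ≤ c i ∧ c i + 1 ≤ v (t i) s i) ∧
        v (t i) o (i + 1) < v (t i) (!o) (i + 1)) := by
  have hd := H.direction h1 hk.le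
  have hd' := H.direction (i := i + 1) (by omega) hk
  rw [H.alt] at hd'
  have hne := H.cross_ne h1 hk.le
  obtain ⟨o, ho⟩ : ∃ o, (∀ s, v (!t i) s (i + 1) ≤ c (i + 1) ∧
        c (i + 1) + 1 ≤ v (!t i) s (i + 2)) ∧ v (!t i) o i < v (!t i) (!o) i ∨
      (∀ s, v (!t i) s (i + 2) ≤ c (i + 1) ∧ c (i + 1) + 1 ≤ v (!t i) s (i + 1)) ∧
        v (!t i) (!o) i < v (!t i) o i := by
    rcases hd' with h | h <;> rcases lt_or_gt_of_ne hne with h' | h'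
    exacts [⟨true, Or.inl ⟨h, h'⟩⟩, ⟨false, Or.inl ⟨h, h'⟩⟩, ⟨false, Or.inr ⟨h, h'⟩⟩,
      ⟨true, Or.inr ⟨h, h'⟩⟩]
  refine ⟨o, ho, ?_⟩
  -- The edge `i + 1` of the side `o` passes the line of the edge `i` of the other side. As the two
  -- do not touch, that edge ends before reaching it.
  have h := (not_touch_iff (t i)).mp (H.opp o (i + 1) i (by omega) hk h1 hk.le)
  have e1 := H.cross (i := i) (by omega) o
  have e2 := H.cross (i := i) (by omega) (!o)
  have e3 := H.cross_succ (i := i) (by omega) o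
  simp only [elo, ehi, show i + 1 + 1 = i + 2 from rfl] at h
  simp only [forall_bool_not o] at hd ho ⊢
  omega

/-- A segment that does not cross the boundary of a bend and has a point outside is outside. -/
theorem avoid_bend {x0o x0n xo xn c yo yn r y2o y2n l₁ h₁ l₂ h₂ z₁ z₂ : ℤ} (a1 : x0o ≤ c)
    (a2 : x0n ≤ c) (a3 : c + 1 ≤ xn) (a4 : xn < xo) (a5 : yo < yn) (a6 : yn ≤ r) (a7 : r + 1 ≤ y2o)
    (a8 : r + 1 ≤ y2n) (b1 : l₁ ≤ z₁) (b2 : z₁ ≤ h₁) (b3 : l₂ ≤ z₂) (b4 : z₂ ≤ h₂)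
    (b5 : l₁ = h₁ ∨ l₂ = h₂)
    (h1 : ¬ (l₁ ≤ xo ∧ x0o ≤ h₁ ∧ l₂ ≤ yo ∧ yo ≤ h₂))
    (h2 : ¬ (l₁ ≤ xn ∧ x0n ≤ h₁ ∧ l₂ ≤ yn ∧ yn ≤ h₂))
    (h3 : ¬ (l₁ ≤ xo ∧ xo ≤ h₁ ∧ l₂ ≤ y2o ∧ yo ≤ h₂))
    (h4 : ¬ (l₁ ≤ xn ∧ xn ≤ h₁ ∧ l₂ ≤ y2n ∧ yn ≤ h₂))
    (h5 : ¬ (l₁ ≤ c ∧ c + 1 ≤ h₁ ∧ l₂ ≤ yn ∧ yo ≤ h₂))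
    (h6 : ¬ (l₂ ≤ r ∧ r + 1 ≤ h₂ ∧ l₁ ≤ xo ∧ xn ≤ h₁))
    (hz1 : ¬ (c + 1 ≤ z₁ ∧ z₁ < xo ∧ yo < z₂ ∧ z₂ < yn))
    (hz2 : ¬ (xn < z₁ ∧ z₁ < xo ∧ yo < z₂ ∧ z₂ ≤ r)) :
    ¬ (c + 1 ≤ h₁ ∧ l₁ < xo ∧ yo < h₂ ∧ l₂ < yn) ∧
      ¬ (xn < h₁ ∧ l₁ < xo ∧ yo < h₂ ∧ l₂ ≤ r) := by
  rcases b5 with rfl | rfl <;> constructor <;> omega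

/-- Both orientations of the second arm reduce to `avoid_bend` by reflecting the second axis. The
reflection sends `r` to `-r - 1` because `r` stands for the cell between `r` and `r + 1`. -/
theorem avoid_bend_half {x0o x0n xo xn c yo yn r y2o y2n l₁ h₁ l₂ h₂ z₁ z₂ T' V V' : ℤ}
    (hT' : T' = yo ∨ T' = yn) (a1 : x0o ≤ c) (a2 : x0n ≤ c) (a3 : c + 1 ≤ xn) (a4 : xn < xo)
    (hy : ((yo ≤ r ∧ r + 1 ≤ y2o) ∧ yn ≤ r ∧ r + 1 ≤ y2n) ∧ yo < yn ∨
      ((y2o ≤ r ∧ r + 1 ≤ yo) ∧ y2n ≤ r ∧ r + 1 ≤ yn) ∧ yn < yo)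
    (hV : V = min (min yo y2o) (min yn y2n)) (hV' : V' = max (max yo y2o) (max yn y2n))
    (z1 : l₁ ≤ z₁) (z1' : z₁ ≤ h₁) (z2 : l₂ ≤ z₂) (z2' : z₂ ≤ h₂) (b5 : l₁ = h₁ ∨ l₂ = h₂) :
    ¬ (l₁ ≤ xo ∧ x0o ≤ h₁ ∧ l₂ ≤ yo ∧ yo ≤ h₂) →
    ¬ (l₁ ≤ xn ∧ x0n ≤ h₁ ∧ l₂ ≤ yn ∧ yn ≤ h₂) →
    ¬ (l₁ ≤ xo ∧ xo ≤ h₁ ∧ l₂ ≤ max yo y2o ∧ min yo y2o ≤ h₂) →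
    ¬ (l₁ ≤ xn ∧ xn ≤ h₁ ∧ l₂ ≤ max yn y2n ∧ min yn y2n ≤ h₂) →
    ¬ (l₁ ≤ c ∧ c + 1 ≤ h₁ ∧ l₂ ≤ max yo yn ∧ min yo yn ≤ h₂) →
    ¬ (l₂ ≤ r ∧ r + 1 ≤ h₂ ∧ l₁ ≤ xo ∧ xn ≤ h₁) →
    ¬ (c + 1 ≤ z₁ ∧ z₁ < xo ∧ min yo yn < z₂ ∧ z₂ < max yo yn) →
    ¬ ((T' ≤ r ∧ z₂ ≤ r ∧ V < z₂ ∨ r + 1 ≤ T' ∧ r + 1 ≤ z₂ ∧ z₂ < V') ∧ xn < z₁ ∧ z₁ < xo) →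
    ¬ (c + 1 ≤ h₁ ∧ l₁ < xo ∧ min yo yn < h₂ ∧ l₂ < max yo yn) ∧
    ¬ ((T' ≤ r ∧ l₂ ≤ r ∧ V < h₂ ∨ r + 1 ≤ T' ∧ r + 1 ≤ h₂ ∧ l₂ < V') ∧ xn < h₁ ∧ l₁ < xo) := by
  rcases hy with ⟨⟨⟨q5, q6⟩, q7, q8⟩, hyo⟩ | ⟨⟨⟨q5, q6⟩, q7, q8⟩, hyo⟩
  · obtain rfl : V = yo := by omega
    have hT1 : T' ≤ r := by omega
    have hT2 : ¬ r + 1 ≤ T' := by omega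
    simp only [hT1, hT2, true_and, false_and, or_false]
    rw [max_eq_right (by omega : V ≤ yn), min_eq_left (by omega : V ≤ yn), min_eq_left (by omega),
      max_eq_right (by omega), min_eq_left (by omega), max_eq_right (by omega)]
    intro E1 E2 E3 E4 hf hf' hP hM
    obtain ⟨R1, R2⟩ := avoid_bend a1 a2 a3 a4 hyo q7 q6 q8 z1 z1' z2 z2' b5 E1 E2
      (fun h => E3 ⟨h.1, h.2.1, h.2.2⟩) (fun h => E4 ⟨h.1, h.2.1, h.2.2.1, h.2.2.2.trans' (by linarith)⟩) hf
      (fun h => hf' ⟨h.1, h.2.1, h.2.2⟩) hP (fun h => hM ⟨⟨h.2.2.2, h.2.2.1⟩, h.1, h.2.1⟩)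
    exact ⟨R1, fun h => R2 ⟨h.2.1, h.2.2, h.1.2, h.1.1⟩⟩
  · obtain rfl : V' = yo := by omega
    have hT1 : ¬ T' ≤ r := by omega
    have hT2 : r + 1 ≤ T' := by omega
    simp only [hT1, hT2, true_and, false_and, false_or]
    rw [max_eq_left (by omega : yn ≤ V'), min_eq_right (by omega : yn ≤ V'),
      min_eq_right (by omega), max_eq_left (by omega), min_eq_right (by omega),
      max_eq_left (by omega)]
    intro E1 E2 E3 E4 hf hf' hP hM
    obtain ⟨R1, R2⟩ := avoid_bend (yo := -V') (yn := -yn) (y2o := -y2o) (y2n := -y2n) (r := -r - 1)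
      (l₂ := -h₂) (h₂ := -l₂) (z₂ := -z₂) a1 a2 a3 a4 (by linarith) (by linarith) (by linarith)
      (by linarith) z1 z1' (by linarith) (by linarith) (b5.imp_right (by simp +contextual))
      (fun h => E1 ⟨h.1, h.2.1, by linarith, by linarith⟩)
      (fun h => E2 ⟨h.1, h.2.1, by linarith, by linarith⟩)
      (fun h => E3 ⟨h.1, h.2.1, by linarith, by linarith⟩)
      (fun h => E4 ⟨h.1, h.2.1, by linarith, by linarith⟩)
      (fun h => hf ⟨h.1, h.2.1, by linarith, by linarith⟩)
      (fun h => hf' ⟨by linarith, by linarith, h.2.2⟩)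
      (fun h => hP ⟨h.1, h.2.1, by linarith, by linarith⟩)
      (fun h => hM ⟨⟨by linarith, by linarith⟩, h.1, h.2.1⟩)
    exact ⟨fun h => R1 ⟨h.1, h.2.1, by linarith, by linarith⟩,
      fun h => R2 ⟨h.2.1, h.2.2, by linarith, by linarith⟩⟩

/-- A reflection of the first axis removes the remaining assumption on the orientation. `U`, `U'`
and `V`, `V'` are the extents of the two rectangles along their own axes; where the arms meet they
end at the outer side. -/
theorem avoid_bend_signed {x0o x0n xo xn c yo yn r y2o y2n l₁ h₁ l₂ h₂ z₁ z₂ T T' U U' V V' : ℤ}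
    (hT : T = x0o ∨ T = x0n) (hT' : T' = yo ∨ T' = yn)
    (hx : ((x0o ≤ c ∧ c + 1 ≤ xo) ∧ x0n ≤ c ∧ c + 1 ≤ xn) ∧ xn < xo ∨
      ((xo ≤ c ∧ c + 1 ≤ x0o) ∧ xn ≤ c ∧ c + 1 ≤ x0n) ∧ xo < xn)
    (hy : ((yo ≤ r ∧ r + 1 ≤ y2o) ∧ yn ≤ r ∧ r + 1 ≤ y2n) ∧ yo < yn ∨
      ((y2o ≤ r ∧ r + 1 ≤ yo) ∧ y2n ≤ r ∧ r + 1 ≤ yn) ∧ yn < yo)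
    (hU : U = min (min x0o xo) (min x0n xn)) (hU' : U' = max (max x0o xo) (max x0n xn))
    (hV : V = min (min yo y2o) (min yn y2n)) (hV' : V' = max (max yo y2o) (max yn y2n))
    (z1 : l₁ ≤ z₁ ∧ z₁ ≤ h₁) (z2 : l₂ ≤ z₂ ∧ z₂ ≤ h₂) (b5 : l₁ = h₁ ∨ l₂ = h₂) :
    ¬ (min x0o xo ≤ h₁ ∧ l₁ ≤ max x0o xo ∧ yo ≤ h₂ ∧ l₂ ≤ yo) →
    ¬ (min x0n xn ≤ h₁ ∧ l₁ ≤ max x0n xn ∧ yn ≤ h₂ ∧ l₂ ≤ yn) →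
    ¬ (xo ≤ h₁ ∧ l₁ ≤ xo ∧ min yo y2o ≤ h₂ ∧ l₂ ≤ max yo y2o) →
    ¬ (xn ≤ h₁ ∧ l₁ ≤ xn ∧ min yn y2n ≤ h₂ ∧ l₂ ≤ max yn y2n) →
    ¬ (l₁ ≤ c ∧ c + 1 ≤ h₁ ∧ l₂ ≤ max yo yn ∧ min yo yn ≤ h₂) →
    ¬ (l₂ ≤ r ∧ r + 1 ≤ h₂ ∧ l₁ ≤ max xo xn ∧ min xo xn ≤ h₁) →
    ¬ ((T ≤ c ∧ c + 1 ≤ z₁ ∧ z₁ < U' ∨ c + 1 ≤ T ∧ z₁ ≤ c ∧ U < z₁) ∧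
      min yo yn < z₂ ∧ z₂ < max yo yn) →
    ¬ ((T' ≤ r ∧ z₂ ≤ r ∧ V < z₂ ∨ r + 1 ≤ T' ∧ r + 1 ≤ z₂ ∧ z₂ < V') ∧
      min xo xn < z₁ ∧ z₁ < max xo xn) →
    ¬ ((T ≤ c ∧ c + 1 ≤ h₁ ∧ l₁ < U' ∨ c + 1 ≤ T ∧ l₁ ≤ c ∧ U < h₁) ∧
      min yo yn < h₂ ∧ l₂ < max yo yn) ∧
    ¬ ((T' ≤ r ∧ l₂ ≤ r ∧ V < h₂ ∨ r + 1 ≤ T' ∧ r + 1 ≤ h₂ ∧ l₂ < V') ∧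
      min xo xn < h₁ ∧ l₁ < max xo xn) := by
  rcases hx with ⟨⟨⟨q1, q2⟩, q3, q4⟩, hxo⟩ | ⟨⟨⟨q1, q2⟩, q3, q4⟩, hxo⟩
  · obtain rfl : U' = xo := by clear hy hV hV' hT'; omega
    have hT1 : T ≤ c := by rcases hT with rfl | rfl <;> assumption
    have hT2 : ¬ c + 1 ≤ T := by linarith
    rw [min_eq_left (by linarith : x0o ≤ U'), max_eq_right (by linarith : x0o ≤ U'),
      min_eq_left (by linarith : x0n ≤ xn), max_eq_right (by linarith : x0n ≤ xn),
      max_eq_left hxo.le, min_eq_right hxo.le]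
    simp only [hT1, hT2, true_and, false_and, or_false]
    intro E1 E2 E3 E4 hf hf' hP hM
    have := avoid_bend_half hT' q1 q3 q4 hxo hy hV hV' z1.1 z1.2 z2.1 z2.2 b5
      (fun h => E1 ⟨h.2.1, h.1, h.2.2.2, h.2.2.1⟩)
      (fun h => E2 ⟨h.2.1, h.1, h.2.2.2, h.2.2.1⟩) (fun h => E3 ⟨h.2.1, h.1, h.2.2.2, h.2.2.1⟩)
      (fun h => E4 ⟨h.2.1, h.1, h.2.2.2, h.2.2.1⟩) hf hf'
      (fun h => hP ⟨⟨h.1, h.2.1⟩, h.2.2⟩) hM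
    exact ⟨fun h => this.1 ⟨h.1.1, h.1.2, h.2⟩, this.2⟩
  · obtain rfl : U = xo := by clear hy hV hV' hT'; omega
    have hT2 : c + 1 ≤ T := by rcases hT with rfl | rfl <;> assumption
    have hT1 : ¬ T ≤ c := by linarith
    rw [min_eq_right (by linarith : U ≤ x0o), max_eq_left (by linarith : U ≤ x0o),
      min_eq_right (by linarith : xn ≤ x0n), max_eq_left (by linarith : xn ≤ x0n),
      max_eq_right hxo.le, min_eq_left hxo.le]
    simp only [hT1, hT2, true_and, false_and, false_or]
    intro E1 E2 E3 E4 hf hf' hP hM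
    obtain ⟨R1, R2⟩ := avoid_bend_half (xo := -U) (xn := -xn) (x0o := -x0o) (x0n := -x0n)
      (c := -c - 1) (l₁ := -h₁) (h₁ := -l₁) (z₁ := -z₁) hT' (by linarith) (by linarith)
      (by linarith) (by linarith) hy hV hV' (by linarith) (by linarith) z2.1 z2.2
      (b5.imp_left (by simp +contextual))
      (fun h => E1 ⟨by linarith, by linarith, h.2.2.2, h.2.2.1⟩)
      (fun h => E2 ⟨by linarith, by linarith, h.2.2.2, h.2.2.1⟩)
      (fun h => E3 ⟨by linarith, by linarith, h.2.2.2, h.2.2.1⟩)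
      (fun h => E4 ⟨by linarith, by linarith, h.2.2.2, h.2.2.1⟩)
      (fun h => hf ⟨by linarith, by linarith, h.2.2⟩)
      (fun h => hf' ⟨h.1, h.2.1, by linarith, by linarith⟩)
      (fun h => hP ⟨⟨by linarith, by linarith⟩, h.2.2⟩)
      (fun h => hM ⟨h.1, by linarith, by linarith⟩)
    exact ⟨fun h => R1 ⟨by linarith, by linarith, h.2⟩, fun h => R2 ⟨h.1, by linarith, by linarith⟩⟩

/-- A box meets the part of the subcorridor `i` behind its crossing line. -/
def HitP (v : Bool → Bool → ℕ → ℤ) (t : ℕ → Bool) (c : ℕ → ℤ) (i : ℕ) (l h : Bool → ℤ) : Prop :=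
  ((v (t i) true i ≤ c i ∧ c i + 1 ≤ h (t i) ∧ l (t i) < Rhi v (t i) i) ∨
    (c i + 1 ≤ v (t i) true i ∧ l (t i) ≤ c i ∧ Rlo v (t i) i < h (t i))) ∧
  Rlo v (!t i) i < h (!t i) ∧ l (!t i) < Rhi v (!t i) i

/-- A box meets the part of the subcorridor `i` in front of its crossing line. -/
def HitM (v : Bool → Bool → ℕ → ℤ) (t : ℕ → Bool) (c : ℕ → ℤ) (i : ℕ) (l h : Bool → ℤ) : Prop :=
  ((v (t i) true i ≤ c i ∧ l (t i) ≤ c i ∧ Rlo v (t i) i < h (t i)) ∨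
    (c i + 1 ≤ v (t i) true i ∧ c i + 1 ≤ h (t i) ∧ l (t i) < Rhi v (t i) i)) ∧
  Rlo v (!t i) i < h (!t i) ∧ l (!t i) < Rhi v (!t i) i

theorem HitP.mono {i : ℕ} {l h l' h' : Bool → ℤ} (H : HitP v t c i l h) (hl : ∀ x, l' x ≤ l x)
    (hh : ∀ x, h x ≤ h' x) : HitP v t c i l' h' := by
  have h1 := hl (t i)
  have h2 := hl (!t i)
  have h3 := hh (t i)
  have h4 := hh (!t i)
  unfold HitP at *
  omega

theorem HitM.mono {i : ℕ} {l h l' h' : Bool → ℤ} (H : HitM v t c i l h) (hl : ∀ x, l' x ≤ l x)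
    (hh : ∀ x, h x ≤ h' x) : HitM v t c i l' h' := by
  have h1 := hl (t i)
  have h2 := hl (!t i)
  have h3 := hh (t i)
  have h4 := hh (!t i)
  unfold HitM at *
  omega

theorem IsCorr.degenerate (H : IsCorr k v t c w) {j : ℕ} (hj : j ≤ k + 1) (s x : Bool) :
    elo v s j x = ehi v s j x ∨ elo v s j (!x) = ehi v s j (!x) := by
  have h := H.par j hj s
  rcases Bool.eq_or_eq_not x (t j) with rfl | hx
  · right
    simp [elo, ehi, h]
  · subst hx
    left
    simp [elo, ehi, h]

/-- The edges `i` and `i + 1` of both sides and the two crossing lines enclose the L-shaped bend,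
which consists of the part of `i` behind its line and the part of `i + 1` in front of its line. -/
theorem IsCorr.bend_step (H : IsCorr k v t c w) {i : ℕ} (h1 : 1 ≤ i) (hk : i < k) {l h z : Bool → ℤ}
    (hz : ∀ x, l x ≤ z x ∧ z x ≤ h x) (hdeg : l (t i) = h (t i) ∨ l (!t i) = h (!t i))
    (hE : ∀ s, ¬ Touch (elo v s i) (ehi v s i) l h)
    (hE' : ∀ s, ¬ Touch (elo v s (i + 1)) (ehi v s (i + 1)) l h)
    (hf : ¬ (l (t i) ≤ c i ∧ c i + 1 ≤ h (t i) ∧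
      l (!t i) ≤ max (v (!t i) true i) (v (!t i) false i) ∧
      min (v (!t i) true i) (v (!t i) false i) ≤ h (!t i)))
    (hf' : ¬ (l (!t i) ≤ c (i + 1) ∧ c (i + 1) + 1 ≤ h (!t i) ∧
      l (t i) ≤ max (v (t i) true (i + 1)) (v (t i) false (i + 1)) ∧
      min (v (t i) true (i + 1)) (v (t i) false (i + 1)) ≤ h (t i)))
    (hP : ¬ HitP v t c i z z) (hM : ¬ HitM v t c (i + 1) z z) :
    ¬ HitP v t c i l h ∧ ¬ HitM v t c (i + 1) l h := by
  obtain ⟨o, hy, hx⟩ := H.bend h1 hk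
  have z1 := hz (t i)
  have z2 := hz (!t i)
  have p1 := H.cross (i := i) (by omega) o
  have p2 := H.cross (i := i) (by omega) (!o)
  have p3 := H.cross_succ (i := i) (by omega) o
  have p4 := H.cross_succ (i := i) (by omega) (!o)
  have E1 := (not_touch_iff (t i)).mp (hE o)
  have E2 := (not_touch_iff (t i)).mp (hE (!o))
  have E3 := (not_touch_iff (t i)).mp (hE' o)
  have E4 := (not_touch_iff (t i)).mp (hE' (!o))
  have m1 : ∀ x j, min (v x true j) (v x false j) = min (v x o j) (v x (!o) j) := fun x j => by
    cases o <;> simp [min_comm]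
  have m2 : ∀ x j, max (v x true j) (v x false j) = max (v x o j) (v x (!o) j) := fun x j => by
    cases o <;> simp [max_comm]
  have r1 : ∀ x j, Rlo v x j = min (elo v o j x) (elo v (!o) j x) := fun x j => by
    cases o <;> simp [Rlo, min_comm]
  have r2 : ∀ x j, Rhi v x j = max (ehi v o j x) (ehi v (!o) j x) := fun x j => by
    cases o <;> simp [Rhi, max_comm]
  rw [m1, m2] at hf hf'
  simp only [elo, ehi, show i + 1 + 1 = i + 2 from rfl, p1, p2, p3, p4, min_self, max_self]
    at E1 E2 E3 E4
  have B1 : Rlo v (!t i) i = min (v (!t i) o i) (v (!t i) (!o) i) := by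
    simp only [r1, elo, p1, p2, min_self]
  have B2 : Rhi v (!t i) i = max (v (!t i) o i) (v (!t i) (!o) i) := by
    simp only [r2, ehi, p1, p2, max_self]
  have B3 : Rlo v (t i) (i + 1) = min (v (t i) o (i + 1)) (v (t i) (!o) (i + 1)) := by
    simp only [r1, elo, p3, p4, show i + 1 + 1 = i + 2 from rfl, min_self]
  have B4 : Rhi v (t i) (i + 1) = max (v (t i) o (i + 1)) (v (t i) (!o) (i + 1)) := by
    simp only [r2, ehi, p3, p4, show i + 1 + 1 = i + 2 from rfl, max_self]
  have B5 : Rlo v (t i) i = min (min (v (t i) o i) (v (t i) o (i + 1)))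
    (min (v (t i) (!o) i) (v (t i) (!o) (i + 1))) := by simp only [r1, elo]
  have B6 : Rhi v (t i) i = max (max (v (t i) o i) (v (t i) o (i + 1)))
    (max (v (t i) (!o) i) (v (t i) (!o) (i + 1))) := by simp only [r2, ehi]
  have B7 : Rlo v (!t i) (i + 1) = min (min (v (!t i) o (i + 1)) (v (!t i) o (i + 2)))
    (min (v (!t i) (!o) (i + 1)) (v (!t i) (!o) (i + 2))) := by simp only [r1, elo]
  have B8 : Rhi v (!t i) (i + 1) = max (max (v (!t i) o (i + 1)) (v (!t i) o (i + 2)))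
    (max (v (!t i) (!o) (i + 1)) (v (!t i) (!o) (i + 2))) := by simp only [r2, ehi]
  rw [p1, p2] at B7 B8
  simp only [HitP, HitM, H.alt, Bool.not_not, B1, B2, B3, B4] at hP hM ⊢
  clear hE hE' m1 m2 r1 r2 B1 B2 B3 B4 H hz p3 p4
  have T1 : v (t i) true i = v (t i) o i ∨ v (t i) true i = v (t i) (!o) i := by cases o <;> simp
  have T2 : v (!t i) true (i + 1) = v (!t i) o i ∨ v (!t i) true (i + 1) = v (!t i) (!o) i := by
    rw [← p1, ← p2]
    cases o <;> simp
  rw [forall_bool_not o, forall_bool_not o, p1, p2] at hy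
  rw [forall_bool_not o, forall_bool_not o] at hx
  exact avoid_bend_signed T1 T2 hx hy B5 B6 B7 B8 z1 z2 hdeg E1 E2 E3 E4 hf hf' hP hM

end Corr

/-! ### Edges stay out of bends. -/

namespace Corr

variable {k : ℕ} {v : Bool → Bool → ℕ → ℤ} {t : ℕ → Bool} {c : ℕ → ℤ} {w : ℤ}

theorem elo_le_ehi (s : Bool) (j : ℕ) (x : Bool) : elo v s j x ≤ ehi v s j x := min_le_max

theorem elo_le (s : Bool) (j : ℕ) (x : Bool) : elo v s j x ≤ v x s j ∧ elo v s j x ≤ v x s (j + 1) :=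
  ⟨min_le_left _ _, min_le_right _ _⟩

theorem le_ehi (s : Bool) (j : ℕ) (x : Bool) : v x s j ≤ ehi v s j x ∧ v x s (j + 1) ≤ ehi v s j x :=
  ⟨le_max_left _ _, le_max_right _ _⟩

/-- The extent of a subcorridor across its direction. -/
theorem IsCorr.Rlo_cross (H : IsCorr k v t c w) {i : ℕ} (hi : i ≤ k + 1) :
    Rlo v (!t i) i = min (v (!t i) true i) (v (!t i) false i) := by
  simp only [Rlo, elo, H.cross hi, min_self]

theorem IsCorr.Rhi_cross (H : IsCorr k v t c w) {i : ℕ} (hi : i ≤ k + 1) :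
    Rhi v (!t i) i = max (v (!t i) true i) (v (!t i) false i) := by
  simp only [Rhi, ehi, H.cross hi, max_self]

/-- The start of the induction along the boundary: the edge `i + 2` lies beyond the crossing line of
the subcorridor `i + 1`, while both arms of the bend lie before it. -/
theorem IsCorr.not_hit_above (H : IsCorr k v t c w) {i : ℕ} (h1 : 1 ≤ i) (hk : i < k) (s : Bool) :
    ¬ HitP v t c i (elo v s (i + 2)) (ehi v s (i + 2)) ∧
      ¬ HitM v t c (i + 1) (elo v s (i + 2)) (ehi v s (i + 2)) := by
  have hd := H.direction (i := i + 1) (by omega) hk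
  have e := H.cross (i := i + 2) (by omega) s
  have e1 := H.cross (i := i) (by omega) true
  have e2 := H.cross (i := i) (by omega) false
  rw [H.alt' i] at e
  unfold HitP HitM
  rw [H.Rlo_cross (by omega), H.Rhi_cross (by omega)]
  simp only [H.alt, Bool.not_not, Bool.forall_bool] at hd ⊢
  have f1 : elo v s (i + 2) (!t i) = v (!t i) s (i + 2) := by simp only [elo, e, min_self]
  have f2 : ehi v s (i + 2) (!t i) = v (!t i) s (i + 2) := by simp only [ehi, e, max_self]
  rw [f1, f2]
  simp only [show i + 1 + 1 = i + 2 from rfl] at hd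
  cases s <;> constructor <;> rintro ⟨h1, h2⟩ <;> omega

theorem IsCorr.not_hit_below (H : IsCorr k v t c w) {i : ℕ} (hk : i + 1 < k) (s : Bool) :
    ¬ HitP v t c (i + 1) (elo v s i) (ehi v s i) ∧
      ¬ HitM v t c (i + 2) (elo v s i) (ehi v s i) := by
  have hd := H.direction (i := i + 1) (by omega) hk.le
  have e := H.cross (i := i) (by omega) s
  have e1 := H.cross_succ (i := i + 1) (by omega) true
  have e2 := H.cross_succ (i := i + 1) (by omega) false
  have r1 := H.Rlo_cross (i := i + 2) (by omega)
  have r2 := H.Rhi_cross (i := i + 2) (by omega)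
  unfold HitP HitM
  rw [H.alt' i] at r1 r2 ⊢
  rw [H.alt i] at hd e1 e2 ⊢
  rw [r1, r2]
  have f1 : elo v s i (!t i) = v (!t i) s i := by simp only [elo, e, min_self]
  have f2 : ehi v s i (!t i) = v (!t i) s i := by simp only [ehi, e, max_self]
  rw [f1, f2]
  simp only [Bool.forall_bool, show i + 1 + 1 = i + 2 from rfl] at hd e1 e2
  cases s <;> constructor <;> rintro ⟨h1, h2⟩ <;> omega

theorem IsCorr.bend_step_edge (H : IsCorr k v t c w) {i j : ℕ} (h1 : 1 ≤ i) (hk : i < k) {s : Bool}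
    (hj : j ≤ k + 1) (hij : i + 3 ≤ j ∨ j + 2 ≤ i) {z : Bool → ℤ}
    (hz : ∀ x, elo v s j x ≤ z x ∧ z x ≤ ehi v s j x)
    (hP : ¬ HitP v t c i z z) (hM : ¬ HitM v t c (i + 1) z z) :
    ¬ HitP v t c i (elo v s j) (ehi v s j) ∧ ¬ HitM v t c (i + 1) (elo v s j) (ehi v s j) := by
  have hf' := H.free (i + 1) (by omega) hk j hj (by omega) s
  rw [H.alt, Bool.not_not] at hf'
  refine H.bend_step h1 hk hz (H.degenerate hj s _) (fun s' => ?_) (fun s' => ?_)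
    (H.free i h1 hk.le j hj (by omega) s) hf' hP hM
  · rcases hij with hij | hij
    · exact H.far s' s i j (by omega) hj
    · exact fun h => H.far s s' j i hij (by omega) (touch_symm h)
  · rcases hij with hij | hij
    · exact H.far s' s (i + 1) j (by omega) hj
    · exact fun h => H.far s s' j (i + 1) (by omega) (by omega) (touch_symm h)

/-- Edges behind a bend stay away from it. -/
theorem IsCorr.avoid_above (H : IsCorr k v t c w) {i : ℕ} (h1 : 1 ≤ i) (hk : i < k) (s : Bool) {j : ℕ}
    (hij : i + 2 ≤ j) (hj : j ≤ k + 1) :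
    ¬ HitP v t c i (elo v s j) (ehi v s j) ∧ ¬ HitM v t c (i + 1) (elo v s j) (ehi v s j) := by
  induction j, hij using Nat.le_induction with
  | base => exact H.not_hit_above h1 hk s
  | succ j hij ih =>
    obtain ⟨i1, i2⟩ := ih (by omega)
    have hz : ∀ x, elo v s j x ≤ v x s (j + 1) ∧ v x s (j + 1) ≤ ehi v s j x := fun x =>
      ⟨(elo_le s j x).2, (le_ehi s j x).2⟩
    exact H.bend_step_edge h1 hk hj (by omega) (z := fun x => v x s (j + 1))
      (fun x => ⟨(elo_le s _ x).1, (le_ehi s _ x).1⟩)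
      (fun h => i1 (h.mono (fun x => (hz x).1) fun x => (hz x).2))
      (fun h => i2 (h.mono (fun x => (hz x).1) fun x => (hz x).2))

/-- Edges in front of a bend stay away from it. -/
theorem IsCorr.avoid_below (H : IsCorr k v t c w) {i : ℕ} (hk : i < k) (s : Bool) {j d : ℕ}
    (hij : j + 1 + d = i) :
    ¬ HitP v t c i (elo v s j) (ehi v s j) ∧ ¬ HitM v t c (i + 1) (elo v s j) (ehi v s j) := by
  induction d generalizing j with
  | zero =>
    obtain rfl : i = j + 1 := by omega
    exact H.not_hit_below hk s
  | succ d ih =>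
    obtain ⟨i1, i2⟩ := ih (j := j + 1) (by omega)
    have hz : ∀ x, elo v s (j + 1) x ≤ v x s (j + 1) ∧ v x s (j + 1) ≤ ehi v s (j + 1) x := fun x =>
      ⟨(elo_le s _ x).1, (le_ehi s _ x).1⟩
    exact H.bend_step_edge (by omega) hk (by omega) (by omega) (z := fun x => v x s (j + 1))
      (fun x => ⟨(elo_le s j x).2, (le_ehi s j x).2⟩)
      (fun h => i1 (h.mono (fun x => (hz x).1) fun x => (hz x).2))
      (fun h => i2 (h.mono (fun x => (hz x).1) fun x => (hz x).2))

/-- The end of a corridor is simpler than a bend: a rectangle enclosed by two parallel edges, the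
end edge at `x` and the crossing line. An axis-parallel segment that avoids these four and has a
point outside stays outside. -/
theorem avoid_cap {x c x₁ x₂ y₁ y₂ l₁ h₁ l₂ h₂ z₁ z₂ : ℤ}
    (hx : c + 1 ≤ x ∧ x₁ ≤ c ∧ x₂ ≤ c ∨ x ≤ c ∧ c + 1 ≤ x₁ ∧ c + 1 ≤ x₂)
    (z1 : l₁ ≤ z₁ ∧ z₁ ≤ h₁) (z2 : l₂ ≤ z₂ ∧ z₂ ≤ h₂) (b5 : l₁ = h₁ ∨ l₂ = h₂)
    (E1 : ¬ (min x x₁ ≤ h₁ ∧ l₁ ≤ max x x₁ ∧ y₁ ≤ h₂ ∧ l₂ ≤ y₁))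
    (E2 : ¬ (min x x₂ ≤ h₁ ∧ l₁ ≤ max x x₂ ∧ y₂ ≤ h₂ ∧ l₂ ≤ y₂))
    (E3 : ¬ (x ≤ h₁ ∧ l₁ ≤ x ∧ min y₁ y₂ ≤ h₂ ∧ l₂ ≤ max y₁ y₂))
    (hf : ¬ (l₁ ≤ c ∧ c + 1 ≤ h₁ ∧ l₂ ≤ max y₁ y₂ ∧ min y₁ y₂ ≤ h₂))
    (hz : ¬ ((c + 1 ≤ x ∧ c + 1 ≤ z₁ ∧ z₁ < x ∨ x ≤ c ∧ z₁ ≤ c ∧ x < z₁) ∧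
      min y₁ y₂ < z₂ ∧ z₂ < max y₁ y₂)) :
    ¬ ((c + 1 ≤ x ∧ c + 1 ≤ h₁ ∧ l₁ < x ∨ x ≤ c ∧ l₁ ≤ c ∧ x < h₁) ∧
      min y₁ y₂ < h₂ ∧ l₂ < max y₁ y₂) := by
  rintro ⟨h1, h2, h3⟩
  have f : max y₁ y₂ = y₁ ∧ min y₁ y₂ = y₂ ∨ max y₁ y₂ = y₂ ∧ min y₁ y₂ = y₁ := by
    clear * -
    omega
  generalize max y₁ y₂ = Y at *
  generalize min y₁ y₂ = y at *
  rcases hx with ⟨q1, q2, q3⟩ | ⟨q1, q2, q3⟩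
  · rw [max_eq_left (by linarith), min_eq_right (by linarith)] at E1 E2
    simp only [q1, show ¬ x ≤ c by linarith, true_and, false_and, or_false] at hz h1
    rcases f with ⟨rfl, rfl⟩ | ⟨rfl, rfl⟩ <;> rcases b5 with rfl | rfl <;> omega
  · rw [max_eq_right (by linarith), min_eq_left (by linarith)] at E1 E2
    simp only [q1, show ¬ c + 1 ≤ x by linarith, true_and, false_and, false_or] at hz h1
    rcases f with ⟨rfl, rfl⟩ | ⟨rfl, rfl⟩ <;> rcases b5 with rfl | rfl <;> omega

end Corr

/-! ### Edges stay out of the two ends of the corridor. -/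

namespace Corr

variable {k : ℕ} {v : Bool → Bool → ℕ → ℤ} {t : ℕ → Bool} {c : ℕ → ℤ} {w : ℤ}

theorem IsCorr.cap_end_eq (H : IsCorr k v t c w) :
    v (t k) true (k + 1) = v (t k) false (k + 1) := by
  have e1 := H.cross_succ (le_refl k) true
  have e3 := H.cap_end (t k) true
  simp only [Bool.not_true] at e3
  omega

theorem IsCorr.cap_start_eq (H : IsCorr k v t c w) : v (t 1) true 1 = v (t 1) false 1 := by
  have e1 := H.cross (i := 0) (by omega) true
  have e3 := H.cap_start (t 1) true
  rw [← H.alt 0] at e1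
  simp only [Bool.not_true, zero_add] at e1 e3
  omega

/-- A box meets the part of the subcorridor `i` between its crossing line and its end at `X`. -/
def HitEnd (v : Bool → Bool → ℕ → ℤ) (t : ℕ → Bool) (c : ℕ → ℤ) (i : ℕ) (X : ℤ) (l h : Bool → ℤ) :
    Prop :=
  (c i + 1 ≤ X ∧ c i + 1 ≤ h (t i) ∧ l (t i) < X ∨ X ≤ c i ∧ l (t i) ≤ c i ∧ X < h (t i)) ∧
  Rlo v (!t i) i < h (!t i) ∧ l (!t i) < Rhi v (!t i) i

theorem HitEnd.mono {i : ℕ} {X : ℤ} {l h l' h' : Bool → ℤ} (H : HitEnd v t c i X l h)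
    (hl : ∀ x, l' x ≤ l x) (hh : ∀ x, h x ≤ h' x) : HitEnd v t c i X l' h' := by
  have h1 := hl (t i)
  have h2 := hl (!t i)
  have h3 := hh (t i)
  have h4 := hh (!t i)
  unfold HitEnd at *
  omega

theorem IsCorr.cap_step (H : IsCorr k v t c w) {i m : ℕ} (h1 : 1 ≤ i) (hk : i ≤ k)
    (hm : m = i ∨ m = i + 1) (hX : v (t i) true m = v (t i) false m) {l h z : Bool → ℤ}
    (hz : ∀ x, l x ≤ z x ∧ z x ≤ h x) (hdeg : l (t i) = h (t i) ∨ l (!t i) = h (!t i))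
    (hE : ∀ s, ¬ Touch (elo v s i) (ehi v s i) l h)
    (hC : ¬ (v (t i) true m ≤ h (t i) ∧ l (t i) ≤ v (t i) true m ∧
      Rlo v (!t i) i ≤ h (!t i) ∧ l (!t i) ≤ Rhi v (!t i) i))
    (hf : ¬ (l (t i) ≤ c i ∧ c i + 1 ≤ h (t i) ∧
      l (!t i) ≤ max (v (!t i) true i) (v (!t i) false i) ∧
      min (v (!t i) true i) (v (!t i) false i) ≤ h (!t i)))
    (hzn : ¬ HitEnd v t c i (v (t i) true m) z z) : ¬ HitEnd v t c i (v (t i) true m) l h := by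
  unfold HitEnd at *
  have E1 := (not_touch_iff (t i)).mp (hE true)
  have E2 := (not_touch_iff (t i)).mp (hE false)
  have hd := H.direction h1 hk
  rw [H.Rlo_cross (by omega), H.Rhi_cross (by omega)] at *
  have e1 := H.cross (i := i) (by omega) true
  have e2 := H.cross (i := i) (by omega) false
  simp only [elo, ehi, e1, e2, min_self, max_self, Bool.forall_bool] at E1 E2 hd
  rcases hm with rfl | rfl
  · exact avoid_cap (by clear * - hd hX; omega) (hz (t m)) (hz (!t m)) hdeg E1 (hX ▸ E2) hC hf hzn
  · refine avoid_cap (x₁ := v (t i) true i) (x₂ := v (t i) false i) (by clear * - hd hX; omega) (hz (t i)) (hz (!t i)) hdeg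
      (by rwa [min_comm, max_comm]) ?_ hC hf hzn
    rwa [hX, min_comm, max_comm]

/-- Induction backwards along the boundary, starting with the edge `k - 1`, which lies before the
last crossing line. Consecutive edges share a vertex, which provides the outside point. -/
theorem IsCorr.avoid_cap_end (H : IsCorr k v t c w) (s : Bool) {j d : ℕ} (hij : j + 1 + d = k) :
    ¬ HitEnd v t c k (v (t k) true (k + 1)) (elo v s j) (ehi v s j) := by
  induction d generalizing j with
  | zero =>
    have hd := H.direction H.one_le le_rfl
    have e := H.cap_end_eq
    obtain rfl : k = j + 1 := by omega
    have f := H.cross (i := j) (by omega) s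
    simp only [H.alt j, Bool.forall_bool] at hd e
    have f1 : elo v s j (!t j) = v (!t j) s j := by simp only [elo, f, min_self]
    have f2 : ehi v s j (!t j) = v (!t j) s j := by simp only [ehi, f, max_self]
    unfold HitEnd
    rw [H.alt j, f1, f2]
    rintro ⟨h1, -⟩
    cases s <;> omega
  | succ d ih =>
    have i1 := ih (j := j + 1) (by omega)
    refine H.cap_step H.one_le le_rfl (Or.inr rfl) H.cap_end_eq (z := fun x => v x s (j + 1))
      (fun x => ⟨(elo_le s j x).2, (le_ehi s j x).2⟩) (H.degenerate (by omega) s _)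
      (fun s' h => H.far s s' j k (by omega) (by omega) (touch_symm h)) ?_
      (H.free k H.one_le le_rfl j (by omega) (by omega) s) fun h => i1 ?_
    · have E3 := (not_touch_iff (t k)).mp fun h =>
        H.far s true j (k + 1) (by omega) (by omega) (touch_symm h)
      have e4 := H.cross_succ (le_refl k) true
      have e5 := H.cap_end (!t k) true
      have e6 := H.cross (i := k) (by omega) true
      have e7 := H.cross (i := k) (by omega) false
      rw [H.Rlo_cross (by omega), H.Rhi_cross (by omega)]
      simp only [Bool.not_true] at e5
      have f1 : elo v true (k + 1) (t k) = v (t k) true (k + 1) := by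
        simp only [elo, show k + 1 + 1 = k + 2 from rfl, e4, min_self]
      have f2 : ehi v true (k + 1) (t k) = v (t k) true (k + 1) := by
        simp only [ehi, show k + 1 + 1 = k + 2 from rfl, e4, max_self]
      have f3 : elo v true (k + 1) (!t k) = min (v (!t k) true k) (v (!t k) false k) := by
        simp only [elo, show k + 1 + 1 = k + 2 from rfl, e5, e6, e7]
      have f4 : ehi v true (k + 1) (!t k) = max (v (!t k) true k) (v (!t k) false k) := by
        simp only [ehi, show k + 1 + 1 = k + 2 from rfl, e5, e6, e7]
      rwa [f1, f2, f3, f4] at E3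
    · exact h.mono (fun x => (elo_le s _ x).1) fun x => (le_ehi s _ x).1

theorem IsCorr.avoid_cap_start (H : IsCorr k v t c w) (s : Bool) {j : ℕ} (h2 : 2 ≤ j)
    (hj : j ≤ k + 1) : ¬ HitEnd v t c 1 (v (t 1) true 1) (elo v s j) (ehi v s j) := by
  induction j, h2 using Nat.le_induction with
  | base =>
    have hd := H.direction le_rfl H.one_le
    have e := H.cap_start_eq
    have f := H.cross (i := 2) (by omega) s
    simp only [H.alt 1, Bool.forall_bool, Bool.not_not, show 1 + 1 = 2 from rfl,
      show 2 + 1 = 3 from rfl] at hd f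
    have f1 : elo v s 2 (t 1) = v (t 1) s 2 := by simp only [elo, show 2 + 1 = 3 from rfl, f, min_self]
    have f2 : ehi v s 2 (t 1) = v (t 1) s 2 := by simp only [ehi, show 2 + 1 = 3 from rfl, f, max_self]
    unfold HitEnd
    rw [f1, f2]
    rintro ⟨h1, -⟩
    cases s <;> omega
  | succ j h2 ih =>
    have i1 := ih (by omega)
    refine H.cap_step le_rfl H.one_le (Or.inl rfl) H.cap_start_eq (z := fun x => v x s (j + 1))
      (fun x => ⟨(elo_le s _ x).1, (le_ehi s _ x).1⟩) (H.degenerate (by omega) s _)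
      (fun s' h => H.far s' s 1 _ (by omega) (by omega) h) ?_
      (H.free 1 le_rfl H.one_le _ (by omega) (by omega) s) fun h => i1 ?_
    · have E3 := (not_touch_iff (t 1)).mp (H.far true s 0 (j + 1) (by omega) (by omega))
      have e4 := H.cross (i := 0) (by omega) true
      rw [← H.alt] at e4
      have e5 := H.cap_start (!t 1) true
      rw [H.Rlo_cross (by omega), H.Rhi_cross (by omega)]
      simp only [Bool.not_true, zero_add] at e5 e4
      have f1 : elo v true 0 (t 1) = v (t 1) true 1 := by
        simp only [elo, zero_add, e4, min_self]
      have f2 : ehi v true 0 (t 1) = v (t 1) true 1 := by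
        simp only [ehi, zero_add, e4, max_self]
      have f3 : elo v true 0 (!t 1) = min (v (!t 1) true 1) (v (!t 1) false 1) := by
        simp only [elo, zero_add, e5, min_comm]
      have f4 : ehi v true 0 (!t 1) = max (v (!t 1) true 1) (v (!t 1) false 1) := by
        simp only [ehi, zero_add, e5, max_comm]
      rwa [f1, f2, f3, f4] at E3
    · exact h.mono (fun x => (elo_le s j x).2) fun x => (le_ehi s j x).2

/-- The part behind the crossing line belongs to the bend `i`, or to the end of the corridor if `i =
k`. -/
theorem IsCorr.avoid_end (H : IsCorr k v t c w) (s : Bool) {i j : ℕ} (h1 : 1 ≤ i) (hk : i ≤ k)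
    (hj : j ≤ k + 1) (hij : i + 2 ≤ j ∨ j + 2 ≤ i) : ¬ HitP v t c i (elo v s j) (ehi v s j) := by
  rcases hk.lt_or_eq with hk | rfl
  · rcases hij with hij | hij
    · exact (H.avoid_above h1 hk s hij hj).1
    · exact (H.avoid_below hk s (d := i - 1 - j) (by omega)).1
  · refine fun h => H.avoid_cap_end s (d := i - 1 - j) (j := j) (by omega) ⟨?_, h.2⟩
    have hd := H.direction h1 le_rfl
    have e := H.cap_end_eq
    have := h.1
    generalize elo v s j (t i) = l at *
    generalize ehi v s j (t i) = h at *
    simp only [Rlo, Rhi, elo, ehi, Bool.forall_bool] at this hd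
    omega

theorem IsCorr.avoid_start (H : IsCorr k v t c w) (s : Bool) {i j : ℕ} (h1 : 1 ≤ i) (hk : i ≤ k)
    (hj : j ≤ k + 1) (hij : i + 2 ≤ j ∨ j + 2 ≤ i) : ¬ HitM v t c i (elo v s j) (ehi v s j) := by
  obtain ⟨i, rfl⟩ := Nat.exists_eq_add_of_le' h1
  rcases Nat.eq_zero_or_pos i with rfl | hi
  · refine fun h => H.avoid_cap_start s (j := j) (by omega) hj ⟨?_, h.2⟩
    have hd := H.direction h1 hk
    have e := H.cap_start_eq
    have := h.1
    simp only [zero_add] at *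
    generalize elo v s j (t 1) = l at *
    generalize ehi v s j (t 1) = h at *
    simp only [Rlo, Rhi, elo, ehi, Bool.forall_bool] at this hd ⊢
    omega
  · rcases hij with hij | hij
    · exact (H.avoid_above hi (by omega) s (by omega) hj).2
    · exact (H.avoid_below (i := i) (by omega) s (d := i - 1 - j) (by omega)).2

/-- Edges do not enter the rectangles of other subcorridors. -/
theorem IsCorr.avoid (H : IsCorr k v t c w) (s : Bool) {i j : ℕ} (h1 : 1 ≤ i) (hk : i ≤ k)
    (hj : j ≤ k + 1) (hij : i + 2 ≤ j ∨ j + 2 ≤ i) :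
    ∃ x, Rhi v x i ≤ elo v s j x ∨ ehi v s j x ≤ Rlo v x i := by
  by_contra! hcon
  have := hcon (t i)
  have := hcon (!t i)
  -- An edge that enters the rectangle meets its part behind or its part in front of the crossing
  -- line.
  have hP := H.avoid_end s h1 hk hj hij
  have hM := H.avoid_start s h1 hk hj hij
  have hl := elo_le_ehi (v := v) s j (t i)
  have hd := H.direction h1 hk
  unfold HitP at hP
  unfold HitM at hM
  simp only [Bool.forall_bool] at hd
  omega

end Corr

/-! ### Walls at the ends of the rectangles, and separation of rectangles. -/

namespace Corr

variable {k : ℕ} {v : Bool → Bool → ℕ → ℤ} {t : ℕ → Bool} {c : ℕ → ℤ} {w : ℤ}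

theorem Rlo_eq (o x : Bool) (j : ℕ) : Rlo v x j = min (elo v o j x) (elo v (!o) j x) := by
  cases o <;> simp [Rlo, min_comm]

theorem Rhi_eq (o x : Bool) (j : ℕ) : Rhi v x j = max (ehi v o j x) (ehi v (!o) j x) := by
  cases o <;> simp [Rhi, max_comm]

theorem exists_bool_not {p : Bool → Prop} (b : Bool) : (∃ x, p x) ↔ p b ∨ p (!b) := by
  cases b <;> simp [or_comm]

/-- The edge `l` of the side `s` bounds the subcorridor `i` at the coordinate `X` along its axis. -/
def Wall (v : Bool → Bool → ℕ → ℤ) (t : ℕ → Bool) (i : ℕ) (X : ℤ) (s : Bool) (l : ℕ) : Prop :=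
  (elo v s l (t i) = X ∧ ehi v s l (t i) = X) ∧
    elo v s l (!t i) ≤ Rlo v (!t i) i ∧ Rhi v (!t i) i ≤ ehi v s l (!t i)

/-- At a bend the next edge of the outer side closes the rectangle over its full width; after the
last subcorridor the end edge does. -/
theorem IsCorr.wall_end (H : IsCorr k v t c w) {i : ℕ} (h1 : 1 ≤ i) (hk : i ≤ k) :
    ∃ s X, Wall v t i X s (i + 1) ∧ (v (t i) true i ≤ c i ∧ X = Rhi v (t i) i ∨
      c i + 1 ≤ v (t i) true i ∧ X = Rlo v (t i) i) := by
  rcases hk.lt_or_eq with hk | rfl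
  · obtain ⟨o, hy, hx⟩ := H.bend h1 hk
    refine ⟨o, v (t i) o (i + 1), ?_⟩
    have e1 := H.cross (i := i) (by omega) o
    have e2 := H.cross (i := i) (by omega) (!o)
    have e3 := H.cross_succ (i := i) (by omega) o
    unfold Wall
    rw [Rlo_eq o, Rhi_eq o, Rlo_eq o (t i), Rhi_eq o (t i)]
    simp only [elo, ehi, show i + 1 + 1 = i + 2 from rfl, e1, e2, e3, min_self, max_self, true_and]
    have hxt := fun h : (∀ s, v (t i) s i ≤ c i ∧ c i + 1 ≤ v (t i) s (i + 1)) => h true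
    have hxt' := fun h : (∀ s, v (t i) s (i + 1) ≤ c i ∧ c i + 1 ≤ v (t i) s i) => h true
    rcases hx with ⟨hx, hxo⟩ | ⟨hx, hxo⟩ <;> rcases hy with ⟨hy, hyo⟩ | ⟨hy, hyo⟩ <;>
      have xt := hx true <;> rw [forall_bool_not o] at hx hy <;> omega
  · refine ⟨true, v (t i) true (i + 1), ?_⟩
    have hd := H.direction h1 le_rfl
    have e1 := H.cross (i := i) (by omega) true
    have e2 := H.cross (i := i) (by omega) false
    have e3 := H.cross_succ (i := i) (by omega) true
    have e4 := H.cap_end_eq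
    have e5 := H.cap_end (!t i) true
    unfold Wall Rlo Rhi
    simp only [elo, ehi, show i + 1 + 1 = i + 2 from rfl, e1, e2, e3, e5, Bool.not_true, min_self,
      max_self, Bool.forall_bool] at hd ⊢
    exact ⟨⟨⟨trivial, trivial⟩, by omega, by omega⟩, by omega⟩

theorem IsCorr.wall_start (H : IsCorr k v t c w) {i : ℕ} (h1 : 1 ≤ i) (hk : i ≤ k) :
    ∃ s X, Wall v t i X s (i - 1) ∧ (v (t i) true i ≤ c i ∧ X = Rlo v (t i) i ∨
      c i + 1 ≤ v (t i) true i ∧ X = Rhi v (t i) i) := by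
  obtain ⟨i, rfl⟩ := Nat.exists_eq_add_of_le' h1
  rcases Nat.eq_zero_or_pos i with rfl | hi
  · refine ⟨true, v (t 1) true 1, ?_⟩
    have hd := H.direction h1 hk
    have e1 := H.cross (i := 1) (by omega) true
    have e2 := H.cross (i := 1) (by omega) false
    have e3 := H.cross (i := 0) (by omega) true
    have e4 := H.cap_start_eq
    have e5 := H.cap_start (!t 1) true
    rw [← H.alt 0] at e3
    simp only [zero_add] at e3
    unfold Wall Rlo Rhi
    simp only [elo, ehi, zero_add, Nat.sub_self, show 1 + 1 = 2 from rfl, e1, e2, e3, e5,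
      Bool.not_true, min_self, max_self, Bool.forall_bool] at hd ⊢
    exact ⟨⟨⟨trivial, trivial⟩, by omega, by omega⟩, by omega⟩
  · obtain ⟨o, hy, hx⟩ := H.bend hi (by omega : i < k)
    refine ⟨o, v (!t i) o (i + 1), ?_⟩
    have e1 := H.cross (i := i) (by omega) o
    have e2 := H.cross (i := i) (by omega) (!o)
    have e3 := H.cross_succ (i := i) (by omega) o
    have e4 := H.cross_succ (i := i) (by omega) (!o)
    unfold Wall
    rw [H.alt, Rlo_eq o, Rhi_eq o, Rlo_eq o (!t i), Rhi_eq o (!t i)]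
    simp only [elo, ehi, show i + 1 + 1 = i + 2 from rfl, e1, e2, e3, e4, min_self, max_self, 
      true_and, Bool.not_not, Nat.add_sub_cancel]
    rcases hx with ⟨hx, hxo⟩ | ⟨hx, hxo⟩ <;> rcases hy with ⟨hy, hyo⟩ | ⟨hy, hyo⟩ <;>
      have xt := hy true <;> rw [forall_bool_not o] at hx hy <;> omega

/-- Each subcorridor is bounded at both ends by edges of the neighbouring levels. -/
theorem IsCorr.wall (H : IsCorr k v t c w) {i : ℕ} (h1 : 1 ≤ i) (hk : i ≤ k) :
    (∃ s l, (l = i + 1 ∨ l + 1 = i) ∧ Wall v t i (Rlo v (t i) i) s l) ∧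
      ∃ s l, (l = i + 1 ∨ l + 1 = i) ∧ Wall v t i (Rhi v (t i) i) s l := by
  obtain ⟨s, X, hW, hX⟩ := H.wall_end h1 hk
  obtain ⟨s', X', hW', hX'⟩ := H.wall_start h1 hk
  rcases hX with ⟨hc, rfl⟩ | ⟨hc, rfl⟩ <;> rcases hX' with ⟨hc', rfl⟩ | ⟨hc', rfl⟩
  · exact ⟨⟨s', _, Or.inr (by omega), hW'⟩, ⟨s, _, Or.inl rfl, hW⟩⟩
  · omega
  · omega
  · exact ⟨⟨s, _, Or.inl rfl, hW⟩, ⟨s', _, Or.inr (by omega), hW'⟩⟩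

theorem IsCorr.far_symm (H : IsCorr k v t c w) {s s' : Bool} {i j : ℕ} (hi : i ≤ k + 1)
    (hj : j ≤ k + 1) (hij : i + 2 ≤ j ∨ j + 2 ≤ i) :
    ¬ Touch (elo v s i) (ehi v s i) (elo v s' j) (ehi v s' j) := by
  rcases hij with h | h
  · exact H.far s s' i j h hj
  · exact fun h' => H.far s' s j i h hi (touch_symm h')

theorem IsCorr.Rlo_lt_Rhi (H : IsCorr k v t c w) {i : ℕ} (h1 : 1 ≤ i) (hk : i ≤ k) (x : Bool) :
    Rlo v x i < Rhi v x i := by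
  rcases Bool.eq_or_eq_not x (t i) with rfl | rfl
  · have := H.chord i h1 hk true
    simp only [Rlo, Rhi, elo, ehi]
    omega
  · have := H.cross_ne h1 hk
    rw [H.Rlo_cross (by omega), H.Rhi_cross (by omega)]
    omega

/-- Subcorridors that are not adjacent do not overlap. -/
theorem IsCorr.separated (H : IsCorr k v t c w) {i j : ℕ} (h1 : 1 ≤ i) (hij : i + 2 ≤ j)
    (hk : j ≤ k) : ∃ x, Rhi v x i ≤ Rlo v x j ∨ Rhi v x j ≤ Rlo v x i := by
  by_contra! hcon
  have q1 := hcon (t i)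
  have q2 := hcon (!t i)
  -- In this case the two rectangles lie on different sides of the crossing line of the subcorridor
  -- between them.
  by_cases h2 : j = i + 2
  · subst h2
    have hd := H.direction (i := i + 1) (by omega) (by omega)
    have e1 := H.Rlo_cross (i := i) (by omega)
    have e2 := H.Rhi_cross (i := i) (by omega)
    have e3 := H.Rlo_cross (i := i + 2) (by omega)
    have e4 := H.Rhi_cross (i := i + 2) (by omega)
    have e5 := H.cross (i := i) (by omega) true
    have e6 := H.cross (i := i) (by omega) false
    simp only [H.alt, Bool.not_not, Bool.forall_bool, show i + 1 + 1 = i + 2 from rfl] at *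
    omega
  obtain ⟨⟨s₁, l₁, hl₁, a1, b1⟩, s₂, l₂, hl₂, a2, b2⟩ := H.wall h1 (by omega : i ≤ k)
  obtain ⟨⟨s₃, l₃, hl₃, a3, b3⟩, s₄, l₄, hl₄, a4, b4⟩ := H.wall (by omega : 1 ≤ j) hk
  have n1 := H.avoid s₁ (i := j) (j := l₁) (by omega) hk (by omega) (by omega)
  have n2 := H.avoid s₂ (i := j) (j := l₂) (by omega) hk (by omega) (by omega)
  have n3 := H.avoid s₃ (i := i) (j := l₃) h1 (by omega) (by omega) (by omega)
  have n4 := H.avoid s₄ (i := i) (j := l₄) h1 (by omega) (by omega) (by omega)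
  rw [exists_bool_not (t i)] at n1 n2 n3 n4
  have p3 : t (i + 3) = !t i := by rw [H.alt, H.alt']
  rcases Bool.eq_or_eq_not (t j) (t i) with ht | ht
  · have h4 : i + 4 ≤ j := by
      by_contra! h
      obtain rfl : j = i + 3 := by omega
      simp [p3] at ht
    rw [ht] at a3 b3 a4 b4
    -- Parallel rectangles: no wall of one enters the other, so both begin at the same coordinate,
    -- and their walls there would touch.
    refine H.far_symm (s := s₁) (s' := s₃) (i := l₁) (j := l₃) (by omega) (by omega) (by omega)
      ((forall_bool_not (t i)).mpr ⟨?_, ?_⟩) <;> omega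
  · rw [ht, Bool.not_not] at b3 b4
    rw [ht] at a3 a4
    have hj := H.chord j (by omega) hk
    rw [ht] at hj
    -- Perpendicular rectangles: the walls of `i` do not enter the rectangle of `j`, so the edges of
    -- `j` lie between these walls. As they neither touch the walls nor enter the rectangle of `i`,
    -- each stays beyond one long side of it. Both contain the crossing cell of `j`, hence both are
    -- beyond the same side, and so is the rectangle of `j`.
    have key : ∀ s, ehi v s j (!t i) ≤ Rlo v (!t i) i ∨ Rhi v (!t i) i ≤ elo v s j (!t i) := by
      intro s
      have f1 := (not_touch_iff (t i)).mp
        (H.far_symm (s := s) (s' := s₁) (i := j) (j := l₁) (by omega) (by omega) (by omega))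
      have f2 := (not_touch_iff (t i)).mp
        (H.far_symm (s := s) (s' := s₂) (i := j) (j := l₂) (by omega) (by omega) (by omega))
      have n5 := H.avoid s h1 (by omega : i ≤ k) (by omega : j ≤ k + 1) (by omega)
      rw [exists_bool_not (t i)] at n5
      have r1 := H.Rlo_cross (by omega : j ≤ k + 1)
      have r2 := H.Rhi_cross (by omega : j ≤ k + 1)
      have e := H.cross (by omega : j ≤ k + 1) s
      rw [ht, Bool.not_not] at r1 r2 e
      have g1 : elo v s j (t i) = v (t i) s j := by simp only [elo, e, min_self]
      have g2 : ehi v s j (t i) = v (t i) s j := by simp only [ehi, e, max_self]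
      have g3 : Rlo v (t i) j ≤ v (t i) s j ∧ v (t i) s j ≤ Rhi v (t i) j := by
        cases s <;> omega
      have g4 := elo_le_ehi (v := v) s j (!t i)
      have g5 := H.Rlo_lt_Rhi h1 (by omega : i ≤ k) (!t i)
      clear r1 r2 hj n3 n4 e
      omega
    have k1 := key true
    have k2 := key false
    have g5 := H.Rlo_lt_Rhi h1 (by omega : i ≤ k) (!t i)
    have j1 := hj true
    have j2 := hj false
    have j3 := elo_le (v := v) true j (!t i)
    have j4 := elo_le (v := v) false j (!t i)
    have j5 := le_ehi (v := v) true j (!t i)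
    have j6 := le_ehi (v := v) false j (!t i)
    have j7 : Rlo v (!t i) j = min (elo v true j (!t i)) (elo v false j (!t i)) := rfl
    have j8 : Rhi v (!t i) j = max (ehi v true j (!t i)) (ehi v false j (!t i)) := rfl
    clear n1 n2 n3 n4 a1 a2 a3 a4 b1 b2 b3 b4 q1 hij h2
    omega

end Corr

/-! ## Crossing parity -/

namespace Corr

variable {k : ℕ} {v : Bool → Bool → ℕ → ℤ} {t : ℕ → Bool} {c : ℕ → ℤ} {w : ℤ}

/-- Does the vertex `i` of the side `s` precede the cell `z` along the axis `x`? -/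
def before (v : Bool → Bool → ℕ → ℤ) (z : Bool → ℤ) (x s : Bool) (i : ℕ) : ZMod 2 :=
  if v x s i ≤ z x then 1 else 0

/-- Does the ray along the axis `x` from the cell `z` cross the edge `i` of the side `s`? -/
def crosses (v : Bool → Bool → ℕ → ℤ) (z : Bool → ℤ) (x s : Bool) (i : ℕ) : ZMod 2 :=
  (1 + before v z x s i) * (before v z (!x) s i + before v z (!x) s (i + 1))

/-- The edges; the first and the last one belong to both sides. -/
def edges (k : ℕ) : Finset (Bool × ℕ) :=
  (Finset.univ ×ˢ Finset.range (k + 2)).filter fun e => e.1 = true ∨ 1 ≤ e.2 ∧ e.2 ≤ k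

/-- The parity of the number of edges that the ray along the axis `x` from the cell `z` crosses. -/
def chi (v : Bool → Bool → ℕ → ℤ) (k : ℕ) (x : Bool) (z : Bool → ℤ) : ZMod 2 :=
  ∑ e ∈ edges k, crosses v z x e.1 e.2

theorem sum_edges (f : Bool → ℕ → ZMod 2) : ∑ e ∈ edges k, f e.1 e.2 =
    ∑ i ∈ Finset.range k, (f true (i + 1) + f false (i + 1)) + f true 0 + f true (k + 1) := by
  have h : ∀ i ∈ Finset.range k, (if 1 ≤ i + 1 ∧ i + 1 ≤ k then f false (i + 1) else 0) =
      f false (i + 1) := fun i hi => if_pos (by simp at hi; omega)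
  rw [edges, Finset.sum_filter, Finset.sum_product]
  simp only [Fintype.sum_bool, true_or, if_true, Bool.false_eq_true, false_or]
  rw [Finset.sum_range_succ, Finset.sum_range_succ', Finset.sum_range_succ _ (k + 1),
    Finset.sum_range_succ' _ k, Finset.sum_congr rfl h, Finset.sum_add_distrib]
  simp
  ring

theorem sum_range_telescope (f : ℕ → ZMod 2) (k : ℕ) :
    ∑ i ∈ Finset.range k, (f (i + 1) + f (i + 2)) = f 1 + f (k + 1) := by
  induction k with
  | zero => simp [CharTwo.add_self_eq_zero]
  | succ k ih =>
    rw [Finset.sum_range_succ, ih]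
    linear_combination CharTwo.add_self_eq_zero (f (k + 1))

theorem before_congr {z : Bool → ℤ} {x s s' : Bool} {i j : ℕ} (h : v x s i = v x s' j) :
    before v z x s i = before v z x s' j := by
  rw [before, before, h]

theorem IsCorr.before_eq (H : IsCorr k v t c w) {i : ℕ} (hi : i ≤ k + 1) (s : Bool) (z : Bool → ℤ)
    (x : Bool) : before v z x s i = before v z x s (i + 1) ∨
      before v z (!x) s i = before v z (!x) s (i + 1) := by
  have h := H.par i hi s
  rcases Bool.eq_or_eq_not x (t i) with rfl | hx
  · exact Or.inr (before_congr h)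
  · exact Or.inl (before_congr (hx ▸ h))

/-- The parity does not depend on the direction of the ray. -/
theorem IsCorr.chi_comm (H : IsCorr k v t c w) (x : Bool) (z : Bool → ℤ) :
    chi v k x z = chi v k (!x) z := by
  -- This is the disjunction of the two indicators of a vertex. Along an axis-parallel edge the
  -- crossing counts for the two rays differ by the change of `g`, and these changes cancel around
  -- the closed curve.
  let g : Bool → ℕ → ZMod 2 := fun s i => before v z x s i + before v z (!x) s i +
    before v z x s i * before v z (!x) s i
  have key : ∀ a b a' b' : ZMod 2, a = a' ∨ b = b' → (1 + a) * (b + b') =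
      (1 + b) * (a + a') + ((a + b + a * b) + (a' + b' + a' * b')) := by decide
  have h : ∀ e ∈ edges k, crosses v z x e.1 e.2 =
      crosses v z (!x) e.1 e.2 + (g e.1 e.2 + g e.1 (e.2 + 1)) := by
    rintro ⟨s, i⟩ he
    simp only [edges, Finset.mem_filter, Finset.mem_product, Finset.mem_range] at he
    simp only [crosses, Bool.not_not, g]
    exact key _ _ _ _ (H.before_eq (by omega) s z x)
  have e1 : g true 0 = g false 1 := by
    simp only [g, before_congr (H.cap_start x true), before_congr (H.cap_start (!x) true),
      Bool.not_true]
  have e2 : g true (k + 2) = g false (k + 1) := by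
    simp only [g, before_congr (H.cap_end x true), before_congr (H.cap_end (!x) true),
      Bool.not_true]
  rw [chi, chi, Finset.sum_congr rfl h, Finset.sum_add_distrib, 
    sum_edges (fun s i => g s i + g s (i + 1)), Finset.sum_add_distrib, sum_range_telescope, sum_range_telescope]
  simp only [zero_add, show k + 1 + 1 = k + 2 from rfl, e1, e2]
  linear_combination CharTwo.add_self_eq_zero (g true 1) + CharTwo.add_self_eq_zero (g false 1) +
    CharTwo.add_self_eq_zero (g true (k + 1)) + CharTwo.add_self_eq_zero (g false (k + 1))

/-- Cells with odd parity lie in some subcorridor. -/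
theorem IsCorr.exists_mem (H : IsCorr k v t c w) {x : Bool} {z : Bool → ℤ} (hz : chi v k x z ≠ 0) :
    ∃ i, 1 ≤ i ∧ i ≤ k ∧ ∀ y, Rlo v y i ≤ z y ∧ z y < Rhi v y i := by
  -- The crossing count of an imagined cut between the two vertices numbered `i`. The cuts divide
  -- the polygon into `k` quadrilaterals; each inner cut is counted twice and cancels, and the first
  -- and the last one account for the end edges.
  let d : ℕ → ZMod 2 := fun i =>
    (1 + before v z x true i) * (before v z (!x) true i + before v z (!x) false i)
  have e1 : crosses v z x true 0 = d 1 := by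
    have key : ∀ a b a' b' : ZMod 2, a = a' ∨ b = b' → (1 + a) * (b + b') =
      (1 + a') * (b' + b) := by decide
    simp only [crosses, d]
    rw [before_congr (H.cap_start (!x) true), before_congr (H.cap_start x true), zero_add,
      Bool.not_true]
    refine key _ _ _ _ ?_
    have := H.before_eq (i := 0) (by omega) true z x
    rwa [before_congr (H.cap_start (!x) true), before_congr (H.cap_start x true), zero_add,
      Bool.not_true] at this
  have e2 : crosses v z x true (k + 1) = d (k + 1) := by
    simp only [crosses, d, before_congr (H.cap_end (!x) true), Bool.not_true]
  have hs : chi v k x z = ∑ i ∈ Finset.range k, ((crosses v z x true (i + 1) +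
      crosses v z x false (i + 1)) + (d (i + 1) + d (i + 2))) := by
    rw [Finset.sum_add_distrib, sum_range_telescope, chi, sum_edges (crosses v z x), e1, e2,
      add_assoc]
  rw [hs] at hz
  obtain ⟨i, hi, hne⟩ := Finset.exists_ne_zero_of_sum_ne_zero hz
  refine ⟨i + 1, by omega, by simpa using hi, ?_⟩
  -- A quadrilateral with odd contribution has vertices on both sides of the cell along each axis,
  -- so its bounding rectangle contains the cell.
  have key : ∀ a b a' b' p q p' q' : ZMod 2, (1 + a) * (p + p') + (1 + b) * (q + q') +
      ((1 + a) * (p + q) + (1 + a') * (p' + q')) ≠ 0 →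
      ¬ (a = b ∧ b = a' ∧ a' = b') ∧ ¬ (p = q ∧ q = p' ∧ p' = q') := by decide
  have := key _ _ _ (before v z x false (i + 2)) _ _ _ _ hne
  have aux : ∀ y, ¬ (before v z y true (i + 1) = before v z y false (i + 1) ∧
      before v z y false (i + 1) = before v z y true (i + 1 + 1) ∧
      before v z y true (i + 1 + 1) = before v z y false (i + 1 + 1)) →
      Rlo v y (i + 1) ≤ z y ∧ z y < Rhi v y (i + 1) := by
    intro y hy
    have hb : ∀ s i, z y < v y s i → before v z y s i = 0 := fun s i h => if_neg (by omega)
    have hb' : ∀ s i, v y s i ≤ z y → before v z y s i = 1 := fun s i h => if_pos h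
    by_contra hcon
    refine hy ?_
    simp only [Rlo, Rhi, elo, ehi, not_and_or, not_le, not_lt, lt_min_iff, max_le_iff] at hcon
    rcases hcon with ⟨⟨h1, h2⟩, h3, h4⟩ | ⟨⟨h1, h2⟩, h3, h4⟩
    · simp only [hb _ _ h1, hb _ _ h2, hb _ _ h3, hb _ _ h4, and_self]
    · simp only [hb' _ _ h1, hb' _ _ h2, hb' _ _ h3, hb' _ _ h4, and_self]
  exact (forall_bool_not x).mpr ⟨aux _ this.1, aux _ this.2⟩

/-- The cells on both sides of an edge do not have the same parity. -/
theorem IsCorr.chi_flip (H : IsCorr k v t c w) {i : ℕ} (hi : i ≤ k + 1) {s x : Bool}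
    (hs : s = true ∨ 1 ≤ i ∧ i ≤ k) (hx : t i = !x) {z z' : Bool → ℤ} (h1 : z x + 1 = v x s i)
    (h2 : z' x = v x s i) (h3 : z' (!x) = z (!x)) (h4 : elo v s i (!x) ≤ z (!x))
    (h5 : z (!x) < ehi v s i (!x)) : chi v k x z + chi v k x z' = 1 := by
  rw [chi, chi, ← Finset.sum_add_distrib, Finset.sum_eq_single_of_mem (s, i)]
  · simp only [crosses, before, h3, ← h1, h2]
    simp only [elo, ehi, min_le_iff, lt_max_iff] at h4 h5
    split_ifs
    all_goals first | omega | decide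
  · simp only [edges, Finset.mem_filter, Finset.mem_product, Finset.mem_range]
    exact ⟨⟨Finset.mem_univ _, by omega⟩, hs⟩
  · rintro ⟨s', j⟩ he hne
    simp only [edges, Finset.mem_filter, Finset.mem_product, Finset.mem_range] at he
    have key : ∀ a a' b b' : ZMod 2, a = a' ∨ b = b' → (1 + a) * (b + b') + (1 + a') * (b + b') = 0 :=
      by decide
    simp only [crosses]
    have e : ∀ j, before v z' (!x) s' j = before v z (!x) s' j := fun j => by
      rw [before, before, h3]
    rw [e, e]
    refine key _ _ _ _ ?_
    -- Any other edge whose contribution changes lies on the line of the given edge and spans the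
    -- same row, so the two touch. Edges with the same axis are not consecutive, which contradicts
    -- simplicity.
    by_contra! hcon
    obtain ⟨hc1, hc2⟩ := hcon
    have hX : v x s' j = v x s i := by
      by_contra hX
      refine hc1 ?_
      simp only [before]
      congr 1
      simp only [eq_iff_iff]
      omega
    have hj1 : elo v s' j (!x) ≤ z (!x) ∧ z (!x) < ehi v s' j (!x) := by
      simp only [before] at hc2
      simp only [elo, ehi]
      split_ifs at hc2
      all_goals first | omega | simp at hc2
    have hj : t j = t i := by
      rw [hx]
      rcases Bool.eq_or_eq_not (t j) x with ht | ht
      · have := H.cross (i := j) (by omega) s'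
        simp only [ht, elo, ehi] at this hj1
        omega
      · exact ht
    have e1 := H.cross hi s
    have e2 := H.cross (i := j) (by omega) s'
    rw [hj] at e2
    rw [hx, Bool.not_not] at e1 e2
    have ht : Touch (elo v s i) (ehi v s i) (elo v s' j) (ehi v s' j) := by
      refine (forall_bool_not x).mpr ⟨?_, ?_⟩
      · simp only [elo, ehi]
        omega
      · omega
    by_cases hij : j = i
    · subst hij
      have hss : s' = !s := (Bool.eq_or_eq_not s' s).resolve_left fun h => hne (h ▸ rfl)
      subst hss
      have : 1 ≤ j ∧ j ≤ k := by
        cases s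
        · exact hs.resolve_left (by simp)
        · exact he.2.resolve_left (by simp)
      exact H.opp s j j this.1 this.2 this.1 this.2 ht
    · have n1 : j ≠ i + 1 := by
        rintro rfl
        simp [H.alt] at hj
      have n2 : i ≠ j + 1 := by
        rintro rfl
        simp [H.alt] at hj
      exact H.far_symm hi (by omega) (by omega) ht

end Corr

/-! ### Boxes made of cells of the polygon lie in subcorridors. -/

namespace Corr

variable {k : ℕ} {v : Bool → Bool → ℕ → ℤ} {t : ℕ → Bool} {c : ℕ → ℤ} {w : ℤ}

/-- A box consists of cells with odd parity. -/
def OddBox (v : Bool → Bool → ℕ → ℤ) (k : ℕ) (lo hi : Bool → ℤ) : Prop :=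
  ∀ z : Bool → ℤ, (∀ x, lo x ≤ z x ∧ z x < hi x) → chi v k true z ≠ 0

theorem IsCorr.oddBox_apply (H : IsCorr k v t c w) {lo hi : Bool → ℤ} (hB : OddBox v k lo hi)
    {z : Bool → ℤ} (hz : ∀ x, lo x ≤ z x ∧ z x < hi x) (x : Bool) : chi v k x z = 1 := by
  have h := hB z hz
  have key : ∀ a : ZMod 2, a ≠ 0 → a = 1 := by decide
  refine key _ ?_
  cases x
  · rwa [H.chi_comm]
  · exact h

/-- The cell with coordinate `p` along the axis `x` and `q` along the other one. -/
def cell (x : Bool) (p q : ℤ) : Bool → ℤ := fun y => if y = x then p else q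

@[simp] theorem cell_self (x : Bool) (p q : ℤ) : cell x p q x = p := by simp [cell]

@[simp] theorem cell_not (x : Bool) (p q : ℤ) : cell x p q (!x) = q := by simp [cell]

/-- No edge cuts a box of cells with odd parity. -/
theorem IsCorr.not_cut (H : IsCorr k v t c w) {lo hi : Bool → ℤ} (hB : OddBox v k lo hi) {i : ℕ}
    (hi' : i ≤ k + 1) {s x : Bool} (hx : t i = !x) (h1 : lo x < v x s i) (h2 : v x s i < hi x)
    {y : ℤ} (h3 : lo (!x) ≤ y) (h4 : y < hi (!x)) (h5 : elo v s i (!x) ≤ y)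
    (h6 : y < ehi v s i (!x)) : False := by
  have main : ∀ s, (s = true ∨ 1 ≤ i ∧ i ≤ k) → lo x < v x s i → v x s i < hi x →
      elo v s i (!x) ≤ y → y < ehi v s i (!x) → False := by
    intro s hs h1 h2 h5 h6
    have := H.chi_flip hi' hs hx (z := cell x (v x s i - 1) y) (z' := cell x (v x s i) y) (by simp)
      (by simp) (by simp) (by simpa using h5) (by simpa using h6)
    rw [H.oddBox_apply hB, H.oddBox_apply hB] at this
    · revert this
      decide
    · exact (forall_bool_not x).mpr (by simp; omega)
    · exact (forall_bool_not x).mpr (by simp; omega)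
  -- The two end edges belong to both sides but are counted only for the side `true`, to which they
  -- are transferred.
  by_cases hs : s = true ∨ 1 ≤ i ∧ i ≤ k
  · exact main s hs h1 h2 h5 h6
  · simp only [not_or, Bool.not_eq_true] at hs
    obtain ⟨rfl, hs⟩ := hs
    have e1 := H.cross hi' true
    have e2 := H.cross hi' false
    simp only [hx, Bool.not_not] at e1 e2
    obtain rfl | rfl : i = 0 ∨ i = k + 1 := by omega
    · have a1 := H.cap_start x false
      have a2 := H.cap_start (!x) false
      have a3 := H.cap_start (!x) true
      simp only [elo, ehi, zero_add, Bool.not_false, Bool.not_true] at *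
      exact main true (Or.inl rfl) (by omega) (by omega) (by omega) (by omega)
    · have a1 := H.cap_end x false
      have a2 := H.cap_end (!x) false
      have a3 := H.cap_end (!x) true
      simp only [elo, ehi, show k + 1 + 1 = k + 2 from rfl, Bool.not_false, Bool.not_true] at *
      exact main true (Or.inl rfl) (by omega) (by omega) (by omega) (by omega)

/-- A box of cells with odd parity that is long along one axis lies in a subcorridor along this
axis. -/
theorem IsCorr.exists_class (H : IsCorr k v t c w) {lo hi : Bool → ℤ} (hB : OddBox v k lo hi)
    (hlt : ∀ x, lo x < hi x) {a : Bool} (ha : lo a + 2 * w + 1 ≤ hi a) :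
    ∃ i, 1 ≤ i ∧ i ≤ k ∧ t i = a ∧ ∀ y, Rlo v y i ≤ lo y ∧ hi y ≤ Rhi v y i := by
  have w0 : 0 ≤ w := (abs_nonneg _).trans (H.width 1 le_rfl H.one_le)
  have l0 := hlt (!a)
  -- A cell with at least `w` cells of the box on either side of it along the axis `a`.
  have hz : ∀ y, lo y ≤ cell a (lo a + w) (lo (!a)) y ∧ cell a (lo a + w) (lo (!a)) y < hi y :=
    (forall_bool_not a).mpr (by simp; omega)
  obtain ⟨i, h1, hk, hR⟩ := H.exists_mem (hB _ hz)
  rw [forall_bool_not a] at hR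
  simp only [cell_self, cell_not] at hR
  -- If the subcorridor led along the other axis, both of its edges would lie within distance `w` of
  -- the chosen cell, strictly inside the box. Both contain the crossing cell, so together they
  -- cover every row of the rectangle, and one of them would cut the box.
  have hta : t i = a := by
    by_contra hta
    have ht : t i = !a := (Bool.eq_or_eq_not _ _).resolve_left hta
    have r1 := H.Rlo_cross (i := i) (by omega)
    have r2 := H.Rhi_cross (i := i) (by omega)
    have r3 := abs_le.mp (H.width i h1 hk)
    have r4 := H.chord i h1 hk
    simp only [ht, Bool.not_not] at r1 r2 r3 r4
    have r5 : Rlo v (!a) i = min (elo v true i (!a)) (elo v false i (!a)) := rfl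
    have r6 : Rhi v (!a) i = max (ehi v true i (!a)) (ehi v false i (!a)) := rfl
    have r7 : ∀ s, elo v s i (!a) ≤ c i ∧ c i + 1 ≤ ehi v s i (!a) := fun s => by
      have := r4 s
      simp only [elo, ehi]
      omega
    have hs : ∀ s, lo a < v a s i ∧ v a s i < hi a := by
      intro s
      cases s <;> omega
    have key : ∀ s, ¬ (elo v s i (!a) ≤ lo (!a) ∧ lo (!a) < ehi v s i (!a)) := fun s h =>
      H.not_cut hB (by omega) ht (hs s).1 (hs s).2 le_rfl l0 h.1 h.2
    have k1 := key true
    have k2 := key false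
    have s1 := r7 true
    have s2 := r7 false
    omega
  have hw := H.wall h1 hk
  simp only [Wall, hta] at hw
  obtain ⟨⟨s₁, l₁, hl₁, ⟨a1, b1⟩, c1, d1⟩, s₂, l₂, hl₂, ⟨a2, b2⟩, c2, d2⟩ := hw
  have tl : ∀ l, l = i + 1 ∨ l + 1 = i → t l = !a := by
    rintro l (rfl | rfl)
    · rw [H.alt, hta]
    · rw [H.alt] at hta
      simp [← hta]
  have g1 : Rlo v a i ≤ lo a := by
    by_contra! hlt'
    have := elo_le (v := v) s₁ l₁ a
    have := le_ehi (v := v) s₁ l₁ a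
    exact H.not_cut hB (by omega) (tl l₁ hl₁) (s := s₁) (by omega) (by omega) le_rfl l0 (by omega)
      (by omega)
  have g2 : hi a ≤ Rhi v a i := by
    by_contra! hlt'
    have := elo_le (v := v) s₂ l₂ a
    have := le_ehi (v := v) s₂ l₂ a
    exact H.not_cut hB (by omega) (tl l₂ hl₂) (s := s₂) (by omega) (by omega) le_rfl l0 (by omega)
      (by omega)
  -- The ends of the two edges differ by at most `w`, and the rectangle contains the box along `a`.
  -- Hence both edges pass the chosen cell, and the one at the boundary would cut a box that sticks
  -- out.
  have g3 : hi (!a) ≤ Rhi v (!a) i := by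
    by_contra! hlt'
    have r2 := H.Rhi_cross (i := i) (by omega)
    have u1 := abs_le.mp (H.vertex_width h1 (by omega) a)
    have u2 := abs_le.mp (H.vertex_width (i := i + 1) (by omega) (by omega) a)
    rw [hta] at r2
    have key : ∀ s, elo v s i a ≤ lo a + w ∧ lo a + w < ehi v s i a := by
      intro s
      simp only [Rlo, Rhi, elo, ehi] at g1 g2 ⊢
      cases s <;> omega
    have fin : ∀ s, Rhi v (!a) i = v (!a) s i → False := fun s hs =>
      H.not_cut hB (x := !a) (i := i) (s := s) (y := lo a + w) (by omega) (by simp [hta])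
        (by omega) (by omega) (by rw [Bool.not_not]; omega) (by rw [Bool.not_not]; omega)
        (by rw [Bool.not_not]; exact (key s).1) (by rw [Bool.not_not]; exact (key s).2)
    rcases max_choice (v (!a) true i) (v (!a) false i) with h | h
    · exact fin true (by omega)
    · exact fin false (by omega)
  exact ⟨i, h1, hk, hta, (forall_bool_not a).mpr ⟨⟨g1, g2⟩, hR.2.1, g3⟩⟩

end Corr

/-! ## Sweeping the packing of a path corridor -/

namespace Corr

variable {k : ℕ} {v : Bool → Bool → ℕ → ℤ} {t : ℕ → Bool} {c : ℕ → ℤ} {w : ℤ}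

/-- At a bend both subcorridors end at the outer side. -/
theorem IsCorr.bend_extent (H : IsCorr k v t c w) {i : ℕ} (h1 : 1 ≤ i) (hk : i < k) :
    ∃ o, (Rhi v (t i) i = v (t i) o (i + 1) ∧ v (t i) (!o) (i + 1) < v (t i) o (i + 1) ∨
        Rlo v (t i) i = v (t i) o (i + 1) ∧ v (t i) o (i + 1) < v (t i) (!o) (i + 1)) ∧
      (Rlo v (!t i) (i + 1) = v (!t i) o i ∧ v (!t i) o i < v (!t i) (!o) i ∨
        Rhi v (!t i) (i + 1) = v (!t i) o i ∧ v (!t i) (!o) i < v (!t i) o i) := by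
  obtain ⟨o, hy, hx⟩ := H.bend h1 hk
  refine ⟨o, ?_⟩
  have e1 := H.cross (i := i) (by omega) o
  have e2 := H.cross (i := i) (by omega) (!o)
  rw [Rlo_eq o, Rhi_eq o, Rlo_eq o, Rhi_eq o]
  simp only [elo, ehi, show i + 1 + 1 = i + 2 from rfl, e1, e2]
  rw [forall_bool_not o, forall_bool_not o, e1, e2] at hy
  rw [forall_bool_not o, forall_bool_not o] at hx
  constructor
  · clear hy
    omega
  · clear hx
    omega

open Classical in
/-- The outer side of a bend. -/
noncomputable def outerSide (v : Bool → Bool → ℕ → ℤ) (t : ℕ → Bool) (i : ℕ) : Bool :=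
  decide ((Rhi v (t i) i = v (t i) true (i + 1) ∧ v (t i) false (i + 1) < v (t i) true (i + 1) ∨
      Rlo v (t i) i = v (t i) true (i + 1) ∧ v (t i) true (i + 1) < v (t i) false (i + 1)) ∧
    (Rlo v (!t i) (i + 1) = v (!t i) true i ∧ v (!t i) true i < v (!t i) false i ∨
      Rhi v (!t i) (i + 1) = v (!t i) true i ∧ v (!t i) false i < v (!t i) true i))

theorem IsCorr.outerSide_spec (H : IsCorr k v t c w) {i : ℕ} (h1 : 1 ≤ i) (hk : i < k) :
    (Rhi v (t i) i = v (t i) (outerSide v t i) (i + 1) ∧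
        v (t i) (!outerSide v t i) (i + 1) < v (t i) (outerSide v t i) (i + 1) ∨
      Rlo v (t i) i = v (t i) (outerSide v t i) (i + 1) ∧
        v (t i) (outerSide v t i) (i + 1) < v (t i) (!outerSide v t i) (i + 1)) ∧
    (Rlo v (!t i) (i + 1) = v (!t i) (outerSide v t i) i ∧
        v (!t i) (outerSide v t i) i < v (!t i) (!outerSide v t i) i ∨
      Rhi v (!t i) (i + 1) = v (!t i) (outerSide v t i) i ∧
        v (!t i) (!outerSide v t i) i < v (!t i) (outerSide v t i) i) := by
  obtain ⟨o, ho⟩ := H.bend_extent h1 hk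
  cases h : outerSide v t i
  · simp only [outerSide, decide_eq_false_iff_not] at h
    cases o
    · exact ho
    · exact absurd ho h
  · exact of_decide_eq_true h

open Classical in
/-- The subcorridors are swept from the side `true` to the side `false`. -/
noncomputable def sweepDir (v : Bool → Bool → ℕ → ℤ) (t : ℕ → Bool) (i : ℕ) : Bool × Bool :=
  (!t i, decide (v (!t i) true i < v (!t i) false i))

/-- The coordinates of items along the axis of a subcorridor are short compared to the items. -/
theorem few_of_disjoint {T : Finset ℕ} {lo hi : ℕ → ℕ} {N L q : ℕ} (hN : ∀ a ∈ T, hi a ≤ N)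
    (hL : ∀ a ∈ T, lo a + L ≤ hi a) (hq : N < (q + 1) * L)
    (hd : ∀ a ∈ T, ∀ b ∈ T, a ≠ b → hi a ≤ lo b ∨ hi b ≤ lo a) : T.card ≤ q := by
  have h1 : (T.biUnion fun a => Finset.Ico (lo a) (hi a)).card = ∑ a ∈ T, (hi a - lo a) := by
    rw [Finset.card_biUnion]
    · simp
    · intro a ha b hb hab
      rw [Function.onFun, Finset.disjoint_left]
      intro x hx hx'
      simp only [Finset.mem_Ico] at hx hx'
      have := hd a ha b hb hab
      omega
  have h2 : (T.biUnion fun a => Finset.Ico (lo a) (hi a)).card ≤ N := by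
    refine (Finset.card_le_card (t := Finset.range N) fun x hx => ?_).trans (by simp)
    simp only [Finset.mem_biUnion, Finset.mem_Ico] at hx
    obtain ⟨a, ha, hx⟩ := hx
    have := hN a ha
    simp only [Finset.mem_range]
    omega
  have h3 : T.card * L ≤ ∑ a ∈ T, (hi a - lo a) := by
    rw [← smul_eq_mul]
    exact Finset.card_nsmul_le_sum _ _ _ fun a ha => by have := hL a ha; omega
  have h4 : T.card * L < (q + 1) * L := by omega
  exact Nat.lt_succ_iff.mp (lt_of_mul_lt_mul_right h4 (Nat.zero_le _))

/-- A packing of long items in a path corridor can be swept. -/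
theorem IsCorr.exists_chain (H : IsCorr k v t c w) {A : Finset ℕ} {lo hi : Bool → ℕ → ℕ}
    {N L q : ℕ} (hlt : ∀ a ∈ A, ∀ x, lo x a < hi x a) (hN : ∀ a ∈ A, ∀ x, hi x a ≤ N)
    (hd : ∀ a ∈ A, ∀ b ∈ A, a ≠ b → ∃ x, hi x a ≤ lo x b ∨ hi x b ≤ lo x a)
    (hB : ∀ a ∈ A, OddBox v k (fun x => lo x a) fun x => hi x a)
    (hlong : ∀ a ∈ A, ∃ x, (lo x a + 2 * w + 1 ≤ hi x a) ∧ lo x a + L ≤ hi x a)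
    (hq : N < (q + 1) * L) :
    ∃ cls, Sweep.Chain A lo hi k q N cls (sweepDir v t) (outerSide v t) (Rlo v) (Rhi v) := by
  have w0 : 0 ≤ w := (abs_nonneg _).trans (H.width 1 le_rfl H.one_le)
  have hex : ∀ a, ∃ i, a ∈ A → (1 ≤ i ∧ i ≤ k) ∧ (lo (t i) a + 2 * w + 1 ≤ hi (t i) a ∧
      lo (t i) a + L ≤ hi (t i) a) ∧ ∀ y, Rlo v y i ≤ lo y a ∧ hi y a ≤ Rhi v y i := by
    intro a
    by_cases ha : a ∈ A
    · obtain ⟨x, h1, h2⟩ := hlong a ha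
      obtain ⟨i, hi1, hik, hti, hm⟩ := H.exists_class (hB a ha)
        (fun x => by exact_mod_cast hlt a ha x) h1
      exact ⟨i, fun _ => ⟨⟨hi1, hik⟩, by rw [hti]; exact ⟨h1, h2⟩, hm⟩⟩
    · exact ⟨0, fun h => absurd h ha⟩
  choose cls hcls using hex
  have bendfacts : ∀ a ∈ A, ∀ b ∈ A, cls b = cls a + 1 →
      ¬ ((lo (t (cls a)) a < hi (t (cls a)) b ∧ lo (t (cls a)) b < hi (t (cls a)) a) ∧
        lo (!t (cls a)) a < hi (!t (cls a)) b ∧ lo (!t (cls a)) b < hi (!t (cls a)) a) := by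
    intro a ha b hb hab hov
    obtain ⟨x, hx⟩ := hd a ha b hb (by rintro rfl; omega)
    rcases Bool.eq_or_eq_not x (t (cls a)) with rfl | rfl <;> omega
  refine ⟨cls, fun a ha => (hcls a ha).1, hlt, hN, hd, fun a ha => (hcls a ha).2.2,
    fun i j h1 hij hj => H.separated h1 hij hj, ?_, ?_, ?_⟩
  -- Both items are longer than `w`, and each of the two rectangles ends at the outer side of the
  -- bend. So each item sticks out of the other rectangle, away from the outer side. The order
  -- assumptions then make the items overlap along both axes; the same holds in the inner case.
  · intro a ha b hb hab ho h1 h2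
    obtain ⟨⟨a1, a2⟩, ⟨a3, -⟩, a4⟩ := hcls a ha
    obtain ⟨⟨b1, b2⟩, ⟨b3, -⟩, b4⟩ := hcls b hb
    have hov := bendfacts a ha b hb hab
    have sp := H.outerSide_spec a1 (by omega : cls a < k)
    rw [hab] at h1 b2 b3 b4
    have r1 := H.Rlo_cross (i := cls a) (by omega)
    have r2 := H.Rhi_cross (i := cls a) (by omega)
    have r3 := H.Rlo_cross (i := cls a + 1) (by omega)
    have r4 := H.Rhi_cross (i := cls a + 1) (by omega)
    have w1 := abs_le.mp (H.width (cls a) a1 a2)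
    have w2 := abs_le.mp (H.width (cls a + 1) (by omega) b2)
    have la := hlt a ha
    have lb := hlt b hb
    rw [ho] at sp
    simp only [Sweep.start, sweepDir, H.alt, Bool.not_not, Bool.not_true,
      decide_eq_true_eq] at h1 h2 sp r3 r4 w2 b3
    rw [forall_bool_not (t (cls a))] at a4 b4 la lb
    clear hcls hd hlt hN hlong hB bendfacts
    refine hov ?_
    rcases sp with ⟨⟨p1, p2⟩ | ⟨p1, p2⟩, ⟨p3, p4⟩ | ⟨p3, p4⟩⟩ <;>
      simp only [p2, p4, p2.not_gt, p4.not_gt, if_true, if_false] at h1 h2 <;>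
      simp only [p2.le, p4.le, max_eq_left, max_eq_right, min_eq_left, min_eq_right] at r1 r2 r3 r4 <;>
      refine ⟨⟨?_, ?_⟩, ?_, ?_⟩ <;> omega
  · intro a ha b hb hab ho h1 h2
    obtain ⟨⟨a1, a2⟩, ⟨a3, -⟩, a4⟩ := hcls a ha
    obtain ⟨⟨b1, b2⟩, ⟨b3, -⟩, b4⟩ := hcls b hb
    have hov := bendfacts a ha b hb hab
    have sp := H.outerSide_spec a1 (by omega : cls a < k)
    rw [hab] at h2 b2 b3 b4
    have r1 := H.Rlo_cross (i := cls a) (by omega)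
    have r2 := H.Rhi_cross (i := cls a) (by omega)
    have r3 := H.Rlo_cross (i := cls a + 1) (by omega)
    have r4 := H.Rhi_cross (i := cls a + 1) (by omega)
    have w1 := abs_le.mp (H.width (cls a) a1 a2)
    have w2 := abs_le.mp (H.width (cls a + 1) (by omega) b2)
    have la := hlt a ha
    have lb := hlt b hb
    rw [ho] at sp
    simp only [Sweep.start, Sweep.finish, sweepDir, H.alt, Bool.not_not, Bool.not_false,
      decide_eq_true_eq] at h1 h2 sp r3 r4 w2 b3
    rw [forall_bool_not (t (cls a))] at a4 b4 la lb
    clear hcls hd hlt hN hlong hB bendfacts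
    refine hov ?_
    rcases sp with ⟨⟨p1, p2⟩ | ⟨p1, p2⟩, ⟨p3, p4⟩ | ⟨p3, p4⟩⟩ <;>
      simp only [p2, p4, p2.not_gt, p4.not_gt, if_true, if_false] at h1 h2 <;>
      simp only [p2.le, p4.le, max_eq_left, max_eq_right, min_eq_left, min_eq_right] at r1 r2 r3 r4 <;>
      refine ⟨⟨?_, ?_⟩, ?_, ?_⟩ <;> omega
  -- Items met by the same sweep line overlap across the subcorridor, so they must be disjoint along
  -- it.
  · intro i T hT hi' s hs
    refine few_of_disjoint (lo := lo (t i)) (hi := hi (t i)) (fun a ha => hN a (hT ha) _)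
      (fun a ha => hi' a ha ▸ (hcls a (hT ha)).2.1.2) hq fun a ha b hb hab => ?_
    obtain ⟨x, hx⟩ := hd a (hT ha) b (hT hb) hab
    rcases Bool.eq_or_eq_not x (t i) with rfl | rfl
    · exact hx
    · have ha' := hs a ha
      have hb' := hs b hb
      simp only [Sweep.start, Sweep.finish, sweepDir, decide_eq_true_eq] at ha' hb'
      by_cases hv : v (!t i) true i < v (!t i) false i <;>
        simp only [hv, if_true, if_false] at ha' hb' <;> omega

end Corr

/-! ## The chain of a path corridor -/

namespace Corridor

variable {k : ℕ}

/-- The coordinate of a lattice point along the axis `x`. -/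
def coord (x : Bool) (p : ℕ × ℕ) : ℤ := if x then p.2 else p.1

/-- The coordinate of a point along the axis `x`. -/
def realCoord (x : Bool) (p : ℝ × ℝ) : ℝ := if x then p.2 else p.1

/-- The vertices of a polygon, numbered cyclically. -/
def vertex (P : Fin (2 * k + 2) → ℕ × ℕ) (i : ℕ) : ℕ × ℕ := P (Fin.ofNat (2 * k + 2) i)

/-- The vertices of the two sides of a corridor. -/
def side (P : Fin (2 * k + 2) → ℕ × ℕ) (x s : Bool) (i : ℕ) : ℤ :=
  coord x (vertex P (if s then i else 2 * k + 3 - i))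

theorem ofNat_succ (i : ℕ) : Fin.ofNat (2 * k + 2) i + 1 = Fin.ofNat (2 * k + 2) (i + 1) := by
  ext
  simp [Fin.val_add]

theorem ofNat_inj {i j : ℕ} (h : i ≤ j) (hj : j < i + (2 * k + 2))
    (he : Fin.ofNat (2 * k + 2) i = Fin.ofNat (2 * k + 2) j) : i = j := by
  have h1 : i % (2 * k + 2) = j % (2 * k + 2) := by simpa [Fin.ext_iff] using he
  have h2 := (Nat.modEq_iff_dvd' h).mp h1
  by_contra hne
  have := Nat.le_of_dvd (by omega) h2
  omega

theorem vertex_add (P : Fin (2 * k + 2) → ℕ × ℕ) (i : ℕ) :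
    vertex P (i + (2 * k + 2)) = vertex P i := by
  unfold vertex
  congr 1
  ext
  simp

theorem vertex_succ (P : Fin (2 * k + 2) → ℕ × ℕ) (i : ℕ) :
    P (Fin.ofNat (2 * k + 2) i + 1) = vertex P (i + 1) := by
  rw [ofNat_succ, vertex]

open Classical in
/-- The axis of the edge `i`. -/
noncomputable def axis (P : Fin (2 * k + 2) → ℕ × ℕ) (i : ℕ) : Bool :=
  xor (decide (edgeVertical P 0)) (decide (Odd i))

theorem axis_succ (P : Fin (2 * k + 2) → ℕ × ℕ) (i : ℕ) : axis P (i + 1) = !axis P i := by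
  unfold axis
  by_cases h : Odd i
  · have : ¬ Odd (i + 1) := by simpa [Nat.odd_add_one] using h
    simp [h, this]
  · have : Odd (i + 1) := by simpa [Nat.odd_add_one] using h
    simp [h, this]

theorem axis_reflect (P : Fin (2 * k + 2) → ℕ × ℕ) {i : ℕ} (hi : i ≤ 2 * k + 2) :
    axis P (2 * k + 2 - i) = axis P i := by
  unfold axis
  have : Odd (2 * k + 2 - i) ↔ Odd i := by
    rw [Nat.odd_iff, Nat.odd_iff]
    omega
  simp only [this]

variable {P : Fin (2 * k + 2) → ℕ × ℕ}

theorem axis_spec (h : IsRectilinear P) (i : ℕ) :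
    (axis P i = true ∧ edgeVertical P (Fin.ofNat _ i)) ∨
      (axis P i = false ∧ edgeHorizontal P (Fin.ofNat _ i)) := by
  have excl : ∀ j, edgeHorizontal P j → ¬ edgeVertical P j := fun j h1 h2 => h1.2 h2.1
  induction i with
  | zero =>
    have e : Fin.ofNat (2 * k + 2) 0 = 0 := rfl
    rw [e]
    rcases h 0 with ⟨h1, -⟩ | ⟨h1, -⟩
    · simp [axis, excl _ h1, h1]
    · simp [axis, h1]
  | succ i ih =>
    rw [axis_succ, ← ofNat_succ]
    rcases ih with ⟨a, b⟩ | ⟨a, b⟩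
    · rcases h (Fin.ofNat _ i) with ⟨h1, -⟩ | ⟨-, h2⟩
      · exact absurd b (excl _ h1)
      · exact Or.inr ⟨by simp [a], h2⟩
    · rcases h (Fin.ofNat _ i) with ⟨-, h2⟩ | ⟨h1, -⟩
      · exact Or.inl ⟨by simp [a], h2⟩
      · exact absurd h1 (excl _ b)

theorem coord_axis (h : IsRectilinear P) (i : ℕ) :
    coord (!axis P i) (vertex P i) = coord (!axis P i) (vertex P (i + 1)) ∧
      coord (axis P i) (vertex P i) ≠ coord (axis P i) (vertex P (i + 1)) := by
  rcases axis_spec h i with ⟨a, b⟩ | ⟨a, b⟩ <;> obtain ⟨b1, b2⟩ := b <;>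
    rw [vertex_succ P i] at b1 b2 <;> rw [a] <;>
    exact ⟨congrArg Nat.cast b1, fun h => b2 (Nat.cast_injective (R := ℤ) h)⟩

/-- Axis-parallel segments are boxes. -/
theorem mem_edge_iff (h : IsRectilinear P) (i : ℕ) (p : ℝ × ℝ) :
    p ∈ edge P (Fin.ofNat _ i) ↔ ∀ x,
      ((min (coord x (vertex P i)) (coord x (vertex P (i + 1))) : ℤ) : ℝ) ≤ realCoord x p ∧
      realCoord x p ≤ ((max (coord x (vertex P i)) (coord x (vertex P (i + 1))) : ℤ) : ℝ) := by
  have e : edge P (Fin.ofNat _ i) = segment ℝ (pt (vertex P i)) (pt (vertex P (i + 1))) := by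
    rw [edge, vertex_succ P i]
    rfl
  rw [e]
  obtain ⟨p1, p2⟩ := p
  have hc := (coord_axis h i).1
  cases ha : axis P i
  · rw [ha] at hc
    simp only [coord, Bool.not_false, if_true, Nat.cast_inj] at hc
    rw [pt, pt, hc, ← Prod.image_mk_segment_left, segment_eq_uIcc, Bool.forall_bool]
    simp only [realCoord, coord, hc, Bool.false_eq_true, if_true, if_false, Set.mem_image,
      Prod.mk.injEq, Set.uIcc, Set.mem_Icc, min_self, max_self, Int.cast_min, Int.cast_max,
      Int.cast_natCast]
    constructor
    · rintro ⟨y, hy, rfl, rfl⟩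
      exact ⟨hy, le_rfl, le_rfl⟩
    · rintro ⟨hy, h3, h4⟩
      exact ⟨p1, hy, rfl, le_antisymm h3 h4⟩
  · rw [ha] at hc
    simp only [coord, Bool.not_true, Bool.false_eq_true, if_false, Nat.cast_inj] at hc
    rw [pt, pt, hc, ← Prod.image_mk_segment_right, segment_eq_uIcc, Bool.forall_bool]
    simp only [realCoord, coord, hc, Bool.false_eq_true, if_true, if_false, Set.mem_image,
      Prod.mk.injEq, Set.uIcc, Set.mem_Icc, min_self, max_self, Int.cast_min, Int.cast_max,
      Int.cast_natCast]
    constructor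
    · rintro ⟨y, hy, rfl, rfl⟩
      exact ⟨⟨le_rfl, le_rfl⟩, hy⟩
    · rintro ⟨⟨h3, h4⟩, hy⟩
      exact ⟨p2, hy, le_antisymm h3 h4, rfl⟩

end Corridor

/-! ### Edges as boxes, and the crossing segments. -/

namespace Corridor

variable {k : ℕ} {P : Fin (2 * k + 2) → ℕ × ℕ}

/-- The extent of the edge `i` along the axis `x`. -/
def edgeMin (P : Fin (2 * k + 2) → ℕ × ℕ) (i : ℕ) (x : Bool) : ℤ :=
  min (coord x (vertex P i)) (coord x (vertex P (i + 1)))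

def edgeMax (P : Fin (2 * k + 2) → ℕ × ℕ) (i : ℕ) (x : Bool) : ℤ :=
  max (coord x (vertex P i)) (coord x (vertex P (i + 1)))

/-- The number of the edge `i` of the side `s`. -/
def edgeIndex (k : ℕ) (s : Bool) (i : ℕ) : ℕ := if s then i else 2 * k + 2 - i

theorem elo_side {i : ℕ} (hi : i ≤ 2 * k + 2) (s x : Bool) :
    Corr.elo (side P) s i x = edgeMin P (edgeIndex k s i) x := by
  unfold Corr.elo side edgeMin edgeIndex
  cases s
  · simp only [Bool.false_eq_true, if_false]
    rw [min_comm, show 2 * k + 3 - (i + 1) = 2 * k + 2 - i by omega,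
      show 2 * k + 3 - i = 2 * k + 2 - i + 1 by omega]
  · rfl

theorem ehi_side {i : ℕ} (hi : i ≤ 2 * k + 2) (s x : Bool) :
    Corr.ehi (side P) s i x = edgeMax P (edgeIndex k s i) x := by
  unfold Corr.ehi side edgeMax edgeIndex
  cases s
  · simp only [Bool.false_eq_true, if_false]
    rw [max_comm, show 2 * k + 3 - (i + 1) = 2 * k + 2 - i by omega,
      show 2 * k + 3 - i = 2 * k + 2 - i + 1 by omega]
  · rfl

theorem ofNat_ne {i j : ℕ} (h : i < j ∧ j < i + (2 * k + 2) ∨ j < i ∧ i < j + (2 * k + 2)) :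
    Fin.ofNat (2 * k + 2) i ≠ Fin.ofNat (2 * k + 2) j := by
  intro he
  rcases h with h | h
  · exact h.1.ne (ofNat_inj h.1.le h.2 he)
  · exact h.1.ne (ofNat_inj h.1.le h.2 he.symm)

theorem disjoint_edges (h : IsSimple P) {i j : ℕ} (h1 : i + 2 ≤ j) (h2 : j + 1 < i + (2 * k + 2)) :
    Disjoint (edge P (Fin.ofNat _ i)) (edge P (Fin.ofNat _ j)) := by
  refine h.2 _ _ (ofNat_ne (by omega)) ?_ ?_ <;> rw [ofNat_succ] <;> exact ofNat_ne (by omega)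

/-- The point with coordinate `p` along the axis `x` and `q` along the other one. -/
def point (x : Bool) (p q : ℝ) : ℝ × ℝ := if x then (q, p) else (p, q)

@[simp] theorem realCoord_point (x : Bool) (p q : ℝ) : realCoord x (point x p q) = p := by
  cases x <;> rfl

@[simp] theorem realCoord_point' (x : Bool) (p q : ℝ) : realCoord (!x) (point x p q) = q := by
  cases x <;> rfl

theorem not_touch_of_disjoint (h : IsRectilinear P) {i j : ℕ}
    (hd : Disjoint (edge P (Fin.ofNat _ i)) (edge P (Fin.ofNat _ j))) :
    ¬ Corr.Touch (edgeMin P i) (edgeMax P i) (edgeMin P j) (edgeMax P j) := by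
  intro ht
  rw [Set.disjoint_left] at hd
  have h0 : ∀ i x, edgeMin P i x ≤ edgeMax P i x := fun i x => min_le_max
  obtain ⟨q, e⟩ : ∃ q, ∀ x, realCoord x q = ((max (edgeMin P i x) (edgeMin P j x) : ℤ) : ℝ) :=
    ⟨point false ((max (edgeMin P i false) (edgeMin P j false) : ℤ) : ℝ)
      ((max (edgeMin P i true) (edgeMin P j true) : ℤ) : ℝ), fun x => by cases x <;> rfl⟩
  refine hd ((mem_edge_iff h i q).mpr fun x => ?_) ((mem_edge_iff h j q).mpr fun x => ?_) <;>
    rw [e, Int.cast_le, Int.cast_le]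
  · exact ⟨le_max_left _ _, max_le (h0 i x) (ht x).2⟩
  · exact ⟨le_max_right _ _, max_le (ht x).1 (h0 j x)⟩

theorem mem_segment_iff {x : Bool} {a b : ℝ × ℝ} (h : realCoord x a = realCoord x b) (p : ℝ × ℝ) :
    p ∈ segment ℝ a b ↔ realCoord x p = realCoord x a ∧
      min (realCoord (!x) a) (realCoord (!x) b) ≤ realCoord (!x) p ∧
      realCoord (!x) p ≤ max (realCoord (!x) a) (realCoord (!x) b) := by
  obtain ⟨a1, a2⟩ := a
  obtain ⟨b1, b2⟩ := b
  obtain ⟨p1, p2⟩ := p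
  cases x <;> simp only [realCoord, Bool.false_eq_true, if_true, if_false, Bool.not_true,
    Bool.not_false] at h ⊢ <;> subst h
  · rw [← Prod.image_mk_segment_right, segment_eq_uIcc]
    simp only [Set.mem_image, Prod.mk.injEq, Set.uIcc, Set.mem_Icc]
    constructor
    · rintro ⟨y, hy, rfl, rfl⟩
      exact ⟨rfl, hy⟩
    · rintro ⟨rfl, hy⟩
      exact ⟨p2, hy, rfl, rfl⟩
  · rw [← Prod.image_mk_segment_left, segment_eq_uIcc]
    simp only [Set.mem_image, Prod.mk.injEq, Set.uIcc, Set.mem_Icc]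
    constructor
    · rintro ⟨y, hy, rfl, rfl⟩
      exact ⟨rfl, hy⟩
    · rintro ⟨rfl, hy⟩
      exact ⟨p1, hy, rfl, rfl⟩

/-- The line through a subcorridor. -/
theorem exists_chord (h : IsRectilinear P) {δ : ℝ} {i j : ℕ} (hij : axis P j = axis P i)
    (hc : ConnectedByShortSegment P δ (Fin.ofNat _ i) (Fin.ofNat _ j)) :
    ∃ X : ℝ, (∀ l, l = i ∨ l = j → edgeMin P l (axis P i) ≤ X ∧ X ≤ edgeMax P l (axis P i)) ∧
      |(coord (!axis P i) (vertex P i) : ℝ) - coord (!axis P i) (vertex P j)| < δ ∧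
      ∀ l, Fin.ofNat (2 * k + 2) l ≠ Fin.ofNat _ i → Fin.ofNat (2 * k + 2) l ≠ Fin.ofNat _ j →
        ¬ ((edgeMin P l (axis P i) ≤ X ∧ X ≤ edgeMax P l (axis P i)) ∧
          edgeMin P l (!axis P i) ≤
            max (coord (!axis P i) (vertex P i)) (coord (!axis P i) (vertex P j)) ∧
          min (coord (!axis P i) (vertex P i)) (coord (!axis P i) (vertex P j)) ≤
            edgeMax P l (!axis P i)) := by
  obtain ⟨a, b, hab, hi, hj, hl⟩ := hc
  have ha : realCoord (axis P i) a = realCoord (axis P i) b ∧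
      |realCoord (!axis P i) a - realCoord (!axis P i) b| < δ := by
    rcases axis_spec h i with ⟨h1, h2⟩ | ⟨h1, h2⟩ <;> rw [h1]
    · rcases hab with ⟨h3, -⟩ | ⟨-, -, h3⟩
      · exact absurd h2.1 h3.2
      · exact h3
    · rcases hab with ⟨-, -, h3⟩ | ⟨h3, -⟩
      · exact h3
      · exact absurd h2.1 h3.2
  obtain ⟨ha1, ha2⟩ := ha
  have par : ∀ l, l = i ∨ l = j →
      edgeMin P l (!axis P i) = coord (!axis P i) (vertex P l) ∧
        edgeMax P l (!axis P i) = coord (!axis P i) (vertex P l) := by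
    rintro l hl'
    have e : axis P l = axis P i := by
      rcases hl' with rfl | rfl
      exacts [rfl, hij]
    have := (coord_axis h l).1
    rw [e] at this
    simp [edgeMin, edgeMax, this]
  have hmem : ∀ l, l = i ∨ l = j → (edgeMin P l (axis P i) ≤ realCoord (axis P i) a ∧
      realCoord (axis P i) a ≤ edgeMax P l (axis P i)) ∧
      min (realCoord (!axis P i) a) (realCoord (!axis P i) b) ≤ coord (!axis P i) (vertex P l) ∧
      coord (!axis P i) (vertex P l) ≤ max (realCoord (!axis P i) a) (realCoord (!axis P i) b) := by
    intro l hl'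
    obtain ⟨p, hp1, hp2⟩ : (edge P (Fin.ofNat _ l) ∩ segment ℝ a b).Nonempty := by
      rcases hl' with rfl | rfl
      exacts [hi, hj]
    rw [mem_edge_iff h] at hp1
    rw [mem_segment_iff ha1] at hp2
    have h1 := hp1 (axis P i)
    have h2 := hp1 (!axis P i)
    have h3 := par l hl'
    unfold edgeMin edgeMax at h3 ⊢
    rw [h3.1, h3.2] at h2
    rw [hp2.1] at h1
    rw [le_antisymm h2.1 h2.2]
    exact ⟨h1, hp2.2⟩
  refine ⟨realCoord (axis P i) a, fun l hl' => (hmem l hl').1, ?_, fun l h1 h2 hcon => ?_⟩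
  · have h1 := (hmem i (Or.inl rfl)).2
    have h2 := (hmem j (Or.inr rfl)).2
    refine lt_of_le_of_lt ?_ ha2
    rw [← max_sub_min_eq_abs' (realCoord _ a), abs_le]
    constructor <;> linarith
  · obtain ⟨h3, h4, h5⟩ := hcon
    have hi' := (hmem i (Or.inl rfl)).2
    have hj' := (hmem j (Or.inr rfl)).2
    have hdis := Set.disjoint_left.mp (hl _ h1 h2)
    refine hdis (a := point (axis P i) (realCoord (axis P i) a)
      ((max (edgeMin P l (!axis P i)) (min (coord (!axis P i) (vertex P i))
        (coord (!axis P i) (vertex P j))) : ℤ) : ℝ)) ?_ ?_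
    · rw [mem_edge_iff h, Corr.forall_bool_not (axis P i)]
      simp only [realCoord_point, realCoord_point']
      refine ⟨h3, ?_⟩
      rw [Int.cast_le, Int.cast_le]
      exact ⟨le_max_left _ _, max_le min_le_max h5⟩
    · rw [mem_segment_iff ha1]
      simp only [realCoord_point, realCoord_point', true_and]
      constructor
      · push_cast
        exact le_max_of_le_right (le_min hi'.1 hj'.1)
      · refine le_trans (Int.cast_le.mpr (max_le h4 min_le_max)) ?_
        push_cast
        exact max_le hi'.2 hj'.2

/-- The ends of an edge belong to its two neighbours, which the crossing line avoids. The preceding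
edge is numbered `i + (2 * k + 1)`, modulo `2 * k + 2`. -/
theorem strict_of_avoid (h : IsRectilinear P) {i : ℕ} {X : ℝ}
    (hX : edgeMin P i (axis P i) ≤ X ∧ X ≤ edgeMax P i (axis P i))
    (hl : ∀ l, l = i + (2 * k + 1) ∨ l = i + 1 →
      ¬ ((edgeMin P l (axis P i) ≤ X ∧ X ≤ edgeMax P l (axis P i)) ∧
          edgeMin P l (!axis P i) ≤ coord (!axis P i) (vertex P i) ∧
          coord (!axis P i) (vertex P i) ≤ edgeMax P l (!axis P i))) :
    edgeMin P i (axis P i) < X ∧ X < edgeMax P i (axis P i) := by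
  have h1 : X ≠ coord (axis P i) (vertex P i) := by
    rintro rfl
    refine hl _ (Or.inl rfl) ?_
    rw [edgeMin, edgeMax, edgeMin, edgeMax, show i + (2 * k + 1) + 1 = i + (2 * k + 2) from rfl,
      vertex_add, Int.cast_le, Int.cast_le]
    exact ⟨⟨min_le_right _ _, le_max_right _ _⟩, min_le_right _ _, le_max_right _ _⟩
  have h2 : X ≠ coord (axis P i) (vertex P (i + 1)) := by
    rintro rfl
    refine hl _ (Or.inr rfl) ?_
    rw [(coord_axis h i).1, edgeMin, edgeMax, edgeMin, edgeMax, Int.cast_le, Int.cast_le]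
    exact ⟨⟨min_le_left _ _, le_max_left _ _⟩, min_le_left _ _, le_max_left _ _⟩
  obtain ⟨h3, h4⟩ := hX
  refine ⟨lt_of_le_of_ne h3 ?_, lt_of_le_of_ne h4 ?_⟩
  · rcases min_choice (coord (axis P i) (vertex P i)) (coord (axis P i) (vertex P (i + 1))) with e | e <;>
      rw [edgeMin, e]
    exacts [h1.symm, h2.symm]
  · rcases max_choice (coord (axis P i) (vertex P i)) (coord (axis P i) (vertex P (i + 1))) with e | e <;>
      rw [edgeMax, e]
    exacts [h1, h2]

/-- The sides of the corridor run along the crossing line, and no other edge meets this line. -/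
theorem exists_column (h : IsRectilinear P) {δ : ℝ} {i : ℕ} (h1 : 1 ≤ i) (hk : i ≤ k)
    (hc : ConnectedByShortSegment P δ (Fin.ofNat _ i) (Fin.ofNat _ (2 * k + 2 - i))) :
    ∃ c : ℤ, (∀ l, l = i ∨ l = 2 * k + 2 - i →
        edgeMin P l (axis P i) ≤ c ∧ c + 1 ≤ edgeMax P l (axis P i)) ∧
      |(coord (!axis P i) (vertex P i) : ℝ) - coord (!axis P i) (vertex P (2 * k + 2 - i))| < δ ∧
      ∀ l, Fin.ofNat (2 * k + 2) l ≠ Fin.ofNat _ i →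
        Fin.ofNat (2 * k + 2) l ≠ Fin.ofNat _ (2 * k + 2 - i) →
        ¬ (edgeMin P l (axis P i) ≤ c ∧ c + 1 ≤ edgeMax P l (axis P i) ∧
          edgeMin P l (!axis P i) ≤ max (coord (!axis P i) (vertex P i))
            (coord (!axis P i) (vertex P (2 * k + 2 - i))) ∧
          min (coord (!axis P i) (vertex P i)) (coord (!axis P i) (vertex P (2 * k + 2 - i))) ≤
            edgeMax P l (!axis P i)) := by
  have hax : axis P (2 * k + 2 - i) = axis P i := axis_reflect P (by omega)
  obtain ⟨X, hX, hw, hl⟩ := exists_chord h hax hc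
  -- Since `X` lies strictly between integral ends, the whole unit interval from `⌊X⌋` lies between
  -- them; conversely an edge covering this interval meets the line at `X`.
  refine ⟨⌊X⌋, fun l hl' => ?_, hw, fun l h2 h3 hcon => hl l h2 h3 ⟨⟨?_, ?_⟩, hcon.2.2⟩⟩
  · have hs : edgeMin P l (axis P i) < X ∧ X < edgeMax P l (axis P i) := by
      rcases hl' with rfl | rfl
      · refine strict_of_avoid h (hX _ (Or.inl rfl)) fun l' hl'' hcon => ?_
        refine hl l' (ofNat_ne (by omega)) ?_
          ⟨hcon.1, hcon.2.1.trans (le_max_left _ _), (min_le_left _ _).trans hcon.2.2⟩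
        rcases lt_or_gt_of_ne (show l' ≠ 2 * k + 2 - l by omega) with hlt | hlt
        · exact ofNat_ne (Or.inl (by omega))
        · exact ofNat_ne (Or.inr (by omega))
      · rw [← hax]
        refine strict_of_avoid h (by rw [hax]; exact hX _ (Or.inr rfl)) fun l' hl'' hcon => ?_
        rw [hax] at hcon
        rcases hl'' with rfl | rfl
        · rw [show 2 * k + 2 - i + (2 * k + 1) = 2 * k + 1 - i + (2 * k + 2) by omega] at hcon
          have e : ∀ x, edgeMin P (2 * k + 1 - i + (2 * k + 2)) x = edgeMin P (2 * k + 1 - i) x ∧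
              edgeMax P (2 * k + 1 - i + (2 * k + 2)) x = edgeMax P (2 * k + 1 - i) x := fun x => by
            simp only [edgeMin, edgeMax, Nat.add_right_comm _ (2 * k + 2) 1, vertex_add, and_self]
          rw [(e _).1, (e _).2, (e _).1, (e _).2] at hcon
          exact hl (2 * k + 1 - i) (ofNat_ne (by omega)) (ofNat_ne (by omega))
            ⟨hcon.1, hcon.2.1.trans (le_max_right _ _), (min_le_right _ _).trans hcon.2.2⟩
        · exact hl _ (ofNat_ne (by omega)) (ofNat_ne (by omega))
            ⟨hcon.1, hcon.2.1.trans (le_max_right _ _), (min_le_right _ _).trans hcon.2.2⟩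
    exact ⟨Int.le_floor.mpr hs.1.le, Int.add_one_le_iff.mpr (Int.floor_lt.mpr hs.2)⟩
  · exact (Int.cast_le.mpr hcon.1).trans (Int.floor_le X)
  · refine (Int.lt_floor_add_one X).le.trans ?_
    exact_mod_cast hcon.2.1

end Corridor

/-! ### From path corridors to the integral description. -/

namespace Corridor

variable {k : ℕ} {P : Fin (2 * k + 2) → ℕ × ℕ}

theorem edgeLength_eq (h : IsRectilinear P) (i : ℕ) : edgeLength P (Fin.ofNat _ i) =
    ((|coord (axis P i) (vertex P i) - coord (axis P i) (vertex P (i + 1))| : ℤ) : ℝ) := by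
  unfold edgeLength
  rw [vertex_succ P i]
  change |((vertex P (i + 1)).1 : ℝ) - (vertex P i).1| + |((vertex P (i + 1)).2 : ℝ) - (vertex P i).2| = _
  have hc := (coord_axis h i).1
  cases ha : axis P i <;> rw [ha] at hc
  · have hc' : (vertex P i).2 = (vertex P (i + 1)).2 := Nat.cast_injective hc
    rw [hc', abs_sub_comm]
    simp [coord]
  · have hc' : (vertex P i).1 = (vertex P (i + 1)).1 := Nat.cast_injective hc
    rw [hc', abs_sub_comm (((vertex P (i + 1)).2 : ℕ) : ℝ)]
    simp [coord]

theorem side_false (x : Bool) {i : ℕ} (hi : i ≤ 2 * k + 2) :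
    side P x false i = coord x (vertex P (2 * k + 2 - i + 1)) := by
  rw [side, if_neg Bool.false_ne_true, show 2 * k + 2 - i + 1 = 2 * k + 3 - i by omega]

theorem side_false_succ (x : Bool) (i : ℕ) :
    side P x false (i + 1) = coord x (vertex P (2 * k + 2 - i)) := by
  rw [side, if_neg Bool.false_ne_true, show 2 * k + 3 - (i + 1) = 2 * k + 2 - i by omega]

theorem side_true (x : Bool) (i : ℕ) : side P x true i = coord x (vertex P i) := rfl

/-- Edges of different sides or levels are not adjacent and therefore disjoint. -/
theorem disjoint_sides (h : IsSimple P) {s s' : Bool} {i j : ℕ} (hj : j ≤ k + 1)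
    (hij : i + 2 ≤ j ∨ s' = !s ∧ 1 ≤ i ∧ i ≤ k ∧ 1 ≤ j ∧ j ≤ k) :
    Disjoint (edge P (Fin.ofNat _ (edgeIndex k s i))) (edge P (Fin.ofNat _ (edgeIndex k s' j))) := by
  by_cases hi0 : i = 0
  · have e : Fin.ofNat (2 * k + 2) (edgeIndex k s i) = Fin.ofNat _ 0 := by
      subst hi0
      cases s <;> ext <;> simp [edgeIndex]
    rw [e]
    refine disjoint_edges h ?_ ?_ <;> cases s' <;> simp [edgeIndex] <;> omega
  · cases s <;> cases s' <;> simp only [edgeIndex, Bool.false_eq_true, if_true, if_false,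
      Bool.not_false, Bool.not_true, reduceCtorEq, false_and, or_false, true_and] at hij ⊢
    · exact (disjoint_edges h (by omega) (by omega)).symm
    · exact (disjoint_edges h (by omega) (by omega)).symm
    · exact disjoint_edges h (by omega) (by omega)
    · exact disjoint_edges h (by omega) (by omega)

/-- A path corridor is a chain of subcorridors. -/
theorem IsPathCorridor.isCorr {ε l : ℝ} {N : ℕ} (h : IsPathCorridor ε l N k P) (hε : ε ≤ 1 / 2)
    (hl : 0 < l) : ∃ c, Corr.IsCorr k (side P) (axis P) c (⌈l * N / 2⌉ - 1) := by
  have hcol := fun i h1 hk => exists_column h.rectilinear h1 hk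
    (h.thin i (Finset.mem_Icc.mpr ⟨h1, hk⟩))
  choose! c hc1 hc2 hc3 using hcol
  have hR := h.rectilinear
  refine ⟨c, h.one_le, axis_succ P, ?_, ?_, ?_, ?_, ?_, ?_, ?_, ?_, ?_⟩
  · intro i hi s
    cases s
    · rw [side_false _ (by omega), side_false_succ]
      have := (coord_axis hR (2 * k + 2 - i)).1
      rw [axis_reflect P (by omega)] at this
      exact this.symm
    · exact (coord_axis hR i).1
  · intro x s
    cases s
    · simp only [side, Bool.not_false, Bool.false_eq_true, if_true, if_false, Nat.sub_zero]
      rw [show 2 * k + 3 = 1 + (2 * k + 2) by omega, vertex_add]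
    · simp only [side, Bool.not_true, Bool.false_eq_true, if_true, if_false]
      rw [show 2 * k + 3 - 1 = 0 + (2 * k + 2) by omega, vertex_add]
  · intro x s
    cases s <;> simp only [side, Bool.not_true, Bool.not_false, Bool.false_eq_true, if_true, if_false]
    · rw [show 2 * k + 3 - (k + 2) = k + 1 by omega]
    · rw [show 2 * k + 3 - (k + 1) = k + 2 by omega]
  · intro i h1 hk s
    have e1 := hc1 i h1 hk i (Or.inl rfl)
    have e2 := hc1 i h1 hk (2 * k + 2 - i) (Or.inr rfl)
    cases s
    · rw [side_false _ (by omega), side_false_succ]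
      unfold edgeMin edgeMax at e2
      omega
    · rw [side_true, side_true]
      unfold edgeMin edgeMax at e1
      omega
  · intro i h1 hk
    -- The width is an integer less than `ε * l * N`, which is at most `l * N / 2`, hence at most
    -- `⌈l * N / 2⌉ - 1`. The lengths, at least `l * N / 2`, exceed this bound.
    have e1 := hc2 i h1 hk
    have e2 := (coord_axis hR (2 * k + 2 - i)).1
    rw [axis_reflect P (by omega)] at e2
    rw [side_true, side_false _ (by omega), ← e2, Int.le_sub_one_iff, Int.lt_ceil]
    push_cast
    refine e1.trans_le ?_
    have : (0 : ℝ) ≤ l * N := by positivity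
    nlinarith
  · intro i h1 hk s
    refine Int.sub_one_lt_iff.mpr (Int.ceil_le.mpr ?_)
    have e := h.long i (Finset.mem_Icc.mpr ⟨h1, hk⟩)
    rw [edgeLength_eq hR, edgeLength_eq hR, axis_reflect P (by omega)] at e
    cases s
    · rw [side_false _ (by omega), side_false_succ, abs_sub_comm]
      exact e.2
    · exact e.1
  · intro s s' i j hij hj
    have := not_touch_of_disjoint hR (disjoint_sides h.simple (s := s) (s' := s') hj (Or.inl hij))
    unfold Corr.Touch at this ⊢
    simpa only [elo_side (P := P) (show i ≤ 2 * k + 2 by omega),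
      elo_side (P := P) (show j ≤ 2 * k + 2 by omega), ehi_side (P := P) (show i ≤ 2 * k + 2 by omega),
      ehi_side (P := P) (show j ≤ 2 * k + 2 by omega)] using this
  · intro s i j h1 hk h1' hk'
    have := not_touch_of_disjoint hR (disjoint_sides h.simple (s := s) (s' := !s) (i := i) (j := j)
      (by omega) (Or.inr ⟨rfl, h1, hk, h1', hk'⟩))
    unfold Corr.Touch at this ⊢
    simpa only [elo_side (P := P) (show i ≤ 2 * k + 2 by omega),
      elo_side (P := P) (show j ≤ 2 * k + 2 by omega), ehi_side (P := P) (show i ≤ 2 * k + 2 by omega),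
      ehi_side (P := P) (show j ≤ 2 * k + 2 by omega)] using this
  · intro i h1 hk j hj hji s
    have e2 := (coord_axis hR (2 * k + 2 - i)).1
    rw [axis_reflect P (by omega)] at e2
    rw [elo_side (by omega), elo_side (by omega), ehi_side (by omega), ehi_side (by omega), side_true,
      side_false _ (by omega), ← e2]
    -- On the side `false` the edge 0 gets the number `2 * k + 2`, which denotes the same edge as 0;
    -- the latter representative is used.
    by_cases hj0 : j = 0 ∧ s = false
    · obtain ⟨rfl, rfl⟩ := hj0
      have := hc3 i h1 hk 0 (ofNat_ne (by omega)) (ofNat_ne (by omega))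
      have e : ∀ x, edgeMin P (0 + (2 * k + 2)) x = edgeMin P 0 x ∧
          edgeMax P (0 + (2 * k + 2)) x = edgeMax P 0 x := fun x => by
        simp only [edgeMin, edgeMax, Nat.add_right_comm _ (2 * k + 2) 1, vertex_add, and_self]
      rw [show edgeIndex k false 0 = 0 + (2 * k + 2) by simp [edgeIndex], (e _).1, (e _).2, (e _).1,
        (e _).2]
      exact this
    · refine hc3 i h1 hk _ ?_ ?_
      · refine ofNat_ne ?_
        cases s <;> simp [edgeIndex] at hj0 ⊢ <;> omega
      · refine ofNat_ne ?_
        cases s <;> simp [edgeIndex] at hj0 ⊢ <;> omega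

end Corridor

/-! ### The region in terms of crossing parity. -/

namespace Corridor

variable {k : ℕ} {P : Fin (2 * k + 2) → ℕ × ℕ}

/-- Does the ray to the right of the cell `z` cross the edge `i`? -/
def CrossesEdge (P : Fin (2 * k + 2) → ℕ × ℕ) (z : Bool → ℤ) (i : ℕ) : Prop :=
  z false < coord false (vertex P i) ∧
    ¬ (coord true (vertex P i) ≤ z true ↔ coord true (vertex P (i + 1)) ≤ z true)

open Classical in
-- The side `false` runs through its edges backwards. An edge contributes the same in either
-- direction, since it is either parallel to the ray and contributes nothing, or both of its ends
-- have the same coordinate along the ray.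
theorem chi_side (h : IsRectilinear P) (z : Bool → ℤ) : Corr.chi (side P) k false z =
    ∑ i ∈ Finset.range (2 * k + 2), if CrossesEdge P z i then 1 else 0 := by
  let b : Bool → ℕ → ZMod 2 := fun x i => if coord x (vertex P i) ≤ z x then 1 else 0
  let g : ℕ → ZMod 2 := fun i => (1 + b false i) * (b true i + b true (i + 1))
  have hg : ∀ i ∈ Finset.range (2 * k + 2), (if CrossesEdge P z i then 1 else 0) = g i := by
    intro i _
    have hce : CrossesEdge P z i ↔ ¬ coord false (vertex P i) ≤ z false ∧
        ¬ (coord true (vertex P i) ≤ z true ↔ coord true (vertex P (i + 1)) ≤ z true) := by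
      rw [CrossesEdge, not_le]
    simp only [g, b, hce]
    by_cases h1 : coord false (vertex P i) ≤ z false <;>
      by_cases h2 : coord true (vertex P i) ≤ z true <;>
      by_cases h3 : coord true (vertex P (i + 1)) ≤ z true <;>
      simp only [h1, h2, h3, not_true_eq_false, not_false_eq_true, iff_self, iff_true, iff_false,
        true_and, false_and, if_true, if_false] <;> decide
  have h1 : ∀ i, Corr.crosses (side P) z false true i = g i := fun i => rfl
  have h2 : ∀ i ∈ Finset.range k, Corr.crosses (side P) z false true (i + 1) +
      Corr.crosses (side P) z false false (i + 1) = g (i + 1) + g (k + 2 + (k - 1 - i)) := by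
    intro i hi
    have hik : i < k := Finset.mem_range.mp hi
    rw [h1]
    congr 1
    have e : k + 2 + (k - 1 - i) = 2 * k + 2 - (i + 1) := by omega
    simp only [Corr.crosses, Corr.before, side_false _ (show i + 1 ≤ 2 * k + 2 by omega),
      side_false_succ, ← e]
    have key : ∀ p q p' q' : ZMod 2, p = p' ∨ q = q' → (1 + p') * (q' + q) = (1 + p) * (q + q') := by
      decide
    refine key _ _ _ _ ?_
    have := (coord_axis h (k + 2 + (k - 1 - i))).1
    cases ha : axis P (k + 2 + (k - 1 - i)) <;> rw [ha] at this
    · right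
      simp only [Bool.not_false] at this ⊢
      rw [this]
    · left
      simp only [Bool.not_true, b] at this ⊢
      rw [this]
  rw [Finset.sum_congr rfl hg, Corr.chi, Corr.sum_edges (Corr.crosses (side P) z false),
    Finset.sum_congr rfl h2, Finset.sum_add_distrib,
    Finset.sum_range_reflect (fun i => g (k + 2 + i)) k, h1, h1,
    show 2 * k + 2 = k + 2 + k by omega, Finset.sum_range_add, Finset.sum_range_succ _ (k + 1),
    Finset.sum_range_succ' _ k]
  ring

/-- Membership in the region depends on the parity of the cell that contains the point. -/
theorem mem_region_iff (h : IsRectilinear P) (p : ℝ × ℝ) : p ∈ region P ↔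
    (∃ i, p ∈ edge P i) ∨ Corr.chi (side P) k false (fun x => ⌊realCoord x p⌋) ≠ 0 := by
  classical
  have hv : ∀ i : Fin (2 * k + 2), P i = vertex P i ∧ P (i + 1) = vertex P (i + 1) := by
    intro i
    have e : Fin.ofNat (2 * k + 2) i = i := by
      ext
      simp
    have := vertex_succ P i
    rw [e] at this
    exact ⟨by rw [vertex, e], this⟩
  have hc : ∀ i : Fin (2 * k + 2), (edgeVertical P i ∧ p.1 < ((P i).1 : ℝ) ∧
      min ((P i).2 : ℝ) (P (i + 1)).2 ≤ p.2 ∧ p.2 < max ((P i).2 : ℝ) (P (i + 1)).2) ↔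
      CrossesEdge P (fun x => ⌊realCoord x p⌋) i := by
    intro i
    have e1 : ∀ q : ℕ × ℕ, p.1 < (q.1 : ℝ) ↔ ⌊p.1⌋ < (q.1 : ℤ) := fun q => by
      rw [Int.floor_lt, Int.cast_natCast]
    have e2 : ∀ q : ℕ × ℕ, (q.2 : ℝ) ≤ p.2 ↔ (q.2 : ℤ) ≤ ⌊p.2⌋ := fun q => by
      rw [Int.le_floor, Int.cast_natCast]
    rw [edgeVertical, (hv i).1, (hv i).2, min_le_iff, lt_max_iff, ← not_le, ← not_le, ← not_le, e2, e2]
    rw [not_le, e1]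
    simp only [CrossesEdge, realCoord, coord, if_true, Bool.false_eq_true, if_false]
    have ha := (coord_axis h i)
    cases hax : axis P i <;> rw [hax] at ha <;>
      simp only [coord, Bool.not_false, Bool.not_true, Bool.false_eq_true, if_true, if_false] at ha <;>
      omega
  unfold region
  rw [Set.mem_ofPred_eq]
  refine or_congr Iff.rfl ?_
  rw [← ZMod.natCast_ne_zero_iff_odd, chi_side h, Finset.sum_range, Set.ncard_eq_toFinset_card']
  rw [Set.toFinset_ofPred, Finset.card_filter]
  push_cast
  simp only [hc]

end Corridor

/-! ## The instance given by a path corridor -/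

namespace Corridor

variable {k : ℕ} {P : Fin (2 * k + 2) → ℕ × ℕ}

/-- The length of an item along the axis `x`. -/
def Item.length (a : Item) (x : Bool) : ℕ := if x then a.h else a.w

theorem mem_placedAt_iff (a : Item) (q p : ℝ × ℝ) : p ∈ a.placedAt q ↔
    ∀ x, realCoord x q < realCoord x p ∧ realCoord x p < realCoord x q + a.length x := by
  simp [Item.placedAt, realCoord, Item.length, Bool.forall_bool]

/-- If a placed item is contained in the region, then the cells of its rounded position have odd
parity. -/
theorem chi_ne_zero_of_subset (h : IsRectilinear P) {a : Item} {q : ℝ × ℝ}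
    (hq : a.placedAt q ⊆ region P) {z : Bool → ℤ}
    (hz : ∀ x, ⌊realCoord x q⌋ ≤ z x ∧ z x < ⌊realCoord x q⌋ + a.length x) :
    Corr.chi (side P) k false z ≠ 0 := by
  -- Rounding moves an item by less than 1, so each cell of the rounded item still meets the open
  -- item. The point is taken in the interior of the cell, where no edge passes because the vertices
  -- are integral.
  have hr : ∀ x, ∃ r : ℝ, ((z x : ℝ) < r ∧ r < z x + 1) ∧ realCoord x q < r ∧
      r < realCoord x q + a.length x := by
    intro x
    obtain ⟨h1, h2⟩ := hz x
    have h3 := Int.lt_floor_add_one (realCoord x q)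
    have h4 := Int.floor_le (realCoord x q)
    have h5 : (⌊realCoord x q⌋ : ℝ) ≤ z x := by exact_mod_cast h1
    have h6 : (z x : ℝ) + 1 ≤ ⌊realCoord x q⌋ + a.length x := by exact_mod_cast h2
    obtain ⟨r, h7, h8⟩ : ∃ r, max (z x : ℝ) (realCoord x q) < r ∧
        r < min ((z x : ℝ) + 1) (realCoord x q + a.length x) := by
      refine exists_between (max_lt (lt_min ?_ ?_) (lt_min ?_ ?_)) <;> linarith
    rw [max_lt_iff] at h7
    rw [lt_min_iff] at h8
    exact ⟨r, ⟨h7.1, h8.1⟩, h7.2, h8.2⟩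
  choose r hr1 hr2 using hr
  obtain ⟨p, hp⟩ : ∃ p, ∀ x, realCoord x p = r x :=
    ⟨point false (r false) (r true), fun x => by cases x <;> rfl⟩
  have hfl : (fun x => ⌊realCoord x p⌋) = z := by
    funext x
    rw [hp, Int.floor_eq_iff]
    exact ⟨(hr1 x).1.le, (hr1 x).2⟩
  have hmem := hq ((mem_placedAt_iff a q p).mpr fun x => by rw [hp]; exact hr2 x)
  rw [mem_region_iff h, hfl] at hmem
  refine hmem.resolve_left ?_
  rintro ⟨i, hi⟩
  have e : Fin.ofNat (2 * k + 2) i = i := by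
    ext
    simp
  rw [← e, mem_edge_iff h] at hi
  have h1 := hi (!axis P i)
  have h2 := hr1 (!axis P i)
  rw [← (coord_axis h i).1, min_self, max_self, hp] at h1
  have h3 := le_antisymm h1.2 h1.1
  rw [h3] at h2
  have h4 : z (!axis P i) < coord (!axis P i) (vertex P i) := by exact_mod_cast h2.1
  have h5 : coord (!axis P i) (vertex P i) < z (!axis P i) + 1 := by exact_mod_cast h2.2
  omega

/-- Disjoint open rectangles are separated along some axis, and as the sizes are integral, rounding
down preserves the inequality. -/
theorem floor_separated {a b : Item} {q r : ℝ × ℝ}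
    (h : Disjoint (a.placedAt q) (b.placedAt r)) :
    ∃ x, ⌊realCoord x q⌋ + a.length x ≤ ⌊realCoord x r⌋ ∨
      ⌊realCoord x r⌋ + b.length x ≤ ⌊realCoord x q⌋ := by
  have hmono : ∀ (s t : ℝ) (m : ℕ), s + m ≤ t → ⌊s⌋ + (m : ℤ) ≤ ⌊t⌋ := fun s t m hst => by
    rw [← Int.floor_add_natCast]
    exact Int.floor_mono hst
  obtain ⟨x, hx⟩ : ∃ x, realCoord x q + a.length x ≤ realCoord x r ∨
      realCoord x r + b.length x ≤ realCoord x q := by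
    by_contra! hcon
    have hpos : ∀ (c : Item) x, (0 : ℝ) < c.length x := fun c x => by
      cases x
      · exact Nat.cast_pos.mpr c.w_pos
      · exact Nat.cast_pos.mpr c.h_pos
    have hs : ∀ x, ∃ s, max (realCoord x q) (realCoord x r) < s ∧
        s < min (realCoord x q + a.length x) (realCoord x r + b.length x) := fun x => by
      have h1 := hcon x
      have h2 := hpos a x
      have h3 := hpos b x
      refine exists_between (max_lt (lt_min ?_ ?_) (lt_min ?_ ?_)) <;> linarith
    choose s hs1 hs2 using hs
    simp only [max_lt_iff] at hs1
    simp only [lt_min_iff] at hs2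
    obtain ⟨p, hp⟩ : ∃ p, ∀ x, realCoord x p = s x :=
      ⟨point false (s false) (s true), fun x => by cases x <;> rfl⟩
    have hdis := Set.disjoint_left.mp h
    refine hdis (a := p) ((mem_placedAt_iff _ _ _).mpr fun x => ?_)
      ((mem_placedAt_iff _ _ _).mpr fun x => ?_) <;> rw [hp]
    exacts [⟨(hs1 x).1, (hs2 x).1⟩, ⟨(hs1 x).2, (hs2 x).2⟩]
  exact ⟨x, hx.imp (hmono _ _ _) (hmono _ _ _)⟩

variable {n γ : ℕ}

/-- The instance of the packing problem. -/
def inst (N : ℕ) (P : Fin (2 * k + 2) → ℕ × ℕ) (I : Fin n → Item) (col : Fin n → Fin γ) : Inst where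
  N := N
  k := k
  n := n
  γ := γ
  px i := (vertex P i).1
  py i := (vertex P i).2
  w a := if h : a < n then (I ⟨a, h⟩).w else 0
  h a := if h : a < n then (I ⟨a, h⟩).h else 0
  col a := if h : a < n then col ⟨a, h⟩ else 0

variable {N : ℕ} {I : Fin n → Item} {col : Fin n → Fin γ}

theorem inst_w (i : Fin n) : (inst N P I col).w i = (I i).w := dif_pos i.2

theorem inst_h (i : Fin n) : (inst N P I col).h i = (I i).h := dif_pos i.2

theorem inst_col (i : Fin n) : (inst N P I col).col i = col i := dif_pos i.2

theorem inst_parity (h : IsRectilinear P) (x y : ℕ) : (inst N P I col).parity x y = 1 ↔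
    Corr.chi (side P) k false (fun b => if b then (y : ℤ) else x) ≠ 0 := by
  classical
  have h1 : ∀ i ∈ Finset.range (2 * k + 2), RAM.truth ((inst N P I col).Cross x y i) =
      if CrossesEdge P (fun b => if b then (y : ℤ) else x) i then 1 else 0 := by
    intro i hi
    have hv : vertex P ((inst N P I col).next i) = vertex P (i + 1) := by
      unfold Inst.next
      split_ifs with h'
      · have := vertex_add P 0
        rw [zero_add] at this
        rw [← this]
        congr 1
        exact h'.symm
      · rfl
    have : (inst N P I col).Cross x y i ↔ CrossesEdge P (fun b => if b then (y : ℤ) else x) i := by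
      unfold Inst.Cross CrossesEdge
      simp only [inst, coord, if_true, Bool.false_eq_true, if_false, Nat.cast_lt, Nat.cast_le]
      have hv' := congrArg Prod.snd hv
      simp only [inst] at hv'
      rw [hv']
    unfold RAM.truth
    simp only [this]
  have h2 : ((inst N P I col).parity x y : ZMod 2) =
      Corr.chi (side P) k false (fun b => if b then (y : ℤ) else x) := by
    rw [chi_side h, Inst.parity, ZMod.natCast_mod]
    change (((∑ i ∈ Finset.range (2 * k + 2), _ : ℕ)) : ZMod 2) = _
    rw [Finset.sum_congr rfl h1]
    push_cast
    rfl
  rw [← h2, ZMod.natCast_ne_zero_iff_odd, Nat.odd_iff, Inst.parity, Nat.mod_mod]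

/-- A packing of the instance is a packing of the items. -/
theorem colorfulPacking_of_colorful (h : IsRectilinear P) (hD : (inst N P I col).Colorful) :
    ColorfulPacking I col (region P) := by
  classical
  obtain ⟨A, X, Y, hP, hA⟩ := hD
  refine ⟨Finset.univ.filter fun i => (i : ℕ) ∈ A, fun d => ?_, fun i => ((X i : ℝ), (Y i : ℝ)), ?_, ?_⟩
  · obtain ⟨a, ha, had⟩ := hA d d.2
    have han := hP.lt a ha
    refine ⟨⟨a, han⟩, ⟨by simpa using ha, ?_⟩, ?_⟩
    · ext
      rw [← had, ← inst_col (N := N) (P := P) (I := I) (col := col)]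
    · rintro j ⟨hj, hjd⟩
      ext
      refine hP.color _ (by simpa using hj) _ ha ?_
      rw [inst_col, hjd, had]
  · intro i hi p hp
    rw [mem_placedAt_iff] at hp
    have hi' : (i : ℕ) ∈ A := by simpa using hi
    rw [mem_region_iff h]
    right
    have h1 := hp false
    have h2 := hp true
    simp only [realCoord, Item.length, Bool.false_eq_true, if_true, if_false] at h1 h2
    have e1 : (X i : ℤ) ≤ ⌊p.1⌋ := Int.le_floor.mpr (by exact_mod_cast h1.1.le)
    have e2 : ⌊p.1⌋ < X i + (I i).w := Int.floor_lt.mpr (by exact_mod_cast h1.2)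
    have e3 : (Y i : ℤ) ≤ ⌊p.2⌋ := Int.le_floor.mpr (by exact_mod_cast h2.1.le)
    have e4 : ⌊p.2⌋ < Y i + (I i).h := Int.floor_lt.mpr (by exact_mod_cast h2.2)
    have := hP.cells i hi' (⌊p.1⌋ - X i).toNat (by rw [inst_w]; omega) (⌊p.2⌋ - Y i).toNat
      (by rw [inst_h]; omega)
    rw [inst_parity h] at this
    convert this using 2
    funext b
    cases b
    · simp [realCoord]
      omega
    · simp [realCoord]
      omega
  · intro i hi j hj hij
    have hd := hP.disjoint i (by simpa using hi) j (by simpa using hj) (fun h => hij (Fin.ext h))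
    rw [inst_w, inst_w, inst_h, inst_h] at hd
    rw [Set.disjoint_left]
    intro p hp hp'
    simp only [Item.placedAt, Set.mem_prod, Set.mem_Ioo] at hp hp'
    obtain ⟨⟨a1, a2⟩, a3, a4⟩ := hp
    obtain ⟨⟨b1, b2⟩, b3, b4⟩ := hp'
    rcases hd with hd | hd | hd | hd <;> rify at hd <;> linarith

end Corridor

theorem Inst.minSide_le_side (D : Inst) {m a : ℕ} (ha : a < m) :
    D.minSide m ≤ max (D.w a) (D.h a) := by
  induction m with
  | zero => omega
  | succ m ih =>
    rcases Nat.lt_succ_iff_lt_or_eq.mp ha with h | rfl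
    · exact (min_le_left _ _).trans (ih h)
    · exact min_le_right _ _

theorem Inst.le_minSide (D : Inst) {m : ℕ} {x : ℝ} (hN : x ≤ D.N)
    (h : ∀ a < m, x ≤ (max (D.w a) (D.h a) : ℕ)) : x ≤ D.minSide m := by
  induction m with
  | zero => exact hN
  | succ m ih =>
    rw [minSide, Nat.cast_min]
    exact le_min (ih fun a ha => h a (ha.trans m.lt_succ_self)) (h m m.lt_succ_self)

/-! ### From a packing with real positions to acceptance. -/

namespace Corridor

variable {k : ℕ} {P : Fin (2 * k + 2) → ℕ × ℕ} {n γ N : ℕ} {I : Fin n → Item} {col : Fin n → Fin γ}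

/-- Such a cell lies in the bounding rectangle of a subcorridor, whose corners have coordinates of
vertices. -/
theorem cell_bounds {c : ℕ → ℤ} {w : ℤ} (H : Corr.IsCorr k (side P) (axis P) c w)
    (hN : ∀ i, (P i).1 ≤ N ∧ (P i).2 ≤ N) {z : Bool → ℤ} (hz : Corr.chi (side P) k false z ≠ 0)
    (x : Bool) : 0 ≤ z x ∧ z x < N := by
  obtain ⟨i, -, -, hi⟩ := H.exists_mem hz
  have hs : ∀ s j, 0 ≤ side P x s j ∧ side P x s j ≤ N := by
    intro s j
    have := hN (Fin.ofNat _ (if s then j else 2 * k + 3 - j))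
    cases x
    · exact ⟨Int.natCast_nonneg _, Int.ofNat_le.mpr this.1⟩
    · exact ⟨Int.natCast_nonneg _, Int.ofNat_le.mpr this.2⟩
  have h1 := hi x
  have h2 := hs true i
  have h3 := hs false i
  have h4 := hs true (i + 1)
  have h5 := hs false (i + 1)
  simp only [Corr.Rlo, Corr.Rhi, Corr.elo, Corr.ehi] at h1
  omega

/-- The long side exceeds `l * N`, twice the bound on the widths of subcorridors; the short side is
at most `εs * N`, so the long one is the maximum. -/
theorem Item.IsSkewed.long {εs l : ℝ} {a : Item} (h : a.IsSkewed εs l N) (hε : εs < l) :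
    ∃ x, 2 * (⌈l * N / 2⌉ - 1) + 1 ≤ (a.length x : ℤ) ∧ max a.w a.h ≤ a.length x := by
  have key : ∀ m : ℕ, l * N < m → 2 * (⌈l * N / 2⌉ - 1) + 1 ≤ (m : ℤ) := by
    intro m hm
    have h1 := Int.ceil_lt_add_one (l * N / 2)
    have h2 : (2 * ⌈l * N / 2⌉ : ℝ) < m + 2 := by linarith
    have h3 : 2 * ⌈l * N / 2⌉ < (m : ℤ) + 2 := by exact_mod_cast h2
    omega
  have hle : εs * N ≤ l * N := mul_le_mul_of_nonneg_right hε.le (Nat.cast_nonneg N)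
  rcases h with ⟨h1, h2⟩ | ⟨h1, h2⟩
  · refine ⟨false, key _ h1, max_le le_rfl ?_⟩
    have : (a.h : ℝ) ≤ a.w := by linarith
    exact_mod_cast this
  · refine ⟨true, key _ h1, max_le ?_ le_rfl⟩
    have : (a.w : ℝ) ≤ a.h := by linarith
    exact_mod_cast this

/-- Packings of the items are found by the algorithm. -/
theorem accepts_of_colorfulPacking {ε εs l : ℝ} (hC : IsPathCorridor ε l N k P) (hε : ε ≤ 1 / 2)
    (hl : 0 < l) (hs : εs < l) (hI : ∀ i, (I i).IsSkewed εs l N)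
    (hL : 0 < (inst N P I col).minSide n) (h : ColorfulPacking I col (region P)) :
    (inst N P I col).Accepts := by
  classical
  obtain ⟨c, H⟩ := hC.isCorr hε hl
  obtain ⟨S, hS, pos, hpos, hdis⟩ := h
  set D := inst N P I col with hD
  have hodd : ∀ i ∈ S, ∀ z : Bool → ℤ, (∀ x, ⌊realCoord x (pos i)⌋ ≤ z x ∧
      z x < ⌊realCoord x (pos i)⌋ + (I i).length x) → Corr.chi (side P) k false z ≠ 0 :=
    fun i hi z hz => chi_ne_zero_of_subset hC.rectilinear (hpos i hi) hz
  have hlen : ∀ i x, 0 < (I i).length x := fun i x => by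
    cases x
    exacts [(I i).w_pos, (I i).h_pos]
  have hbd : ∀ i ∈ S, ∀ x, 0 ≤ ⌊realCoord x (pos i)⌋ ∧
      ⌊realCoord x (pos i)⌋ + (I i).length x ≤ N := by
    intro i hi x
    have h1 := cell_bounds H hC.inside (hodd i hi (fun x => ⌊realCoord x (pos i)⌋) fun x =>
      ⟨le_rfl, by have := hlen i x; omega⟩) x
    have h2 := cell_bounds H hC.inside (hodd i hi (fun x => ⌊realCoord x (pos i)⌋ +
      (I i).length x - 1) fun x => ⟨by have := hlen i x; omega, by omega⟩) x
    exact ⟨h1.1, by omega⟩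
  -- Positions are rounded down; for items of the packing they are nonnegative, so nothing is lost
  -- by passing to natural numbers.
  let lo : Bool → ℕ → ℕ := fun x a => if h : a < n then ⌊realCoord x (pos ⟨a, h⟩)⌋.toNat else 0
  let hi : Bool → ℕ → ℕ := fun x => lo x + if x then D.h else D.w
  have hlo : ∀ i ∈ S, ∀ x, (lo x i : ℤ) = ⌊realCoord x (pos i)⌋ := fun i hi x => by
    simp only [lo, i.2, dif_pos]
    exact Int.toNat_of_nonneg (hbd i hi x).1
  have hhi : ∀ (i : Fin n) x, hi x i = lo x i + (I i).length x := fun i x => by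
    cases x
    · exact congrArg (lo false i + ·) (inst_w i)
    · exact congrArg (lo true i + ·) (inst_h i)
  let A : Finset ℕ := S.image Fin.val
  have hA : ∀ a ∈ A, ∃ i ∈ S, (i : ℕ) = a := fun a ha => by simpa [A] using ha
  have hsep : ∀ a ∈ A, ∀ b ∈ A, a ≠ b → ∃ x, hi x a ≤ lo x b ∨ hi x b ≤ lo x a := by
    intro a ha b hb hab
    obtain ⟨i, hi, rfl⟩ := hA a ha
    obtain ⟨j, hj, rfl⟩ := hA b hb
    obtain ⟨x, hx⟩ := floor_separated (hdis i hi j hj fun h => hab (h ▸ rfl))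
    refine ⟨x, ?_⟩
    rw [hhi, hhi]
    have := hlo i hi x
    have := hlo j hj x
    omega
  have hP : D.Packing A (lo false) (lo true) := by
    refine ⟨?_, ?_, ?_, ?_, ?_⟩
    · intro a ha
      obtain ⟨i, -, rfl⟩ := hA a ha
      exact i.2
    · intro a ha b hb hab
      obtain ⟨i, hi, rfl⟩ := hA a ha
      obtain ⟨j, hj, rfl⟩ := hA b hb
      rw [hD, inst_col, inst_col] at hab
      rw [(hS (col i)).unique ⟨hi, rfl⟩ ⟨hj, Fin.ext hab.symm⟩]
    · intro a ha
      obtain ⟨i, hi, rfl⟩ := hA a ha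
      have h1 := hbd i hi false
      have h2 := hbd i hi true
      have h3 := hlo i hi false
      have h4 := hlo i hi true
      rw [hD, inst_w, inst_h]
      simp only [Item.length, Bool.false_eq_true, if_true, if_false] at h1 h2
      change _ ≤ N ∧ _ ≤ N
      omega
    · intro a ha p hp q hq
      obtain ⟨i, hi, rfl⟩ := hA a ha
      rw [hD, inst_w] at hp
      rw [hD, inst_h] at hq
      rw [hD, inst_parity hC.rectilinear]
      refine hodd i hi _ fun x => ?_
      have h3 := hlo i hi x
      cases x
      · simp only [Item.length, Bool.false_eq_true, if_false]
        omega
      · simp only [Item.length, if_true]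
        omega
    · intro a ha b hb hab
      obtain ⟨x, hx⟩ := hsep a ha b hb hab
      cases x
      · exact hx.elim Or.inl fun h => Or.inr (Or.inr (Or.inl h))
      · exact hx.elim (fun h => Or.inr (Or.inl h)) fun h => Or.inr (Or.inr (Or.inr h))
  obtain ⟨cls, hchain⟩ := H.exists_chain (A := A) (lo := lo) (hi := hi) (N := N) (L := D.minSide n)
    (q := D.width) (fun a ha x => by
      obtain ⟨i, -, rfl⟩ := hA a ha
      have := hlen i x
      rw [hhi]
      omega) (fun a ha x => by
      obtain ⟨i, hi, rfl⟩ := hA a ha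
      have := hbd i hi x
      have := hlo i hi x
      rw [hhi]
      omega) hsep (fun a ha z hz => by
      obtain ⟨i, hi, rfl⟩ := hA a ha
      rw [H.chi_comm]
      refine hodd i hi z fun x => ?_
      have h1 := hz x
      have h2 := hlo i hi x
      simp only [hhi] at h1
      push_cast at h1
      omega) (fun a ha => by
      obtain ⟨i, -, rfl⟩ := hA a ha
      obtain ⟨x, h1, h2⟩ := (hI i).long hs
      refine ⟨x, ?_, ?_⟩
      · rw [hhi]
        push_cast
        linarith
      · rw [hhi]
        have := D.minSide_le_side i.2
        rw [show D.w i = (I i).w from inst_w i, show D.h i = (I i).h from inst_h i] at this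
        have := this.trans h2
        omega) (by rw [mul_comm]; exact Nat.lt_mul_div_succ N hL)
  refine Inst.accepts_of_chain hP (fun a ha => ?_) (fun a ha => ?_) (fun d hd => ?_) rfl rfl rfl rfl
    hchain
  · exact (inst_w (N := N) (P := P) (I := I) (col := col) ⟨a, ha⟩) ▸ (I ⟨a, ha⟩).w_pos
  · exact (inst_col (N := N) (P := P) (I := I) (col := col) ⟨a, ha⟩) ▸ (col ⟨a, ha⟩).2
  · obtain ⟨i, ⟨hi, hid⟩, -⟩ := hS ⟨d, hd⟩
    exact ⟨i, Finset.mem_image_of_mem _ hi, by rw [hD, inst_col, hid]⟩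

end Corridor

/-! ## The encoding of the input -/

theorem getD_flatMap {α β : Type*} (f : α → List β) {c : ℕ} (hf : ∀ x, (f x).length = c) (d : β)
    {j : ℕ} (hj : j < c) (l : List α) (i : ℕ) (hi : i < l.length) :
    (l.flatMap f).getD (c * i + j) d = (f l[i]).getD j d := by
  induction l generalizing i with
  | nil => simp at hi
  | cons x l ih =>
    rw [List.flatMap_cons]
    rcases i with _ | i
    · rw [Nat.mul_zero, Nat.zero_add, List.getD_append _ _ _ _ (by rw [hf]; exact hj)]
      rfl
    · rw [List.getD_append_right _ _ _ _ (by rw [hf, Nat.mul_succ]; omega), hf,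
        show c * (i + 1) + j - c = c * i + j by rw [Nat.mul_succ]; omega,
        ih i (by simpa using hi)]
      rfl

namespace Corridor

variable {k : ℕ} {P : Fin (2 * k + 2) → ℕ × ℕ} {n γ N : ℕ} {I : Fin n → Item} {col : Fin n → Fin γ}

theorem encode_vertex {j : ℕ} (hj : j < 2) (i : Fin (2 * k + 2)) :
    (encode N P I col).getD (4 + (i + i) + j) 0 = [(P i).1, (P i).2].getD j 0 := by
  have hlen : ((List.finRange (2 * k + 2)).flatMap fun i => [(P i).1, (P i).2]).length =
      2 * (2 * k + 2) := by
    simp [List.length_flatMap, mul_comm]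
  have h := getD_flatMap (fun i => [(P i).1, (P i).2]) (c := 2) (fun _ => rfl) 0 hj
    (List.finRange (2 * k + 2)) i (by simp)
  rw [encode, List.append_assoc, List.getD_append_right _ _ _ _ (by simp; omega),
    List.getD_append _ _ _ _ (by rw [hlen]; simp; omega)]
  simp only [List.getElem_finRange] at h
  rw [show 4 + ((i : ℕ) + i) + j - [N, k, n, γ].length = 2 * i + j by simp; omega, h]
  simp

theorem encode_item {j : ℕ} (hj : j < 3) (a : Fin n) :
    (encode N P I col).getD (8 + (k + k + (k + k)) + (a + (a + a)) + j) 0 =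
      [(I a).w, (I a).h, (col a : ℕ)].getD j 0 := by
  have hlen : ((List.finRange (2 * k + 2)).flatMap fun i => [(P i).1, (P i).2]).length =
      2 * (2 * k + 2) := by
    simp [List.length_flatMap, mul_comm]
  have h := getD_flatMap (fun i => [(I i).w, (I i).h, (col i : ℕ)]) (c := 3) (fun _ => rfl) 0 hj
    (List.finRange n) a (by simp)
  rw [encode, List.getD_append_right _ _ _ _ (by rw [List.length_append, hlen]; simp; omega),
    List.length_append, hlen]
  simp only [List.getElem_finRange] at h
  rw [show 8 + (k + k + (k + k)) + ((a : ℕ) + (a + a)) + j -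
    ([N, k, n, γ].length + 2 * (2 * k + 2)) = 3 * a + j by simp; omega, h]
  simp

theorem holds_encode : (inst N P I col).Holds (RAM.init (encode N P I col)).mem := by
  have hv : ∀ i, (hi : i < 2 * k + 2) → vertex P i = P ⟨i, hi⟩ := fun i hi => by
    rw [vertex]
    congr 1
    ext
    simp [Nat.mod_eq_of_lt hi]
  refine ⟨rfl, rfl, rfl, rfl, fun i hi => ?_, fun i hi => ?_, fun a ha => ?_, fun a ha => ?_,
    fun a ha => ?_⟩
  · exact (encode_vertex (j := 0) (by omega) ⟨i, hi⟩).trans (congrArg Prod.fst (hv i hi)).symm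
  · rw [show 5 + (i + i) = 4 + (i + i) + 1 by omega]
    exact (encode_vertex (j := 1) (by omega) ⟨i, hi⟩).trans (congrArg Prod.snd (hv i hi)).symm
  · exact (encode_item (j := 0) (by omega) ⟨a, ha⟩).trans (inst_w ⟨a, ha⟩).symm
  · change (encode N P I col).getD (9 + (k + k + (k + k)) + (a + (a + a))) 0 = _
    rw [show 9 + (k + k + (k + k)) + (a + (a + a)) = 8 + (k + k + (k + k)) + (a + (a + a)) + 1 by omega]
    exact (encode_item (j := 1) (by omega) ⟨a, ha⟩).trans (inst_h ⟨a, ha⟩).symm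
  · change (encode N P I col).getD (10 + (k + k + (k + k)) + (a + (a + a))) 0 = _
    rw [show 10 + (k + k + (k + k)) + (a + (a + a)) = 8 + (k + k + (k + k)) + (a + (a + a)) + 2 by omega]
    exact (encode_item (j := 2) (by omega) ⟨a, ha⟩).trans (inst_col ⟨a, ha⟩).symm

end Corridor

/-! ## The running time -/

theorem Inst.size_le (D : Inst) (hN : 3 ≤ D.N) (hn : 1 ≤ D.n) :
    D.size + 2 ≤ (D.n * D.N) ^ 4 * (2 ^ D.γ * D.families) := by
  have hf : 2 ^ (4 * D.slots) ≤ D.families := Nat.pow_le_pow_left (by omega) _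
  have hs : 4 * D.slots < 2 ^ (4 * D.slots) := Nat.lt_two_pow_self
  have hk : D.k ≤ D.slots := Nat.le_mul_of_pos_right _ (Nat.succ_pos _)
  have hγ : D.γ < 2 ^ D.γ := Nat.lt_two_pow_self
  have hg1 : 1 ≤ 2 ^ D.γ := Nat.one_le_two_pow
  have hf1 : 1 ≤ D.families := by omega
  have h1 : 2 ^ D.γ ≤ 2 ^ D.γ * D.families := Nat.le_mul_of_pos_right _ hf1
  have h2 : D.families ≤ 2 ^ D.γ * D.families := Nat.le_mul_of_pos_left _ hg1
  have h3 : D.n ≤ D.n * D.N := Nat.le_mul_of_pos_right _ (by omega)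
  have h4 : D.N ≤ D.n * D.N := Nat.le_mul_of_pos_left _ hn
  set T := 2 ^ D.γ * D.families with hT
  set B := D.n * D.N
  have h5 : D.size + 2 ≤ 10 * T + 2 * B := by
    unfold size states
    rw [← hT]
    omega
  have h6 : 12 ≤ B ^ 3 := by
    have : 3 ^ 3 ≤ B ^ 3 := Nat.pow_le_pow_left (by omega) 3
    omega
  have h7 : T ≤ T * B := Nat.le_mul_of_pos_right _ (by omega)
  have h8 : B ≤ T * B := Nat.le_mul_of_pos_left _ (by omega)
  calc D.size + 2 ≤ 12 * (T * B) := by omega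
    _ ≤ B ^ 3 * (T * B) := Nat.mul_le_mul_right _ h6
    _ = B ^ 4 * T := by ring

/-- The width is at most `1 / l`, and the additional box per subcorridor at most doubles this
because `l ≤ 1`. -/
theorem Inst.slots_le (D : Inst) {l : ℝ} (hl : 0 < l) (hl1 : l ≤ 1) (hN : 0 < D.N)
    (hL : l * D.N ≤ D.minSide D.n) : (D.slots : ℝ) ≤ 2 * (D.k / l) := by
  have hN' : (0 : ℝ) < D.N := Nat.cast_pos.mpr hN
  have h1 : (D.width : ℝ) ≤ 1 / l := by
    refine Nat.cast_div_le.trans ((div_le_div_of_nonneg_left hN'.le (by positivity) hL).trans ?_)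
    rw [div_le_div_iff₀ (by positivity) hl]
    linarith
  have h2 : (1 : ℝ) ≤ 1 / l := by rwa [le_div_iff₀ hl, one_mul]
  calc (D.slots : ℝ) = D.k * (D.width + 1) := by
        unfold slots
        push_cast
        ring
    _ ≤ D.k * (2 * (1 / l)) := by gcongr; linarith
    _ = 2 * (D.k / l) := by ring

/-- With `B = n * N`, the inequality `N + 1 ≤ B ^ 2` bounds the number of families by `B` to the
power `8 * slots`, hence `16 * k / l`. The remaining `B ^ 4` of `Inst.size_le` fits into `4 * k /
l`, since `k / l ≥ 1`; this explains the constant 20. -/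
theorem Inst.time_le (D : Inst) {l : ℝ} (hl : 0 < l) (hl1 : l ≤ 1) (hN : 3 ≤ D.N) (hn : 1 ≤ D.n)
    (hk : 1 ≤ D.k) (hL : l * D.N ≤ D.minSide D.n) (e : ℕ) : (((D.size + 2) ^ e : ℕ) : ℝ) ≤
      ((D.n : ℝ) * D.N) ^ (((20 * e : ℕ) : ℝ) * D.k / l) * (2 : ℝ) ^ (20 * e * D.γ) := by
  have hs := D.slots_le hl hl1 (by omega) hL
  have hnN : D.N ≤ D.n * D.N := Nat.le_mul_of_pos_left _ hn
  have hB : (1 : ℝ) ≤ (D.n : ℝ) * D.N := by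
    have : 1 ≤ D.n * D.N := by omega
    exact_mod_cast this
  set B : ℝ := (D.n : ℝ) * D.N with hBdef
  have hM : 1 ≤ (D.k : ℝ) / l := by
    rw [le_div_iff₀ hl, one_mul]
    exact hl1.trans (by exact_mod_cast hk)
  have hfam : (D.families : ℝ) ≤ B ^ (16 * ((D.k : ℝ) / l)) := by
    have h1 : ((D.N + 1 : ℕ) : ℝ) ≤ B ^ 2 := by
      have : D.N + 1 ≤ (D.n * D.N) ^ 2 := by nlinarith
      rw [hBdef]
      exact_mod_cast this
    calc (D.families : ℝ) = ((D.N + 1 : ℕ) : ℝ) ^ (4 * D.slots) := by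
          unfold families
          push_cast
          rfl
      _ ≤ (B ^ 2) ^ (4 * D.slots) := pow_le_pow_left₀ (Nat.cast_nonneg _) h1 _
      _ = B ^ ((8 * D.slots : ℕ) : ℝ) := by
          rw [← pow_mul, Real.rpow_natCast]
          congr 1
          ring
      _ ≤ B ^ (16 * ((D.k : ℝ) / l)) := by
          refine Real.rpow_le_rpow_of_exponent_le hB ?_
          push_cast
          linarith
  have hsize : ((D.size + 2 : ℕ) : ℝ) ≤ B ^ (20 * ((D.k : ℝ) / l)) * 2 ^ D.γ := by
    calc ((D.size + 2 : ℕ) : ℝ) ≤ (((D.n * D.N) ^ 4 * (2 ^ D.γ * D.families) : ℕ) : ℝ) :=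
          Nat.cast_le.mpr (D.size_le hN hn)
      _ = B ^ 4 * D.families * 2 ^ D.γ := by
          push_cast
          ring
      _ ≤ B ^ (4 * ((D.k : ℝ) / l)) * B ^ (16 * ((D.k : ℝ) / l)) * 2 ^ D.γ := by
          gcongr
          rw [← Real.rpow_natCast]
          refine Real.rpow_le_rpow_of_exponent_le hB ?_
          push_cast
          linarith
      _ = B ^ (20 * ((D.k : ℝ) / l)) * 2 ^ D.γ := by
          rw [← Real.rpow_add (by linarith)]
          ring_nf
  calc (((D.size + 2) ^ e : ℕ) : ℝ) = ((D.size + 2 : ℕ) : ℝ) ^ e := by push_cast; rfl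
    _ ≤ (B ^ (20 * ((D.k : ℝ) / l)) * 2 ^ D.γ) ^ e := pow_le_pow_left₀ (Nat.cast_nonneg _) hsize e
    _ = B ^ (((20 * e : ℕ) : ℝ) * D.k / l) * (2 : ℝ) ^ (e * D.γ) := by
        rw [mul_pow, ← Real.rpow_mul_natCast (by linarith), ← pow_mul, mul_comm D.γ e]
        congr 2
        push_cast
        ring
    _ ≤ B ^ (((20 * e : ℕ) : ℝ) * D.k / l) * (2 : ℝ) ^ (20 * e * D.γ) := by
        gcongr
        · norm_num
        · omega

theorem RAM.DecidesWithin.mono {p : Prog} {input : List ℕ} {a b : Prop} {s t : ℝ}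
    (h : DecidesWithin p input a s) (hab : a ↔ b) (hst : s ≤ t) : DecidesWithin p input b t := by
  obtain ⟨σ, m, h1, h2, h3, h4⟩ := h
  exact ⟨σ, m, h1, h2.trans hst, fun hb => h3 (hab.mpr hb), fun hb => h4 (mt hab.mp hb)⟩


/-- A subcorridor has width at least 1 and at most `⌈l * N / 2⌉ - 1`, which forces `l * N > 2`. -/
theorem Corridor.IsPathCorridor.three_le {ε l : ℝ} {N k : ℕ} {P : Fin (2 * k + 2) → ℕ × ℕ}
    (h : IsPathCorridor ε l N k P) (hε : ε ≤ 1 / 2) (hl : 0 < l) (hl1 : l ≤ 1) : 3 ≤ N := by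
  obtain ⟨c, H⟩ := h.isCorr hε hl
  have h1 := H.cross_ne le_rfl h.one_le
  have h2 := H.width 1 le_rfl h.one_le
  have h3 : 1 < ⌈l * N / 2⌉ := by
    have := abs_pos.mpr (sub_ne_zero.mpr h1)
    omega
  rw [Int.lt_ceil] at h3
  push_cast at h3
  have h4 : l * N ≤ 1 * N := mul_le_mul_of_nonneg_right hl1 (Nat.cast_nonneg N)
  have h5 : (2 : ℝ) < N := by linarith
  exact_mod_cast h5

theorem mainTheorem7 :
    ∃ (A : RAM.Prog) (c : ℕ),
      ∀ (ε εsmall εlarge : ℝ), 0 < ε → ε ≤ 1 / 2 → 0 < εsmall → εsmall < εlarge → εlarge ≤ 1 →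
      ∀ (N k n γ : ℕ), 0 < n →
      ∀ (P : Fin (2 * k + 2) → ℕ × ℕ), Corridor.IsPathCorridor ε εlarge N k P →
      ∀ (I : Fin n → Corridor.Item), (∀ i, (I i).IsSkewed εsmall εlarge N) →
      ∀ (col : Fin n → Fin γ),
        RAM.DecidesWithin A (Corridor.encode N P I col)
          (Corridor.ColorfulPacking I col (Corridor.region P))
          (((n : ℝ) * (N : ℝ)) ^ ((c : ℝ) * (k : ℝ) / εlarge) * (2 : ℝ) ^ (c * γ)) := by
  obtain ⟨e, he⟩ := RAM.exists_algorithm_spec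
  refine ⟨RAM.algorithm, 20 * e, ?_⟩
  intro ε εs l _ hε _ hs hl1 N k n γ hn P hP I hI col
  have hl : 0 < l := by linarith
  have hN := hP.three_le hε hl hl1
  have hL : l * N ≤ (Corridor.inst N P I col).minSide n := by
    refine Inst.le_minSide _ (mul_le_of_le_one_left (Nat.cast_nonneg N) hl1) fun a ha => ?_
    rw [show (Corridor.inst N P I col).w a = (I ⟨a, ha⟩).w from Corridor.inst_w ⟨a, ha⟩,
      show (Corridor.inst N P I col).h a = (I ⟨a, ha⟩).h from Corridor.inst_h ⟨a, ha⟩, Nat.cast_max]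
    rcases hI ⟨a, ha⟩ with h | h
    · exact h.1.le.trans (le_max_left _ _)
    · exact h.1.le.trans (le_max_right _ _)
  have hN' : (0 : ℝ) < N := Nat.cast_pos.mpr (by omega)
  have hL0 : 0 < (Corridor.inst N P I col).minSide n := by
    have : (0 : ℝ) < (Corridor.inst N P I col).minSide n := lt_of_lt_of_le (by positivity) hL
    exact_mod_cast this
  have hcol : ∀ a < n, (Corridor.inst N P I col).col a < γ := fun a ha =>
    (Corridor.inst_col (N := N) (P := P) (I := I) (col := col) ⟨a, ha⟩) ▸ (col ⟨a, ha⟩).2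
  have hw : ∀ a < n, 0 < (Corridor.inst N P I col).w a := fun a ha =>
    (Corridor.inst_w (N := N) (P := P) (I := I) (col := col) ⟨a, ha⟩) ▸ (I ⟨a, ha⟩).w_pos
  refine (he (Corridor.inst N P I col) _ (by change 0 < N; omega) hL0 hcol
    Corridor.holds_encode).mono ⟨fun h => ?_, fun h => ?_⟩ ?_
  · exact Corridor.colorfulPacking_of_colorful hP.rectilinear (h.colorful hw hcol)
  · exact Corridor.accepts_of_colorfulPacking hP hε hl hs hI hL0 h
  · exact (Corridor.inst N P I col).time_le hl hl1 hN hn hP.one_le hL e
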